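/- Let $\mathbb{R}_2^+=\{x\in\mathbb{R}^2: x_2\ge 0\}$, let $\omega:\mathbb{R}_2^+\to\mathbb{R}$, and put $$[\omega]_{C_x^{1/2}}=\sup_{x_2=z_2,\ x_1\neq z_1}\frac{|\omega(x)-\omega(z)|}{|x_1-z_1|^{1/2}},\qquad [\omega]_{C_y^{1/2}}=\sup_{x_1=z_1,\ x_2\neq z_2}\frac{|\omega(x)-\omega(z)|}{|x_2-z_2|^{1/2}},$$ the suprema being taken over $x,z\in\mathbb{R}_2^+$. Let $W$ be the extension of $\omega$ to $\mathbb{R}^2$ that is odd in the second variable ($W(y)=\omega(y)$ for $y_2\ge0$ and $W(y)=-\omega(y_1,-y_2)$ for $y_2<0$), let $Q_a(x)=[x_1-a,x_1+a]\times[x_2-a,x_2+a]$, and for $x_2>0$, $a>0$ set $$u_y(x,a)=\frac1{2\pi}\,\mathrm{P.V.}\!\int_{Q_a(x)}\frac{(x_1-y_1)^2-(x_2-y_2)^2}{|x-y|^4}W(y)\,dy+\frac{\omega(x)}2,$$ $$v_x(x,a)=\frac1{2\pi}\,\mathrm{P.V.}\!\int_{Q_a(x)}\frac{(x_1-y_1)^2-(x_2-y_2)^2}{|x-y|^4}W(y)\,dy-\frac{\omega(x)}2,$$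 where $\mathrm{P.V.}\int_{Q_a(x)}=\lim_{\varepsilon\to0^+}\int_{Q_a(x)\setminus Q_\varepsilon(x)}$. Let $u_y(x,\infty)=\lim_{a\to\infty}u_y(x,a)$ and $v_x(x,\infty)=\lim_{a\to\infty}v_x(x,a)$ for $x_2>0$; at boundary points, $u_y((x_1,0),\infty)$ and $v_x((x_1,0),\infty)$ denote the limits of $u_y((x_1,h),\infty)$ and $v_x((x_1,h),\infty)$ as $h\to0^+$. **Lemma 3.4 ($C_y^{1/2}$ estimate of $u_y$ and $v_x$).** There are constants $C_3(\tau),C_4(\tau)>0$, depending only on $\tau>0$, with $$\frac1\pi C_3(0.582)\le 2.60,\qquad \frac1\pi C_4(0.582)\le 2.61,$$ such that for every $\omega$ with $[\omega]_{C_x^{1/2}},[\omega]_{C_y^{1/2}}<\infty$ all the limits above exist, and for every $\tau>0$ and all $x=(x_1,x_2)\neq z=(x_1,z_2)$ in $\mathbb{R}_2^+$, $$\frac{|v_x(x,\infty)-v_x(z,\infty)|}{|x-z|^{1/2}}\le\frac{C_3(\tau)}\pi\max\!\big([\omega]_{C_x^{1/2}},\tau^{-1}[\omega]_{C_y^{1/2}}\big),$$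 $$\frac{|u_y(x,\infty)-u_y(z,\infty)|}{|x-z|^{1/2}}\le\frac{C_4(\tau)}\pi\max\!\big([\omega]_{C_x^{1/2}},\tau^{-1}[\omega]_{C_y^{1/2}}\big).$$ -/

import Mathlib

open MeasureTheory Filter Topology
open scoped ENNReal

namespace HolderVel

/-- The closed upper half plane `ℝ₂⁺`. -/
def halfPlane : Set (ℝ × ℝ) := {x | 0 ≤ x.2}

/-- Partial Hölder seminorm in the first variable, with values in `[0, ∞]`
(a pair `x = z` contributes `0 / 0 = 0`). -/
noncomputable def semiX (α : ℝ) (D : Set (ℝ × ℝ)) (f : ℝ × ℝ → ℝ) : ℝ≥0∞ :=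
  ⨆ (x ∈ D) (z ∈ D) (_ : x.2 = z.2),
    ENNReal.ofReal |f x - f z| / ENNReal.ofReal (|x.1 - z.1| ^ α)

/-- Partial Hölder seminorm in the second variable, with values in `[0, ∞]`. -/
noncomputable def semiY (α : ℝ) (D : Set (ℝ × ℝ)) (f : ℝ × ℝ → ℝ) : ℝ≥0∞ :=
  ⨆ (x ∈ D) (z ∈ D) (_ : x.1 = z.1),
    ENNReal.ofReal |f x - f z| / ENNReal.ofReal (|x.2 - z.2| ^ α)

/-- The kernel `K₂(y) = (y₁² - y₂²) / (2 |y|⁴)`. -/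
noncomputable def K₂ (y : ℝ × ℝ) : ℝ :=
  1 / 2 * ((y.1 ^ 2 - y.2 ^ 2) / (y.1 ^ 2 + y.2 ^ 2) ^ 2)

/-- The extension `W` of `ω` from the upper half plane to the plane that is odd in `y₂`.
The values of `ω` below the boundary are not used. -/
noncomputable def oddExt (ω : ℝ × ℝ → ℝ) (y : ℝ × ℝ) : ℝ :=
  if 0 ≤ y.2 then ω y else -ω (y.1, -y.2)

/-- The closed square `Q_a(x)` with centre `x` and half side `a`. -/
def sq (x : ℝ × ℝ) (a : ℝ) : Set (ℝ × ℝ) := {y | |x.1 - y.1| ≤ a ∧ |x.2 - y.2| ≤ a}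

/-- The integrand `K₂(x - y) W(y)`. -/
noncomputable def integrand (ω : ℝ × ℝ → ℝ) (x y : ℝ × ℝ) : ℝ := K₂ (x - y) * oddExt ω y

/-- The truncated integral over `Q_a(x) \ Q_ε(x)`. -/
noncomputable def truncInt (ω : ℝ × ℝ → ℝ) (x : ℝ × ℝ) (a ε : ℝ) : ℝ :=
  ∫ y in sq x a \ sq x ε, integrand ω x y

/-- The principal value `P.V. ∫_{Q_a(x)} K₂(x - y) W(y) dy`. -/
noncomputable def pvInt (ω : ℝ × ℝ → ℝ) (x : ℝ × ℝ) (a : ℝ) : ℝ :=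
  limUnder (𝓝[>] 0) (truncInt ω x a)

/-- The localized `u_y(x, a)`. -/
noncomputable def uyLoc (ω : ℝ × ℝ → ℝ) (x : ℝ × ℝ) (a : ℝ) : ℝ :=
  1 / Real.pi * pvInt ω x a + ω x / 2

/-- The localized `v_x(x, a)`. -/
noncomputable def vxLoc (ω : ℝ × ℝ → ℝ) (x : ℝ × ℝ) (a : ℝ) : ℝ :=
  1 / Real.pi * pvInt ω x a - ω x / 2

/-- The non-localized `u_y(x, ∞)`: for `x` in the open half plane, the limit of `u_y(x, a)` as
`a → ∞`; on the boundary, the limit from the interior along the normal. -/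
noncomputable def uyInf (ω : ℝ × ℝ → ℝ) (x : ℝ × ℝ) : ℝ :=
  if 0 < x.2 then limUnder atTop (uyLoc ω x)
  else limUnder (𝓝[>] 0) (fun h : ℝ => limUnder atTop (uyLoc ω (x.1, h)))

/-- The non-localized `v_x(x, ∞)`, with the same conventions. -/
noncomputable def vxInf (ω : ℝ × ℝ → ℝ) (x : ℝ × ℝ) : ℝ :=
  if 0 < x.2 then limUnder atTop (vxLoc ω x)
  else limUnder (𝓝[>] 0) (fun h : ℝ => limUnder atTop (vxLoc ω (x.1, h)))

/-- All the integrals and limits that enter the definitions of `u_y(·, ∞)` and `v_x(·, ∞)`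
exist. -/
def LimitsExist (ω : ℝ × ℝ → ℝ) : Prop :=
  (∀ x : ℝ × ℝ, 0 < x.2 →
    (∀ a ε : ℝ, 0 < ε → IntegrableOn (integrand ω x) (sq x a \ sq x ε)) ∧
    (∀ a : ℝ, 0 < a → Tendsto (truncInt ω x a) (𝓝[>] 0) (𝓝 (pvInt ω x a))) ∧
    Tendsto (uyLoc ω x) atTop (𝓝 (uyInf ω x)) ∧
    Tendsto (vxLoc ω x) atTop (𝓝 (vxInf ω x))) ∧
  (∀ x₁ : ℝ,
    Tendsto (fun h : ℝ => uyInf ω (x₁, h)) (𝓝[>] 0) (𝓝 (uyInf ω (x₁, 0))) ∧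
    Tendsto (fun h : ℝ => vxInf ω (x₁, h)) (𝓝[>] 0) (𝓝 (vxInf ω (x₁, 0))))

end HolderVel

namespace HolderVel

/-! ### Pairing a unimodal profile with a Hölder function: layer cake over level intervals. -/

section IntervalsAndLevelSets

/-! The proof is a transport argument. For two points on a vertical line, the difference of the
principal values is the integral of `W` against the difference of two copies of `K₂`. This
difference decays like the inverse cube of the distance, so the integral converges at infinity
although `W` may grow like a square root; near the two centres convergence comes from subtracting
`W(x)` on a square, which costs nothing because `K₂` has mean zero on square annuli. By scaling, the
centres become `(0, 1/2)` and `(0, -1/2)`. It remains to bound a signed measure of total mass zero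
tested against `W`, together with the local term `±ω/2`, by moving positive mass onto negative mass
at cost `√distance`.

The direction of transport depends on the height. Outside the strip between the centres, mass moves
horizontally, so only the seminorm in `x₁` is used and the jump of the odd extension across the
boundary is harmless. Inside the strip, which lies in the half plane, mass moves vertically and only
the seminorm in `x₂` is used.

Horizontal lines: the kernel difference is minus the derivative of a profile that is nonnegative and
unimodal on the half line. By the layer cake formula its pairing with a Hölder function is at most
the integral over levels of the square root of the length of the level interval
(`abs_integral_neg_deriv_mul_le`). In terms of the length `g` and the sum `p` of the end points of a
level interval, the total cost over all lines has the explicit density `gapDensity`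
(`deriv_mul_gapLevel`). A polynomial majorant splits it into products of one-dimensional
lemniscate-type moments, which yields the constant 5.767 (`lintegral_lineCost_lt`).

Vertical lines in the strip: the kernel is odd about the axis `t = 0`, so it is folded to depths `l`
below a centre. The inversion `l ↦ s² / l` matches negative mass with positive mass in the same half
(`integral_ker_mul_eq`); a nonnegative density `crossDens` is left and is sent across the axis to
its mirror image. Its total mass over the strip is exactly the weight `π/2` of the local term, so
that term can be put under the same integral (`abs_integral_unitDiff_strip_le`). For `v_x` the two
contributions nearly cancel close to the centres. This saving, measured by `nearMass`, brings the
bound below 2.60; for `u_y` there is none.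

The limit over growing squares exists because `W` is odd: the integral around `x` is half the
difference of the integrals around `x` and its mirror image (`HalfHolder.tendsto_pvLimit`). Boundary
values follow from the Hölder bound in the interior by completeness. -/

lemma ordConnected_ae_eq_Ioc {I : Set ℝ} (hI : I.OrdConnected) (hne : I.Nonempty)
    (hb : BddBelow I) (ha : BddAbove I) : I =ᵐ[volume] Set.Ioc (sInf I) (sSup I) := by
  have h1 : Set.Ioo (sInf I) (sSup I) ⊆ I := by
    intro x hx
    obtain ⟨y, hy, hyx⟩ := exists_lt_of_csInf_lt hne hx.1
    obtain ⟨z, hz, hxz⟩ := exists_lt_of_lt_csSup hne hx.2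
    exact hI.out hy hz ⟨hyx.le, hxz.le⟩
  have h2 : I ⊆ Set.Icc (sInf I) (sSup I) := subset_Icc_csInf_csSup hb ha
  have h3 : Set.Ioo (sInf I) (sSup I) =ᵐ[volume] Set.Ioc (sInf I) (sSup I) := Ioo_ae_eq_Ioc
  have h4 : Set.Ioc (sInf I) (sSup I) =ᵐ[volume] Set.Icc (sInf I) (sSup I) := Ioc_ae_eq_Icc
  refine Filter.EventuallyLE.antisymm ?_ ?_
  · exact (LE.le.eventuallyLE h2).trans h4.symm.le
  · exact h3.symm.le.trans (LE.le.eventuallyLE h1)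

/-- Up to a null set `I` is a bounded interval, so the integral is an increment of `v`. This is the
only place where connectedness of level sets enters. -/
lemma abs_setIntegral_deriv_le {v v' : ℝ → ℝ} {A : ℝ} {I : Set ℝ}
    (hd : ∀ s, HasDerivAt v (v' s) s) (hc : Continuous v')
    (hv : ∀ s s', |v s - v s'| ≤ A * √|s - s'|)
    (hI : I.OrdConnected) (hb : BddBelow I) (ha : BddAbove I) :
    |∫ s in I, v' s| ≤ A * √(volume I).toReal := by
  rcases I.eq_empty_or_nonempty with rfl | hne
  · simp
  have hae := ordConnected_ae_eq_Ioc hI hne hb ha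
  have hle : sInf I ≤ sSup I := csInf_le_csSup hne hb ha
  rw [setIntegral_congr_set hae, measure_congr hae, ← intervalIntegral.integral_of_le hle,
    intervalIntegral.integral_eq_sub_of_hasDerivAt (fun x _ => hd x) (hc.intervalIntegrable _ _),
    Real.volume_Ioc, ENNReal.toReal_ofReal (sub_nonneg.2 hle)]
  have := hv (sSup I) (sInf I)
  rwa [abs_of_nonneg (sub_nonneg.2 hle)] at this

/-- The layer cake bound for the pairing of a quasi-concave profile with the derivative of a
Hölder function. -/
lemma abs_integral_mul_deriv_le {H v v' : ℝ → ℝ} {A C : ℝ} (hA : 0 ≤ A)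
    (hd : ∀ s, HasDerivAt v (v' s) s) (hc : Continuous v') (hC : ∀ s, |v' s| ≤ C)
    (hv : ∀ s s', |v s - v s'| ≤ A * √|s - s'|)
    (Hm : Measurable H) (Hnn : ∀ s, 0 < s → 0 ≤ H s) (Hint : IntegrableOn H (Set.Ioi 0))
    (hI : ∀ h : ℝ, 0 < h → {s | 0 < s ∧ h < H s}.OrdConnected)
    (hb : ∀ h : ℝ, 0 < h → BddAbove {s | 0 < s ∧ h < H s}) :
    ENNReal.ofReal |∫ s in Set.Ioi 0, H s * v' s| ≤
      ENNReal.ofReal A * ∫⁻ h in Set.Ioi (0 : ℝ),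
        ENNReal.ofReal (√(volume {s | 0 < s ∧ h < H s}).toReal) := by
  have hS : MeasurableSet {q : ℝ × ℝ | q.2 < H q.1} :=
    measurableSet_lt measurable_snd (Hm.comp measurable_fst)
  have hprod : Integrable (Function.uncurry fun s h : ℝ => {q : ℝ × ℝ | q.2 < H q.1}.indicator
      (fun q => v' q.1) (s, h))
      ((volume.restrict (Set.Ioi 0)).prod (volume.restrict (Set.Ioi 0))) := by
    have hmeas : AEStronglyMeasurable (Function.uncurry fun s h : ℝ =>
        {q : ℝ × ℝ | q.2 < H q.1}.indicator (fun q => v' q.1) (s, h))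
        ((volume.restrict (Set.Ioi 0)).prod (volume.restrict (Set.Ioi 0))) := by
      exact (((hc.measurable.comp measurable_fst).indicator hS)).aestronglyMeasurable
    refine ⟨hmeas, ?_⟩
    rw [hasFiniteIntegral_iff_enorm, lintegral_prod _ (by exact hmeas.enorm)]
    calc _ ≤ ∫⁻ s in Set.Ioi (0 : ℝ), ENNReal.ofReal (C * H s) := by
          refine setLIntegral_mono' measurableSet_Ioi fun s hs => ?_
          have h0 : ∀ h : ℝ, ‖Function.uncurry (fun s h : ℝ => {q : ℝ × ℝ | q.2 < H q.1}.indicator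
              (fun q => v' q.1) (s, h)) (s, h)‖ₑ ≤
              (Set.Iio (H s)).indicator (fun _ => ENNReal.ofReal C) h := by
            intro h
            by_cases hh : h < H s
            · simp only [Function.uncurry, Set.indicator, Set.mem_ofPred_eq, hh, if_true, Set.mem_Iio]
              rw [Real.enorm_eq_ofReal_abs]
              exact ENNReal.ofReal_le_ofReal (hC s)
            · simp [Function.uncurry, Set.indicator, hh]
          calc _ ≤ ∫⁻ h in Set.Ioi (0 : ℝ), (Set.Iio (H s)).indicator (fun _ => ENNReal.ofReal C) h :=
                lintegral_mono h0
            _ = ENNReal.ofReal C * volume (Set.Ioo 0 (H s)) := by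
                rw [lintegral_indicator measurableSet_Iio, setLIntegral_const,
                  Measure.restrict_apply measurableSet_Iio, Set.inter_comm, Set.Ioi_inter_Iio]
            _ ≤ _ := by
                rw [Real.volume_Ioo, sub_zero, ENNReal.ofReal_mul ((abs_nonneg _).trans (hC 0))]
      _ < ∞ := by
          exact (Hint.const_mul C).lintegral_lt_top
  -- Write `H s` as the measure of the levels `h` in `(0, H s)`; Fubini then turns the pairing into
  -- integrals of `v'` over level sets.
  have e1 : ∫ s in Set.Ioi 0, H s * v' s = ∫ s in Set.Ioi (0 : ℝ), ∫ h in Set.Ioi (0 : ℝ),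
      {q : ℝ × ℝ | q.2 < H q.1}.indicator (fun q => v' q.1) (s, h) := by
    refine setIntegral_congr_fun measurableSet_Ioi fun s hs => ?_
    have : ∀ h : ℝ, {q : ℝ × ℝ | q.2 < H q.1}.indicator (fun q => v' q.1) (s, h) =
        (Set.Iio (H s)).indicator (fun _ => v' s) h := by
      intro h; simp [Set.indicator]
    simp only [this]
    rw [integral_indicator measurableSet_Iio, setIntegral_const, measureReal_restrict_apply
      measurableSet_Iio, Set.inter_comm, Set.Ioi_inter_Iio, Real.volume_real_Ioo_of_le (Hnn s hs)]
    simp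
  rw [e1, integral_integral_swap hprod]
  calc _ ≤ ∫⁻ h in Set.Ioi (0 : ℝ), ENNReal.ofReal |∫ s in Set.Ioi (0 : ℝ),
        {q : ℝ × ℝ | q.2 < H q.1}.indicator (fun q => v' q.1) (s, h)| := by
        have := enorm_integral_le_lintegral_enorm (μ := volume.restrict (Set.Ioi (0:ℝ)))
          (fun h : ℝ => ∫ s in Set.Ioi (0 : ℝ),
            {q : ℝ × ℝ | q.2 < H q.1}.indicator (fun q => v' q.1) (s, h))
        simpa only [Real.enorm_eq_ofReal_abs] using this
    _ ≤ ∫⁻ h in Set.Ioi (0 : ℝ), ENNReal.ofReal A *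
        ENNReal.ofReal (√(volume {s | 0 < s ∧ h < H s}).toReal) := by
        refine setLIntegral_mono' measurableSet_Ioi fun h hh => ?_
        rw [← ENNReal.ofReal_mul hA]
        refine ENNReal.ofReal_le_ofReal ?_
        have hset : {s | 0 < s ∧ h < H s} = Set.Ioi 0 ∩ {s | h < H s} := rfl
        have hm : MeasurableSet {s | h < H s} := measurableSet_lt measurable_const Hm
        have : ∫ s in Set.Ioi (0 : ℝ),
            {q : ℝ × ℝ | q.2 < H q.1}.indicator (fun q => v' q.1) (s, h) =
            ∫ s in {s | 0 < s ∧ h < H s}, v' s := by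
          have e : ∀ s : ℝ, {q : ℝ × ℝ | q.2 < H q.1}.indicator (fun q => v' q.1) (s, h) =
              {s | h < H s}.indicator v' s := by
            intro s; simp [Set.indicator]
          simp only [e]
          rw [setIntegral_indicator hm, hset]
        rw [this]
        exact abs_setIntegral_deriv_le hd hc hv (hI h hh) ⟨0, fun s hs => hs.1.le⟩ (hb h hh)
    _ = _ := lintegral_const_mul' _ _ ENNReal.ofReal_ne_top

end IntervalsAndLevelSets

/-! ### Regularization of Hölder functions by forward averages. -/

section Steklov

/-- The forward average of `w` over an interval of length `ε`. -/
noncomputable def fwdAvg (w : ℝ → ℝ) (ε s : ℝ) : ℝ := ε⁻¹ * ∫ r in (0 : ℝ)..ε, w (s + r)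

lemma continuous_of_sqrt_bound {w : ℝ → ℝ} {A : ℝ}
    (hw : ∀ s s', |w s - w s'| ≤ A * √|s - s'|) : Continuous w := by
  rw [continuous_iff_continuousAt]
  intro s
  rw [ContinuousAt, tendsto_iff_dist_tendsto_zero]
  have h : Tendsto (fun x => A * √|x - s|) (𝓝 s) (𝓝 0) := by
    have : Continuous fun x => A * √|x - s| := by fun_prop
    simpa using this.tendsto s
  exact squeeze_zero (fun _ => dist_nonneg) (fun x => by rw [Real.dist_eq]; exact hw x s) h

lemma hasDerivAt_fwdAvg {w : ℝ → ℝ} (hw : Continuous w) (ε s : ℝ) :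
    HasDerivAt (fwdAvg w ε) (ε⁻¹ * (w (s + ε) - w s)) s := by
  have e : fwdAvg w ε = fun s => ε⁻¹ * ((∫ r in (0 : ℝ)..(s + ε), w r) - ∫ r in (0 : ℝ)..s, w r) := by
    funext s
    rw [fwdAvg, intervalIntegral.integral_comp_add_left (fun r => w r), add_zero,
      intervalIntegral.integral_interval_sub_left (hw.intervalIntegrable _ _)
        (hw.intervalIntegrable _ _)]
  rw [e]
  have h1 (u : ℝ) : HasDerivAt (fun s => ∫ r in (0 : ℝ)..s, w r) (w u) u :=
    (hw.integral_hasStrictDerivAt 0 u).hasDerivAt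
  exact (((h1 (s + ε)).comp_add_const s ε).sub (h1 s)).const_mul _

/-- Averaging commutes with translations, so the Hölder constant is not increased; the sharp
constant survives the regularization. -/
lemma fwdAvg_sub_le {w : ℝ → ℝ} {A ε : ℝ} (hε : 0 < ε)
    (hw : ∀ s s', |w s - w s'| ≤ A * √|s - s'|) (s s' : ℝ) :
    |fwdAvg w ε s - fwdAvg w ε s'| ≤ A * √|s - s'| := by
  have hc := continuous_of_sqrt_bound hw
  rw [fwdAvg, fwdAvg, ← mul_sub, ← intervalIntegral.integral_sub
    (Continuous.intervalIntegrable (by fun_prop) _ _)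
    (Continuous.intervalIntegrable (by fun_prop) _ _), abs_mul, abs_of_pos (inv_pos.2 hε)]
  have := intervalIntegral.norm_integral_le_of_norm_le_const (a := 0) (b := ε)
    (f := fun r => w (s + r) - w (s' + r)) (C := A * √|s - s'|) (fun r _ => by
      have := hw (s + r) (s' + r); rwa [add_sub_add_right_eq_sub] at this)
  rw [Real.norm_eq_abs, sub_zero, abs_of_pos hε] at this
  calc _ ≤ ε⁻¹ * (A * √|s - s'| * ε) := by gcongr
    _ = _ := by field_simp

lemma fwdAvg_sub_self_le {w : ℝ → ℝ} {A ε : ℝ} (hA : 0 ≤ A) (hε : 0 < ε)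
    (hw : ∀ s s', |w s - w s'| ≤ A * √|s - s'|) (s : ℝ) :
    |fwdAvg w ε s - w s| ≤ A * √ε := by
  have hc := continuous_of_sqrt_bound hw
  have e : fwdAvg w ε s - w s = ε⁻¹ * ∫ r in (0 : ℝ)..ε, (w (s + r) - w s) := by
    rw [intervalIntegral.integral_sub (Continuous.intervalIntegrable (by fun_prop) _ _)
      (by simp), fwdAvg]
    simp
    field_simp
  rw [e, abs_mul, abs_of_pos (inv_pos.2 hε)]
  have := intervalIntegral.norm_integral_le_of_norm_le_const (a := 0) (b := ε)
    (f := fun r => w (s + r) - w s) (C := A * √ε) (fun r hr => by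
      rw [Set.uIoc_of_le hε.le] at hr
      refine (hw (s + r) s).trans ?_
      rw [add_sub_cancel_left, abs_of_pos hr.1]
      gcongr; exact hr.2)
  rw [Real.norm_eq_abs, sub_zero, abs_of_pos hε] at this
  calc _ ≤ ε⁻¹ * (A * √ε * ε) := by gcongr
    _ = _ := by field_simp

end Steklov

/-- Pairing of a Hölder function with (minus) the derivative of a quasi-concave profile. -/
lemma abs_integral_neg_deriv_mul_le {H K w : ℝ → ℝ} {A : ℝ} (hA : 0 ≤ A)
    (hH : ∀ s, HasDerivAt H (-K s) s) (H0 : H 0 = 0)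
    (Hnn : ∀ s, 0 < s → 0 ≤ H s) (Hint : IntegrableOn H (Set.Ioi 0))
    (Kint : IntegrableOn K (Set.Ioi 0)) (Kw : IntegrableOn (fun s => K s * w s) (Set.Ioi 0))
    (hw : ∀ s s', |w s - w s'| ≤ A * √|s - s'|)
    (hlim : Tendsto (fun s => H s * (1 + √s)) atTop (𝓝 0))
    (hI : ∀ h : ℝ, 0 < h → {s | 0 < s ∧ h < H s}.OrdConnected)
    (hb : ∀ h : ℝ, 0 < h → BddAbove {s | 0 < s ∧ h < H s}) :
    ENNReal.ofReal |∫ s in Set.Ioi 0, K s * w s| ≤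
      ENNReal.ofReal A * ∫⁻ h in Set.Ioi (0 : ℝ),
        ENNReal.ofReal (√(volume {s | 0 < s ∧ h < H s}).toReal) := by
  set R := ENNReal.ofReal A * ∫⁻ h in Set.Ioi (0 : ℝ),
        ENNReal.ofReal (√(volume {s | 0 < s ∧ h < H s}).toReal) with hR
  have hwc := continuous_of_sqrt_bound hw
  have Hc : Continuous H := continuous_iff_continuousAt.2 fun s => (hH s).continuousAt
  set T := ∫ s in Set.Ioi (0 : ℝ), |K s| with hT
  have hT0 : 0 ≤ T := integral_nonneg fun _ => abs_nonneg _
  -- A Hölder function need not be differentiable, so the layer cake bound is applied to its forward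
  -- average; the error is the uniform distance `A * √ε` times the `L¹` norm of `K`, and `ε → 0` at
  -- the end.
  have key : ∀ ε : ℝ, 0 < ε → ENNReal.ofReal |∫ s in Set.Ioi 0, K s * w s| ≤
      R + ENNReal.ofReal (A * √ε * T) := by
    intro ε hε
    set v := fwdAvg w ε with hv
    set v' : ℝ → ℝ := fun s => ε⁻¹ * (w (s + ε) - w s) with hv'
    have hvd : ∀ s, HasDerivAt v (v' s) s := fun s => hasDerivAt_fwdAvg hwc ε s
    have hvc : Continuous v := continuous_iff_continuousAt.2 fun s => (hvd s).continuousAt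
    have hv'c : Continuous v' := by fun_prop
    have hvC : ∀ s, |v' s| ≤ ε⁻¹ * (A * √ε) := by
      intro s
      rw [hv', abs_mul, abs_of_pos (inv_pos.2 hε)]
      have := hw (s + ε) s
      rw [add_sub_cancel_left, abs_of_pos hε] at this
      gcongr
    have hvh := fwdAvg_sub_le hε hw
    have hvw := fwdAvg_sub_self_le hA hε hw
    have Kdiff : IntegrableOn (fun s => K s * (v s - w s)) (Set.Ioi 0) := by
      refine Integrable.mul_bdd (c := A * √ε) Kint
        (by fun_prop) (Eventually.of_forall hvw)
    have Kv : IntegrableOn (fun s => K s * v s) (Set.Ioi 0) := by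
      have := Kw.add Kdiff
      refine this.congr (Eventually.of_forall fun s => ?_)
      simp only [Pi.add_apply]; ring
    have Hv' : IntegrableOn (fun s => H s * v' s) (Set.Ioi 0) :=
      Integrable.mul_bdd (c := ε⁻¹ * (A * √ε)) Hint
        (by fun_prop) (Eventually.of_forall hvC)
    -- Integration by parts has no boundary terms: `H` vanishes at `0`, and at infinity `v` grows at
    -- most like `1 + √s`, which `hlim` absorbs.
    have hparts : ∫ s in Set.Ioi 0, H s * v' s = ∫ s in Set.Ioi 0, K s * v s := by
      rw [integral_Ioi_mul_deriv_eq_deriv_mul (a' := 0) (b' := 0) (fun x _ => hH x)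
        (fun x _ => hvd x) Hv' (by
          refine Kv.neg.congr (Eventually.of_forall fun s => ?_)
          simp) ?_ ?_]
      · simp [integral_neg]
      · have : Tendsto (H * v) (𝓝 0) (𝓝 (H 0 * v 0)) := (Hc.mul hvc).tendsto 0
        rw [H0, zero_mul] at this
        exact this.mono_left nhdsWithin_le_nhds
      · have hb2 : ∀ᶠ s in atTop, ‖(H * v) s‖ ≤ (|v 0| + A) * (H s * (1 + √s)) := by
          filter_upwards [eventually_gt_atTop 0] with s hs
          have h1 := hvh s 0
          rw [sub_zero, abs_of_pos hs] at h1
          have h2 : |v s| ≤ |v 0| + A * √s := by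
            have := abs_sub_abs_le_abs_sub (v s) (v 0); linarith
          have h3 : |v 0| + A * √s ≤ (|v 0| + A) * (1 + √s) := by
            nlinarith [abs_nonneg (v 0), Real.sqrt_nonneg s]
          rw [Pi.mul_apply, Real.norm_eq_abs, abs_mul, abs_of_nonneg (Hnn s hs)]
          calc H s * |v s| ≤ H s * ((|v 0| + A) * (1 + √s)) := by
                gcongr
                · exact Hnn s hs
                · linarith
            _ = _ := by ring
        exact squeeze_zero_norm' hb2 (by simpa using hlim.const_mul (|v 0| + A))
    have hmain := abs_integral_mul_deriv_le hA hvd hv'c hvC hvh Hc.measurable Hnn Hint hI hb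
    rw [hparts, ← hR] at hmain
    have hsplit : ∫ s in Set.Ioi 0, K s * w s =
        (∫ s in Set.Ioi 0, K s * v s) - ∫ s in Set.Ioi 0, K s * (v s - w s) := by
      rw [← integral_sub Kv Kdiff]
      congr 1; funext s; ring
    have hdiff : |∫ s in Set.Ioi 0, K s * (v s - w s)| ≤ A * √ε * T := by
      calc |∫ s in Set.Ioi 0, K s * (v s - w s)| ≤ ∫ s in Set.Ioi (0 : ℝ), A * √ε * |K s| := by
            rw [← Real.norm_eq_abs]
            refine norm_integral_le_of_norm_le (Kint.abs.const_mul _)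
              (Eventually.of_forall fun s => ?_)
            rw [Real.norm_eq_abs, abs_mul, mul_comm]
            have := hvw s
            gcongr
        _ = _ := by rw [integral_const_mul]
    calc _ ≤ ENNReal.ofReal (|∫ s in Set.Ioi 0, K s * v s| + A * √ε * T) := by
          refine ENNReal.ofReal_le_ofReal ?_
          rw [hsplit]
          exact (abs_sub _ _).trans (by gcongr)
      _ = ENNReal.ofReal |∫ s in Set.Ioi 0, K s * v s| + ENNReal.ofReal (A * √ε * T) :=
          ENNReal.ofReal_add (abs_nonneg _) (by positivity)
      _ ≤ _ := by gcongr
  have hlim2 : Tendsto (fun ε : ℝ => R + ENNReal.ofReal (A * √ε * T)) (𝓝[>] 0)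
      (𝓝 (R + ENNReal.ofReal 0)) := by
    refine Tendsto.const_add _ (ENNReal.tendsto_ofReal ?_)
    have : Continuous fun ε : ℝ => A * √ε * T := by fun_prop
    have := this.tendsto 0
    simp only [Real.sqrt_zero, mul_zero, zero_mul] at this
    exact this.mono_left nhdsWithin_le_nhds
  rw [ENNReal.ofReal_zero, add_zero] at hlim2
  exact ge_of_tendsto hlim2 (by filter_upwards [self_mem_nhdsWithin] with ε hε using key ε hε)

/-! ### Transport along a horizontal line above both centres. -/

section HorizontalLine

/-- The difference of the kernels centred at `(0, 1/2)` and `(0, -1/2)`. -/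
noncomputable def kerDiff (s t : ℝ) : ℝ := K₂ (s, t - 1 / 2) - K₂ (s, t + 1 / 2)

/-- The primitive of `-kerDiff` along a horizontal line. -/
noncomputable def profile (t s : ℝ) : ℝ :=
  1 / 2 * (s / (s ^ 2 + (t - 1 / 2) ^ 2) - s / (s ^ 2 + (t + 1 / 2) ^ 2))

lemma hasDerivAt_div_sq_add_sq {a s : ℝ} (h : s ^ 2 + a ^ 2 ≠ 0) :
    HasDerivAt (fun s : ℝ => s / (s ^ 2 + a ^ 2)) ((a ^ 2 - s ^ 2) / (s ^ 2 + a ^ 2) ^ 2) s := by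
  have := (hasDerivAt_id' s).div (((hasDerivAt_pow 2 s).add_const (a ^ 2))) h
  refine HasDerivAt.congr_deriv this ?_
  congr 1
  push_cast
  ring

lemma hasDerivAt_profile {t : ℝ} (ht : 1 / 2 < t) (s : ℝ) :
    HasDerivAt (profile t) (-kerDiff s t) s := by
  have ha : s ^ 2 + (t - 1 / 2) ^ 2 ≠ 0 := by
    have : 0 < t - 1 / 2 := by linarith
    positivity
  have hb : s ^ 2 + (t + 1 / 2) ^ 2 ≠ 0 := by positivity
  refine (((hasDerivAt_div_sq_add_sq ha).sub (hasDerivAt_div_sq_add_sq hb)).const_mul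
    (1 / 2 : ℝ)).congr_deriv ?_
  simp only [kerDiff, K₂]
  ring

lemma profile_eq {t : ℝ} (ht : 1 / 2 < t) (s : ℝ) :
    profile t s = s * t / ((s ^ 2 + (t - 1 / 2) ^ 2) * (s ^ 2 + (t + 1 / 2) ^ 2)) := by
  have : 0 < t - 1 / 2 := by linarith
  have ha : s ^ 2 + (t - 1 / 2) ^ 2 ≠ 0 := by positivity
  have hb : s ^ 2 + (t + 1 / 2) ^ 2 ≠ 0 := by positivity
  rw [profile, div_sub_div _ _ ha hb, ← mul_div_assoc]
  congr 1
  ring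

lemma profile_nonneg {t : ℝ} (ht : 1 / 2 < t) {s : ℝ} (hs : 0 < s) : 0 ≤ profile t s := by
  rw [profile_eq ht]
  have : 0 < t := by linarith
  positivity

lemma profile_le {t : ℝ} {s : ℝ} (hs : 0 < s) : profile t s ≤ 1 / (2 * s) := by
  have h1 : s / (s ^ 2 + (t - 1 / 2) ^ 2) ≤ 1 / s := by
    rw [div_le_div_iff₀ (by positivity) hs]
    nlinarith [sq_nonneg (t - 1 / 2)]
  have h2 : 0 ≤ s / (s ^ 2 + (t + 1 / 2) ^ 2) := by positivity
  rw [profile]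
  calc _ ≤ 1 / 2 * (1 / s) := by linarith
    _ = _ := by field_simp

lemma lt_profile_iff {t h s : ℝ} (ht : 1 / 2 < t) (hh : 0 < h) :
    h < profile t s ↔ (s ^ 2 + (t - 1 / 2) ^ 2) * (s ^ 2 + (t + 1 / 2) ^ 2) < t / h * s := by
  have : 0 < t - 1 / 2 := by linarith
  rw [profile_eq ht, lt_div_iff₀ (by positivity), div_mul_eq_mul_div, lt_div_iff₀ hh]
  constructor <;> intro h <;> linarith

/-- After clearing denominators the level set is where a quartic, convex on the positive half line,
is negative. -/
lemma ordConnected_levelSet {t h : ℝ} (ht : 1 / 2 < t) (hh : 0 < h) :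
    {s | 0 < s ∧ h < profile t s}.OrdConnected := by
  have hconv : ConvexOn ℝ (Set.Ioi 0) fun s : ℝ =>
      s ^ 4 + (((t - 1 / 2) ^ 2 + (t + 1 / 2) ^ 2) * s ^ 2 +
        ((t - 1 / 2) ^ 2 * (t + 1 / 2) ^ 2 + (-(t / h)) * s)) := by
    have h4 : ConvexOn ℝ (Set.Ioi (0 : ℝ)) fun s : ℝ => s ^ 4 :=
      (convexOn_pow 4).subset Set.Ioi_subset_Ici_self (convex_Ioi 0)
    have h2 : ConvexOn ℝ (Set.Ioi (0 : ℝ)) fun s : ℝ => s ^ 2 :=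
      (convexOn_pow 2).subset Set.Ioi_subset_Ici_self (convex_Ioi 0)
    have h1 : ConvexOn ℝ (Set.Ioi (0 : ℝ)) fun s : ℝ =>
        (t - 1 / 2) ^ 2 * (t + 1 / 2) ^ 2 + (-(t / h)) * s := by
      refine ⟨convex_Ioi 0, fun x _ y _ a b _ _ hab => ?_⟩
      simp only [smul_eq_mul]
      have hb : b = 1 - a := by linarith
      subst hb
      exact le_of_eq (by ring)
    exact h4.add ((h2.smul (c := (t - 1 / 2) ^ 2 + (t + 1 / 2) ^ 2) (by positivity)).add h1)
  have := (hconv.convex_lt 0).ordConnected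
  have heq : {s | 0 < s ∧ h < profile t s} = {s | s ∈ Set.Ioi 0 ∧
      s ^ 4 + (((t - 1 / 2) ^ 2 + (t + 1 / 2) ^ 2) * s ^ 2 +
        ((t - 1 / 2) ^ 2 * (t + 1 / 2) ^ 2 + (-(t / h)) * s)) < 0} := by
    refine Set.ext fun s => and_congr_right fun _ => ?_
    rw [lt_profile_iff ht hh]
    constructor <;> intro h1 <;> linarith
  rwa [heq]

lemma bddAbove_levelSet {t h : ℝ} (hh : 0 < h) : BddAbove {s | 0 < s ∧ h < profile t s} := by
  refine ⟨1 / (2 * h), fun s hs => ?_⟩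
  have := hs.2.trans_le (profile_le hs.1)
  have hs0 := hs.1
  rw [lt_div_iff₀ (by positivity)] at this
  rw [le_div_iff₀ (by positivity)]
  linarith

/-- The product of the end points of the level interval of length `g`. -/
noncomputable def gapProd (t g : ℝ) : ℝ :=
  (√((2 * t ^ 2 + 1 / 2 + g ^ 2) ^ 2 + 12 * (t ^ 2 - 1 / 4) ^ 2) - (2 * t ^ 2 + 1 / 2 + g ^ 2)) / 6

/-- The level at which the level interval of `profile t` has length `g`. -/
noncomputable def gapLevel (t g : ℝ) : ℝ :=
  t / (√(g ^ 2 + 4 * gapProd t g) * (2 * t ^ 2 + 1 / 2 + g ^ 2 + 2 * gapProd t g))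

lemma gapProd_nonneg (t g : ℝ) : 0 ≤ gapProd t g := by
  have : 2 * t ^ 2 + 1 / 2 + g ^ 2 ≤
      √((2 * t ^ 2 + 1 / 2 + g ^ 2) ^ 2 + 12 * (t ^ 2 - 1 / 4) ^ 2) :=
    Real.le_sqrt_of_sq_le (by nlinarith [sq_nonneg (t ^ 2 - 1 / 4)])
  rw [gapProd]
  linarith

/-- If the quartic bounding a level set has positive roots with difference `g`, product `q` and sum
`p`, it factors as `(s² - p s + q)(s² + p s + r)`, since it has no cubic term. The quadratic
coefficient gives `r`, the constant term gives this equation for `q`, and the linear coefficient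
gives `gapLevel`. -/
lemma gapProd_spec (t g : ℝ) :
    3 * gapProd t g ^ 2 + (2 * t ^ 2 + 1 / 2 + g ^ 2) * gapProd t g = (t ^ 2 - 1 / 4) ^ 2 := by
  have := Real.sq_sqrt (show 0 ≤ (2 * t ^ 2 + 1 / 2 + g ^ 2) ^ 2 + 12 * (t ^ 2 - 1 / 4) ^ 2 by
    positivity)
  rw [gapProd]
  nlinarith

lemma abs_sub_lt_of_gapLevel_le {t g h s : ℝ} (ht : 1 / 2 < t) (hg : 0 < g)
    (hh : 0 < h) (hgh : gapLevel t g ≤ h) (hs : 0 < s) (hsh : h < profile t s) :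
    |s - √(g ^ 2 + 4 * gapProd t g) / 2| < g / 2 := by
  set q := gapProd t g with hq
  have hq0 : 0 ≤ q := gapProd_nonneg t g
  have hspec := gapProd_spec t g
  rw [← hq] at hspec
  set p := √(g ^ 2 + 4 * q) with hp
  have hp0 : 0 < p := Real.sqrt_pos.2 (by positivity)
  have hp2 : p ^ 2 = g ^ 2 + 4 * q := Real.sq_sqrt (by positivity)
  have ht0 : 0 < t := by linarith
  have hden : 0 < p * (2 * t ^ 2 + 1 / 2 + g ^ 2 + 2 * q) := by positivity
  rw [gapLevel, ← hq, ← hp, div_le_iff₀ hden] at hgh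
  have h1 : t / h * s ≤ p * (2 * t ^ 2 + 1 / 2 + g ^ 2 + 2 * q) * s := by
    gcongr
    rw [div_le_iff₀ hh]; linarith
  have h2 := ((lt_profile_iff ht hh).1 hsh).trans_le h1
  -- The factorization of the quartic at the critical level. The second factor is positive, so the
  -- first is negative, which places `s` between two roots at distance `g`.
  have h3 : (s ^ 2 - p * s + q) * (s ^ 2 + p * s + (2 * t ^ 2 + 1 / 2 + g ^ 2 + 3 * q)) < 0 := by
    have e : (s ^ 2 - p * s + q) * (s ^ 2 + p * s + (2 * t ^ 2 + 1 / 2 + g ^ 2 + 3 * q)) =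
        (s ^ 2 + (t - 1 / 2) ^ 2) * (s ^ 2 + (t + 1 / 2) ^ 2) -
          p * (2 * t ^ 2 + 1 / 2 + g ^ 2 + 2 * q) * s := by
      linear_combination (-s ^ 2) * hp2 + hspec
    rw [e]; linarith
  have h4 : s ^ 2 - p * s + q < 0 := by
    by_contra hcon
    push Not at hcon
    have : 0 ≤ (s ^ 2 - p * s + q) * (s ^ 2 + p * s + (2 * t ^ 2 + 1 / 2 + g ^ 2 + 3 * q)) :=
      mul_nonneg hcon (by positivity)
    linarith
  refine abs_lt_of_sq_lt_sq ?_ (by positivity)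
  nlinarith

/-- The transport cost of half a horizontal line at height `t`. -/
noncomputable def lineCost (t : ℝ) : ℝ≥0∞ :=
  ENNReal.ofReal (1 / 2) * ∫⁻ g in Set.Ioi (0 : ℝ),
    ENNReal.ofReal (gapLevel t g) * ENNReal.ofReal (g ^ (1 / 2 - 1 : ℝ))

/-- A second layer cake, now for the length of the level interval as a function of `h`: the levels
where the length exceeds `g` all lie below `gapLevel t g`. -/
lemma lintegral_sqrt_levelSet_le {t : ℝ} (ht : 1 / 2 < t) :
    ∫⁻ h in Set.Ioi (0 : ℝ), ENNReal.ofReal (√(volume {s | 0 < s ∧ h < profile t s}).toReal) ≤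
      lineCost t := by
  have hanti : Antitone fun h : ℝ => volume {s | 0 < s ∧ h < profile t s} := by
    intro h h' hhh
    exact measure_mono fun s hs => ⟨hs.1, hhh.trans_lt hs.2⟩
  simp only [Real.sqrt_eq_rpow]
  rw [lintegral_rpow_eq_lintegral_meas_lt_mul (volume.restrict (Set.Ioi (0 : ℝ)))
    (Eventually.of_forall fun h => ENNReal.toReal_nonneg)
    (hanti.measurable.ennreal_toReal.aemeasurable) (by norm_num : (0 : ℝ) < 1 / 2), lineCost]
  gcongr ENNReal.ofReal (1 / 2) * ?_
  refine setLIntegral_mono' measurableSet_Ioi fun g hg => ?_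
  gcongr
  have hg0 : 0 < g := hg
  have hsub : {h | g < (volume {s | 0 < s ∧ h < profile t s}).toReal} ∩ Set.Ioi 0 ⊆
      Set.Ioo 0 (gapLevel t g) := by
    rintro h ⟨h1, h2⟩
    refine ⟨h2, ?_⟩
    by_contra hcon
    push Not at hcon
    have hss : {s | 0 < s ∧ h < profile t s} ⊆
        Metric.ball (√(g ^ 2 + 4 * gapProd t g) / 2) (g / 2) := by
      intro s hs
      rw [Metric.mem_ball, Real.dist_eq]
      exact abs_sub_lt_of_gapLevel_le ht hg0 h2 hcon hs.1 hs.2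
    have hv := measure_mono (μ := volume) hss
    rw [Real.volume_ball, mul_div_cancel₀ _ (two_ne_zero)] at hv
    have := ENNReal.toReal_mono ENNReal.ofReal_ne_top hv
    rw [ENNReal.toReal_ofReal hg0.le] at this
    exact absurd h1 (not_lt.2 this)
  calc _ ≤ volume ({h | g < (volume {s | 0 < s ∧ h < profile t s}).toReal} ∩ Set.Ioi 0) :=
        le_of_eq (Measure.restrict_apply' measurableSet_Ioi)
    _ ≤ _ := measure_mono hsub
    _ = _ := by rw [Real.volume_Ioo, sub_zero]

lemma abs_K₂_le (s t : ℝ) : |K₂ (s, t)| ≤ 1 / 2 * (s ^ 2 + t ^ 2)⁻¹ := by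
  rcases eq_or_ne (s ^ 2 + t ^ 2) 0 with h | h
  · simp [K₂, h]
  have hp : 0 < s ^ 2 + t ^ 2 := lt_of_le_of_ne (by positivity) h.symm
  simp only [K₂, abs_mul, abs_div, abs_of_pos (pow_pos hp 2)]
  rw [abs_one, abs_two]
  gcongr
  rw [div_le_iff₀ (by positivity)]
  have : |s ^ 2 - t ^ 2| ≤ s ^ 2 + t ^ 2 := by
    rw [abs_le]; constructor <;> nlinarith [sq_nonneg s, sq_nonneg t]
  calc _ ≤ _ := this
    _ = _ := by field_simp

lemma integrable_inv_sq_add_sq {a : ℝ} (ha : a ≠ 0) :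
    Integrable fun s : ℝ => (s ^ 2 + a ^ 2)⁻¹ := by
  have hm : AEStronglyMeasurable (fun s : ℝ => (s ^ 2 + a ^ 2)⁻¹) volume :=
    (by fun_prop : Measurable fun s : ℝ => (s ^ 2 + a ^ 2)⁻¹).aestronglyMeasurable
  refine (integrable_inv_one_add_sq.const_mul (1 + (a ^ 2)⁻¹)).mono' hm
    (Eventually.of_forall fun s => ?_)
  have ha2 : 0 < a ^ 2 := by positivity
  rw [Real.norm_eq_abs, abs_of_nonneg (by positivity), ← div_eq_mul_inv,
    inv_le_comm₀ (by positivity) (by positivity), inv_div, div_le_iff₀ (by positivity)]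
  have : (s ^ 2 + a ^ 2) * (1 + (a ^ 2)⁻¹) = s ^ 2 + a ^ 2 + s ^ 2 * (a ^ 2)⁻¹ + 1 := by
    have := mul_inv_cancel₀ ha2.ne'
    linear_combination this
  rw [this]
  nlinarith [mul_nonneg (sq_nonneg s) (inv_nonneg.2 ha2.le)]

lemma measurable_K₂ : Measurable K₂ := by
  unfold K₂
  fun_prop

lemma integrable_K₂_left {a : ℝ} (ha : a ≠ 0) : Integrable fun s : ℝ => K₂ (s, a) :=
  ((integrable_inv_sq_add_sq ha).const_mul (1 / 2)).mono'
    (measurable_K₂.comp (measurable_id.prodMk measurable_const)).aestronglyMeasurable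
    (Eventually.of_forall fun s => abs_K₂_le s a)

lemma integrable_kerDiff {t : ℝ} (ht : 1 / 2 < t) : Integrable fun s => kerDiff s t :=
  (integrable_K₂_left (by linarith : t - 1 / 2 ≠ 0)).sub
    (integrable_K₂_left (by linarith : t + 1 / 2 ≠ 0))

lemma kerDiff_neg_left (s t : ℝ) : kerDiff (-s) t = kerDiff s t := by
  simp [kerDiff, K₂]

lemma integrableOn_profile {t : ℝ} (ht : 1 / 2 < t) : IntegrableOn (profile t) (Set.Ioi 0) := by
  have h0 : 0 < t - 1 / 2 := by linarith
  have hc : Continuous (profile t) :=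
    continuous_iff_continuousAt.2 fun s => (hasDerivAt_profile ht s).continuousAt
  refine ((integrable_inv_sq_add_sq h0.ne').const_mul 1).integrableOn.mono'
    hc.aestronglyMeasurable ((ae_restrict_iff' measurableSet_Ioi).2 (Eventually.of_forall fun s hs => ?_))
  have hs0 : 0 < s := hs
  rw [Real.norm_eq_abs, abs_of_nonneg (profile_nonneg ht hs), profile_eq ht, one_mul, inv_eq_one_div,
    div_le_div_iff₀ (by positivity) (by positivity), one_mul, mul_comm]
  gcongr
  nlinarith [sq_nonneg (s - t)]

/-- Bound for the pairing of `kerDiff` with a Hölder function along a horizontal line. -/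
lemma abs_integral_kerDiff_mul_le {t A : ℝ} (ht : 1 / 2 < t) (hA : 0 ≤ A) {w : ℝ → ℝ}
    (hw : ∀ s s', |w s - w s'| ≤ A * √|s - s'|)
    (hint : Integrable fun s => kerDiff s t * w s) :
    ENNReal.ofReal |∫ s, kerDiff s t * w s| ≤ ENNReal.ofReal (2 * A) * lineCost t := by
  have hneg : IntegrableOn (fun s => kerDiff s t * w (-s)) (Set.Ioi 0) := by
    have := hint.comp_neg.integrableOn (s := Set.Ioi 0)
    simpa only [kerDiff_neg_left] using this
  -- The kernel is even in `s`, so the line folds onto a half line where `w s + w (-s)` has Hölder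
  -- constant `2 * A`.
  have e : ∫ s, kerDiff s t * w s = ∫ s in Set.Ioi 0, kerDiff s t * (w s + w (-s)) := by
    rw [← intervalIntegral.integral_Iic_add_Ioi hint.integrableOn hint.integrableOn (b := 0)]
    have : ∫ s in Set.Iic 0, kerDiff s t * w s = ∫ s in Set.Ioi 0, kerDiff s t * w (-s) := by
      have := integral_comp_neg_Ioi (c := 0) (f := fun s => kerDiff s t * w s)
      rw [neg_zero] at this
      rw [← this]
      simp only [kerDiff_neg_left]
    rw [this, add_comm, ← integral_add hint.integrableOn hneg]
    simp only [mul_add]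
  rw [e]
  refine (abs_integral_neg_deriv_mul_le (A := 2 * A) (by positivity) (hasDerivAt_profile ht)
    (by simp [profile]) (fun s hs => profile_nonneg ht hs) (integrableOn_profile ht)
    (integrable_kerDiff ht).integrableOn ?_ ?_ ?_ (fun h hh => ordConnected_levelSet ht hh)
    (fun h hh => bddAbove_levelSet hh)).trans ?_
  · simp only [mul_add]
    exact hint.integrableOn.add hneg
  · intro s s'
    have h1 := hw s s'
    have h2 := hw (-s) (-s')
    have h3 : |-s - -s'| = |s - s'| := by rw [← abs_neg]; ring_nf
    rw [h3] at h2
    calc |w s + w (-s) - (w s' + w (-s'))| = |(w s - w s') + (w (-s) - w (-s'))| := by ring_nf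
      _ ≤ _ := abs_add_le _ _
      _ ≤ _ := by linarith
  · have hlim : Tendsto (fun s : ℝ => 1 / 2 * s⁻¹ + 1 / 2 * (√s)⁻¹) atTop (𝓝 0) := by
      have h1 := tendsto_inv_atTop_zero (𝕜 := ℝ)
      have h2 := h1.comp Real.tendsto_sqrt_atTop
      have h3 := (h1.const_mul (1 / 2)).add (h2.const_mul (1 / 2))
      rwa [mul_zero, add_zero] at h3
    refine squeeze_zero' ?_ ?_ hlim
    · filter_upwards [eventually_gt_atTop 0] with s hs
      have := profile_nonneg ht hs
      positivity
    · filter_upwards [eventually_gt_atTop 0] with s hs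
      calc profile t s * (1 + √s) ≤ 1 / (2 * s) * (1 + √s) := by
            gcongr; exact profile_le hs
        _ = _ := by
            have hq : √s ≠ 0 := (Real.sqrt_pos.2 hs).ne'
            have := Real.sq_sqrt hs.le
            field_simp
            nlinarith
  · gcongr
    exact lintegral_sqrt_levelSet_le ht

end HorizontalLine

/-! ### Change of variables from the height to the sum of the end points. -/

section GapIntegral

/-- The height at which the level interval of length `g` has end points with sum `p`. -/
noncomputable def heightOf (g p : ℝ) : ℝ :=
  1 / 2 * √(1 + (p ^ 2 - g ^ 2) + 2 * (√(p ^ 2 - g ^ 2) * √(p ^ 2 + 1)))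

/-- The density of the gaps in the variables `g`, `p`. -/
noncomputable def gapDensity (G E : ℝ) : ℝ :=
  1 / 4 * ((E ^ 2 + E * G + G ^ 2) / (E ^ 2 * G * (E + G)))

lemma gapProd_unique {t g q : ℝ} (hq : 0 ≤ q)
    (h : 3 * q ^ 2 + (2 * t ^ 2 + 1 / 2 + g ^ 2) * q = (t ^ 2 - 1 / 4) ^ 2) : gapProd t g = q := by
  have h1 := gapProd_spec t g
  have h2 := gapProd_nonneg t g
  have : (gapProd t g - q) * (3 * (gapProd t g + q) + (2 * t ^ 2 + 1 / 2 + g ^ 2)) = 0 := by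
    linear_combination h1 - h
  rcases mul_eq_zero.1 this with h3 | h3
  · linarith
  · have : 0 < 3 * (gapProd t g + q) + (2 * t ^ 2 + 1 / 2 + g ^ 2) := by positivity
    linarith

/-- With `G² = p² - g²` the product of the end points is `G² / 4`, and the equation for it is solved
by `t² = (1 + G² + 2 G E) / 4`. In the product of the Jacobian and the level, the factors `t` and
`p` cancel and a rational function of `G` and `E` remains. -/
lemma deriv_mul_gapLevel {g p : ℝ} (hg : 0 < g) (hp : g < p) :
    ∃ d : ℝ, 0 ≤ d ∧ HasDerivAt (heightOf g) d p ∧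
      d * gapLevel (heightOf g p) g = gapDensity √(p ^ 2 - g ^ 2) √(p ^ 2 + 1) := by
  have hpg : 0 < p ^ 2 - g ^ 2 := by nlinarith
  have hp0 : 0 < p := hg.trans hp
  set G := √(p ^ 2 - g ^ 2) with hG
  set E := √(p ^ 2 + 1) with hE
  have hG0 : 0 < G := Real.sqrt_pos.2 hpg
  have hE0 : 0 < E := Real.sqrt_pos.2 (by positivity)
  have hG2 : G ^ 2 = p ^ 2 - g ^ 2 := Real.sq_sqrt hpg.le
  have hE2 : E ^ 2 = p ^ 2 + 1 := Real.sq_sqrt (by positivity)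
  have hu : 0 < 1 + (p ^ 2 - g ^ 2) + 2 * (G * E) := by positivity
  set t := heightOf g p with ht
  have htdef : t = 1 / 2 * √(1 + (p ^ 2 - g ^ 2) + 2 * (G * E)) := rfl
  have ht0 : 0 < t := by rw [htdef]; positivity
  have ht2 : t ^ 2 = (1 + G ^ 2 + 2 * (G * E)) / 4 := by
    rw [htdef, mul_pow, Real.sq_sqrt hu.le, hG2]; ring
  have hdG : HasDerivAt (fun p : ℝ => √(p ^ 2 - g ^ 2)) (p / G) p := by
    have := ((hasDerivAt_pow 2 p).sub_const (g ^ 2)).sqrt hpg.ne'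
    refine this.congr_deriv ?_
    rw [← hG]; push_cast; field_simp
  have hdE : HasDerivAt (fun p : ℝ => √(p ^ 2 + 1)) (p / E) p := by
    have := ((hasDerivAt_pow 2 p).add_const (1 : ℝ)).sqrt (by positivity)
    refine this.congr_deriv ?_
    rw [← hE]; push_cast; field_simp
  have hd : HasDerivAt (heightOf g) (p * (E * G + E ^ 2 + G ^ 2) / (4 * t * (E * G))) p := by
    have h1 := (((hasDerivAt_pow 2 p).sub_const (g ^ 2)).const_add 1).add
      ((hdG.mul hdE).const_mul 2)
    have h2 := (h1.sqrt (by exact hu.ne')).const_mul (1 / 2 : ℝ)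
    refine h2.congr_deriv ?_
    have h3 : √(1 + (p ^ 2 - g ^ 2) + 2 * (G * E)) = 2 * t := by rw [htdef]; ring
    simp only [← hG, ← hE, Pi.add_apply, Pi.mul_apply]
    rw [h3]
    push_cast
    field_simp
    ring
  refine ⟨_, by positivity, hd, ?_⟩
  have hq : gapProd t g = G ^ 2 / 4 := by
    refine gapProd_unique (by positivity) ?_
    have hg2 : g ^ 2 = E ^ 2 - 1 - G ^ 2 := by linarith
    rw [ht2, hg2]
    ring
  have hgl : gapLevel t g = t / (p * (E * (E + G))) := by
    rw [gapLevel, hq, ht2]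
    have e1 : √(g ^ 2 + 4 * (G ^ 2 / 4)) = p := by
      rw [hG2, show g ^ 2 + 4 * ((p ^ 2 - g ^ 2) / 4) = p ^ 2 by ring, Real.sqrt_sq hp0.le]
    rw [e1]
    congr 2
    linear_combination hG2 - hE2
  rw [hgl, gapDensity]
  field_simp
  ring

lemma tendsto_heightOf_atTop (g : ℝ) : Tendsto (heightOf g) atTop atTop := by
  have h1 : Tendsto (fun p : ℝ => 1 / 2 * √(p ^ 2 - g ^ 2)) atTop atTop := by
    refine (Real.tendsto_sqrt_atTop.comp ?_).const_mul_atTop (by norm_num)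
    exact tendsto_atTop_add_const_right _ _ (tendsto_pow_atTop two_ne_zero)
  refine tendsto_atTop_mono (fun p => ?_) h1
  rw [heightOf]
  gcongr
  have : 0 ≤ √(p ^ 2 - g ^ 2) * √(p ^ 2 + 1) := by positivity
  linarith

/-- The map `heightOf g` is injective on `p > g`, starts from `1/2` at `p = g` and is unbounded, so
its image covers all heights above `1/2`; covering is enough for an upper bound. -/
lemma lintegral_gapLevel_le {g : ℝ} (hg : 0 < g) :
    ∫⁻ t in Set.Ioi (1 / 2 : ℝ), ENNReal.ofReal (gapLevel t g) ≤
      ∫⁻ p in Set.Ioi g, ENNReal.ofReal (gapDensity √(p ^ 2 - g ^ 2) √(p ^ 2 + 1)) := by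
  choose! d hd0 hd hdeq using fun p (hp : g < p) => deriv_mul_gapLevel hg hp
  have hcont : Continuous (heightOf g) := by unfold heightOf; fun_prop
  have himg : Set.Ioi (1 / 2) ⊆ heightOf g '' Set.Ioi g := by
    refine (isPreconnected_Ioi).intermediate_value_Ioi (l₁ := 𝓝[>] g) (l₂ := atTop)
      (le_principal_iff.2 self_mem_nhdsWithin) (le_principal_iff.2 (Ioi_mem_atTop g))
      hcont.continuousOn ?_ (tendsto_heightOf_atTop g)
    have h := hcont.tendsto g
    have e : heightOf g g = 1 / 2 := by simp [heightOf]
    rw [e] at h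
    exact h.mono_left nhdsWithin_le_nhds
  have hinj : Set.InjOn (heightOf g) (Set.Ioi g) := by
    refine StrictMonoOn.injOn fun p hp q _ hpq => ?_
    have hp' : g < p := hp
    have h1 : p ^ 2 < q ^ 2 := by nlinarith
    have h2 : 0 < p ^ 2 - g ^ 2 := by nlinarith
    rw [heightOf, heightOf]
    gcongr
  calc _ ≤ ∫⁻ t in heightOf g '' Set.Ioi g, ENNReal.ofReal (gapLevel t g) :=
        lintegral_mono_set himg
    _ = ∫⁻ p in Set.Ioi g, ENNReal.ofReal |d p| * ENNReal.ofReal (gapLevel (heightOf g p) g) :=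
        lintegral_image_eq_lintegral_abs_deriv_mul measurableSet_Ioi
          (fun p hp => (hd p hp).hasDerivWithinAt) hinj _
    _ = _ := by
        refine setLIntegral_congr_fun measurableSet_Ioi fun p hp => ?_
        rw [abs_of_nonneg (hd0 p hp), ← ENNReal.ofReal_mul (hd0 p hp), hdeq p hp]

lemma measurable_gapLevel : Measurable fun q : ℝ × ℝ => gapLevel q.1 q.2 := by
  unfold gapLevel gapProd
  fun_prop

lemma measurable_gapDensity :
    Measurable fun q : ℝ × ℝ => gapDensity √(q.1 ^ 2 - q.2 ^ 2) √(q.1 ^ 2 + 1) := by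
  unfold gapDensity
  fun_prop

/-- The total cost of the horizontal lines above height `1/2`. -/
lemma lintegral_lineCost_le :
    ∫⁻ t in Set.Ioi (1 / 2 : ℝ), lineCost t ≤
      ENNReal.ofReal (1 / 2) * ∫⁻ p in Set.Ioi (0 : ℝ), ∫⁻ y in Set.Ioo (0 : ℝ) 1,
        ENNReal.ofReal (p * ((p * y) ^ (1 / 2 - 1 : ℝ) *
          gapDensity √(p ^ 2 - (p * y) ^ 2) √(p ^ 2 + 1))) := by
  unfold lineCost
  rw [lintegral_const_mul' _ _ ENNReal.ofReal_ne_top]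
  gcongr ENNReal.ofReal (1 / 2) * ?_
  have hm : AEMeasurable (Function.uncurry fun t g : ℝ =>
      ENNReal.ofReal (gapLevel t g) * ENNReal.ofReal (g ^ (1 / 2 - 1 : ℝ)))
      ((volume.restrict (Set.Ioi (1 / 2))).prod (volume.restrict (Set.Ioi 0))) :=
    (measurable_gapLevel.ennreal_ofReal.mul (by fun_prop)).aemeasurable
  rw [lintegral_lintegral_swap hm]
  -- The region of integration is the wedge `0 < g < p`; extending by zero makes it a product
  -- domain, so that the order can be exchanged.
  set f : ℝ → ℝ → ℝ≥0∞ := fun g p => (Set.Ioi g).indicator (fun p =>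
    ENNReal.ofReal (g ^ (1 / 2 - 1 : ℝ) * gapDensity √(p ^ 2 - g ^ 2) √(p ^ 2 + 1))) p with hf
  have hfm : Measurable (Function.uncurry f) := by
    have h1 : Measurable fun q : ℝ × ℝ => ENNReal.ofReal (q.1 ^ (1 / 2 - 1 : ℝ) *
        gapDensity √(q.2 ^ 2 - q.1 ^ 2) √(q.2 ^ 2 + 1)) :=
      ((by fun_prop : Measurable fun q : ℝ × ℝ => q.1 ^ (1 / 2 - 1 : ℝ)).mul
        (measurable_gapDensity.comp measurable_swap)).ennreal_ofReal
    exact h1.indicator (measurableSet_lt measurable_fst measurable_snd)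
  calc _ ≤ ∫⁻ g in Set.Ioi (0 : ℝ), ∫⁻ p in Set.Ioi (0 : ℝ), f g p := by
        refine setLIntegral_mono' measurableSet_Ioi fun g hg => ?_
        have hg0 : 0 < g := hg
        rw [lintegral_mul_const' _ _ ENNReal.ofReal_ne_top]
        calc _ ≤ (∫⁻ p in Set.Ioi g, ENNReal.ofReal
              (gapDensity √(p ^ 2 - g ^ 2) √(p ^ 2 + 1))) * ENNReal.ofReal (g ^ (1 / 2 - 1 : ℝ)) := by
              exact mul_le_mul' (lintegral_gapLevel_le hg) le_rfl
          _ = ∫⁻ p in Set.Ioi g, ENNReal.ofReal (g ^ (1 / 2 - 1 : ℝ) *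
              gapDensity √(p ^ 2 - g ^ 2) √(p ^ 2 + 1)) := by
              rw [← lintegral_mul_const' _ _ ENNReal.ofReal_ne_top]
              refine setLIntegral_congr_fun measurableSet_Ioi fun p _ => ?_
              rw [ENNReal.ofReal_mul (by positivity), mul_comm]
          _ = ∫⁻ p in Set.Ioi (0 : ℝ), f g p := by
              rw [hf, lintegral_indicator measurableSet_Ioi, Measure.restrict_restrict
                measurableSet_Ioi, Set.Ioi_inter_Ioi, max_eq_left hg0.le]
    _ = ∫⁻ p in Set.Ioi (0 : ℝ), ∫⁻ g in Set.Ioi (0 : ℝ), f g p :=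
        lintegral_lintegral_swap hfm.aemeasurable
    _ ≤ _ := by
        refine setLIntegral_mono' measurableSet_Ioi fun p hp => le_of_eq ?_
        have hp0 : 0 < p := hp
        have e1 : ∫⁻ g in Set.Ioi (0 : ℝ), f g p = ∫⁻ g in Set.Ioo 0 p, ENNReal.ofReal
            (g ^ (1 / 2 - 1 : ℝ) * gapDensity √(p ^ 2 - g ^ 2) √(p ^ 2 + 1)) := by
          have : ∀ g, f g p = (Set.Iio p).indicator (fun g => ENNReal.ofReal
            (g ^ (1 / 2 - 1 : ℝ) * gapDensity √(p ^ 2 - g ^ 2) √(p ^ 2 + 1))) g := by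
            intro g; simp [hf, Set.indicator]
          simp only [this]
          rw [lintegral_indicator measurableSet_Iio, Measure.restrict_restrict measurableSet_Iio,
            Set.inter_comm, Set.Ioi_inter_Iio]
        -- The substitution `g = p * y` makes the range of the inner variable independent of `p`.
        have e2 : Set.Ioo 0 p = (fun y => p * y) '' Set.Ioo (0 : ℝ) 1 := by
          rw [Set.image_mul_left_Ioo hp0]; simp
        rw [e1, e2, lintegral_image_eq_lintegral_abs_deriv_mul (f' := fun _ => p) measurableSet_Ioo
          (fun y _ => by simpa using ((hasDerivAt_id' y).const_mul p).hasDerivWithinAt)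
          (fun a _ b _ hab => mul_left_cancel₀ hp0.ne' hab)]
        simp only [abs_of_pos hp0, ← ENNReal.ofReal_mul hp0.le]

end GapIntegral

/-! ### Separation of variables and the zeroth radial moment. -/

section LemniscateMoments

/-- The radial factors of the gap density. -/
noncomputable def momR (k : ℕ) (p : ℝ) : ℝ := (√p)⁻¹ * (√(p ^ 2 + 1))⁻¹ * (p / √(p ^ 2 + 1)) ^ k

/-- The angular factors of the gap density. -/
noncomputable def momA (k : ℕ) (y : ℝ) : ℝ := (√y)⁻¹ * (√(1 - y ^ 2))⁻¹ * √(1 - y ^ 2) ^ k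

lemma momR_nonneg (k : ℕ) {p : ℝ} (hp : 0 ≤ p) : 0 ≤ momR k p := by
  unfold momR; positivity

lemma momA_nonneg (k : ℕ) (y : ℝ) : 0 ≤ momA k y := by
  unfold momA; positivity

lemma measurable_momR (k : ℕ) : Measurable (momR k) := by
  unfold momR; fun_prop

lemma measurable_momA (k : ℕ) : Measurable (momA k) := by
  unfold momA; fun_prop

/-- The right side minus the left is `x (3x - 1)² (x - 1)² / (64 (1 + x))`: the quartic agrees at
`0` and is tangent at `1/3` and `1`. -/
lemma sq_div_one_add_le {x : ℝ} (hx : 0 ≤ x) :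
    x ^ 2 / (1 + x) ≤ 1 / 64 * x + 55 / 64 * x ^ 2 - 33 / 64 * x ^ 3 + 9 / 64 * x ^ 4 := by
  rw [div_le_iff₀ (by positivity)]
  have : 0 ≤ x * ((3 * x - 1) * (x - 1)) ^ 2 := by positivity
  nlinarith

/-- With `x = G / E` the density equals `(1 + x² / (1 + x)) / (4 E G)`. Since `G = p √(1 - y²)`,
every power of `x` is a function of `p` times a function of `y`, so a polynomial majorant in `x`
separates the variables. -/
lemma gap_integrand_le {p y : ℝ} (hp : 0 < p) (hy : y ∈ Set.Ioo (0 : ℝ) 1) :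
    p * ((p * y) ^ (1 / 2 - 1 : ℝ) * gapDensity √(p ^ 2 - (p * y) ^ 2) √(p ^ 2 + 1)) ≤
      1 / 4 * (momR 0 p * momA 0 y + 1 / 64 * (momR 1 p * momA 1 y) +
        55 / 64 * (momR 2 p * momA 2 y) - 33 / 64 * (momR 3 p * momA 3 y) +
        9 / 64 * (momR 4 p * momA 4 y)) := by
  obtain ⟨hy0, hy1⟩ := hy
  have hc2 : 0 < 1 - y ^ 2 := by nlinarith
  have e1 : √(p ^ 2 - (p * y) ^ 2) = p * √(1 - y ^ 2) := by
    rw [show p ^ 2 - (p * y) ^ 2 = p ^ 2 * (1 - y ^ 2) by ring, Real.sqrt_mul (by positivity),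
      Real.sqrt_sq hp.le]
  have e2 : (p * y) ^ (1 / 2 - 1 : ℝ) = (√p)⁻¹ * (√y)⁻¹ := by
    rw [show (1 / 2 - 1 : ℝ) = -(1 / 2) by norm_num, Real.rpow_neg (by positivity),
      ← Real.sqrt_eq_rpow, Real.sqrt_mul hp.le, mul_inv]
  rw [e1, e2]
  simp only [momR, momA]
  set c := √(1 - y ^ 2)
  set E := √(p ^ 2 + 1)
  have hc : 0 < c := Real.sqrt_pos.2 hc2
  have hE : 0 < E := Real.sqrt_pos.2 (by positivity)
  have hsp : 0 < √p := Real.sqrt_pos.2 hp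
  have hsy : 0 < √y := Real.sqrt_pos.2 hy0
  set x := p * c / E with hx
  have hx0 : 0 < x := by positivity
  have key := sq_div_one_add_le hx0.le
  have e3 : gapDensity (p * c) E = 1 / 4 * ((E * (p * c))⁻¹ * (1 + x ^ 2 / (1 + x))) := by
    rw [gapDensity, hx]
    field_simp
  rw [e3]
  calc p * ((√p)⁻¹ * (√y)⁻¹ * (1 / 4 * ((E * (p * c))⁻¹ * (1 + x ^ 2 / (1 + x)))))
      ≤ p * ((√p)⁻¹ * (√y)⁻¹ * (1 / 4 * ((E * (p * c))⁻¹ * (1 + (1 / 64 * x + 55 / 64 * x ^ 2 -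
          33 / 64 * x ^ 3 + 9 / 64 * x ^ 4))))) := by gcongr
    _ = _ := by
        rw [hx]
        field_simp
        ring

/-- The quartic agrees with `1 / √(1 + x)` at `0` and is tangent to it at `13/36` and `24/25`. There
`1 + x` is `(7/6)²` and `(7/5)²`, which makes all coefficients rational. -/
lemma inv_sqrt_one_add_le {x : ℝ} (hx0 : 0 ≤ x) (hx1 : x ≤ 1) :
    (√(1 + x))⁻¹ ≤ 1 - 21168487807 / 42749293587 * x + 17815445749505 / 53351118396576 * x ^ 2 -
      131755461125 / 740987755508 * x ^ 3 + 17109590625 / 370493877754 * x ^ 4 := by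
  set P := 1 - 21168487807 / 42749293587 * x + 17815445749505 / 53351118396576 * x ^ 2 -
      131755461125 / 740987755508 * x ^ 3 + 17109590625 / 370493877754 * x ^ 4 with hP
  have hx2 : x ^ 2 ≤ x := by nlinarith
  have hx3 : x ^ 3 ≤ x ^ 2 := by nlinarith [sq_nonneg x]
  have hP0 : 0 < P := by
    have : 0 ≤ x ^ 4 := by positivity
    have : 0 ≤ x ^ 2 := by positivity
    rw [hP]
    nlinarith
  have h1 : 1 ≤ P ^ 2 * (1 + x) := by
    -- The contact points appear as a simple and two double roots; the remaining factor is positive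
    -- on `[0, 1]`.
    have key : P ^ 2 * (1 + x) - 1 = x * (x - 13 / 36) ^ 2 * (x - 24 / 25) ^ 2 *
      (773096199375 / 9632840821604 - 69176974444962381584375 / 2196251415251134337352256 * x + 3035215461246516203125 / 168942416557779564411712 * x ^ 2 - 2376129641664863671875 / 274531426906391792169032 * x ^ 3 + 292738091355087890625 / 137265713453195896084516 * x ^ 4) := by
      rw [hP]; ring
    have h2 : 0 ≤ 773096199375 / 9632840821604 - 69176974444962381584375 / 2196251415251134337352256 * x + 3035215461246516203125 / 168942416557779564411712 * x ^ 2 - 2376129641664863671875 / 274531426906391792169032 * x ^ 3 + 292738091355087890625 / 137265713453195896084516 * x ^ 4 := by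
      have : 0 ≤ x ^ 4 := by positivity
      have : 0 ≤ x ^ 2 := by positivity
      nlinarith
    have : 0 ≤ P ^ 2 * (1 + x) - 1 := by rw [key]; positivity
    linarith
  rw [inv_le_iff_one_le_mul₀ (by positivity)]
  refine (Real.one_le_sqrt.2 h1).trans_eq ?_
  rw [Real.sqrt_mul (by positivity), Real.sqrt_sq hP0.le]

lemma integrableOn_inv_sqrt : IntegrableOn (fun p : ℝ => (√p)⁻¹) (Set.Ioc 0 1) := by
  have h := (intervalIntegral.intervalIntegrable_rpow' (a := 0) (b := 1)
    (by norm_num : (-1 : ℝ) < -(1 / 2))).1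
  refine h.congr_fun (fun p hp => ?_) measurableSet_Ioc
  simp only
  rw [Real.rpow_neg hp.1.le, Real.sqrt_eq_rpow]

lemma momR_le (k : ℕ) {p : ℝ} (hp : 0 ≤ p) : momR k p ≤ momR 0 p := by
  have h1 : p / √(p ^ 2 + 1) ≤ 1 := by
    rw [div_le_one (by positivity)]
    exact Real.le_sqrt_of_sq_le (by linarith)
  have h2 : (p / √(p ^ 2 + 1)) ^ k ≤ 1 := pow_le_one₀ (by positivity) h1
  simp only [momR, pow_zero]
  gcongr

lemma momA_le (k : ℕ) {y : ℝ} : momA k y ≤ momA 0 y := by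
  have h1 : √(1 - y ^ 2) ≤ 1 := Real.sqrt_le_one.2 (by nlinarith [sq_nonneg y])
  have h2 : √(1 - y ^ 2) ^ k ≤ 1 := pow_le_one₀ (by positivity) h1
  simp only [momA, pow_zero]
  gcongr

lemma momR_zero_le_inv_sqrt {p : ℝ} : momR 0 p ≤ (√p)⁻¹ := by
  have : (√(p ^ 2 + 1))⁻¹ ≤ 1 := inv_le_one_of_one_le₀ (Real.one_le_sqrt.2 (by nlinarith [sq_nonneg p]))
  simp only [momR, pow_zero, mul_one]
  exact mul_le_of_le_one_right (by positivity) this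

/-- A polynomial majorant of `1 / √(1 + x)` on `[0, 1]`, by coefficients. -/
noncomputable def sqrtCoef : ℕ → ℝ
  | 0 => 1
  | 1 => -(21168487807 / 42749293587)
  | 2 => 17815445749505 / 53351118396576
  | 3 => -(131755461125 / 740987755508)
  | 4 => 17109590625 / 370493877754
  | _ => 0

lemma inv_sqrt_one_add_le_sum {x : ℝ} (hx0 : 0 ≤ x) (hx1 : x ≤ 1) :
    (√(1 + x))⁻¹ ≤ ∑ j ∈ Finset.range 5, sqrtCoef j * x ^ j := by
  refine (inv_sqrt_one_add_le hx0 hx1).trans_eq ?_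
  simp only [Finset.sum_range_succ, Finset.range_zero, Finset.sum_empty, sqrtCoef]
  ring

lemma momR_zero_le_of_le_one {p : ℝ} (hp : 0 < p) (hp1 : p ≤ 1) :
    momR 0 p ≤ ∑ j ∈ Finset.range 5, sqrtCoef j * p ^ (2 * j - 1 / 2 : ℝ) := by
  have h := inv_sqrt_one_add_le_sum (sq_nonneg p) (pow_le_one₀ hp.le hp1)
  have e : ∑ j ∈ Finset.range 5, sqrtCoef j * p ^ (2 * j - 1 / 2 : ℝ) =
      (√p)⁻¹ * ∑ j ∈ Finset.range 5, sqrtCoef j * (p ^ 2) ^ j := by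
    rw [Finset.mul_sum]
    refine Finset.sum_congr rfl fun j _ => ?_
    rw [Real.rpow_sub hp, ← Real.sqrt_eq_rpow, ← pow_mul, ← Real.rpow_natCast]
    push_cast
    field_simp
  rw [e, momR, pow_zero, mul_one, add_comm (p ^ 2)]
  gcongr

/-- For large `p` a factor `p` is taken out of the root, so that the majorant is used at `p⁻²`,
again in `[0, 1]`. -/
lemma momR_zero_le_of_one_le {p : ℝ} (hp : 1 ≤ p) :
    momR 0 p ≤ ∑ j ∈ Finset.range 5, sqrtCoef j * p ^ (-(2 * j) - 3 / 2 : ℝ) := by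
  have hp0 : 0 < p := by linarith
  have h := inv_sqrt_one_add_le_sum (x := (p ^ 2)⁻¹) (by positivity)
    (inv_le_one_of_one_le₀ (one_le_pow₀ hp))
  have e : ∑ j ∈ Finset.range 5, sqrtCoef j * p ^ (-(2 * j) - 3 / 2 : ℝ) =
      (√p)⁻¹ * p⁻¹ * ∑ j ∈ Finset.range 5, sqrtCoef j * ((p ^ 2)⁻¹) ^ j := by
    rw [Finset.mul_sum]
    refine Finset.sum_congr rfl fun j _ => ?_
    rw [show (-(2 * j) - 3 / 2 : ℝ) = -((2 * j : ℕ) : ℝ) - 1 - 1 / 2 by push_cast; ring,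
      Real.rpow_sub hp0, Real.rpow_sub hp0, ← Real.sqrt_eq_rpow, inv_pow, ← pow_mul,
      Real.rpow_neg hp0.le, Real.rpow_natCast, Real.rpow_one]
    field_simp
  have e2 : (√(p ^ 2 + 1))⁻¹ = p⁻¹ * (√(1 + (p ^ 2)⁻¹))⁻¹ := by
    rw [show p ^ 2 + 1 = p ^ 2 * (1 + (p ^ 2)⁻¹) by field_simp, Real.sqrt_mul (by positivity),
      Real.sqrt_sq hp0.le, mul_inv]
  rw [e, momR, pow_zero, mul_one, e2, ← mul_assoc]
  gcongr

lemma integrableOn_momR_zero : IntegrableOn (momR 0) (Set.Ioi 0) := by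
  rw [← Set.Ioc_union_Ioi_eq_Ioi (zero_le_one (α := ℝ))]
  refine IntegrableOn.union ?_ ?_
  · refine integrableOn_inv_sqrt.mono' (measurable_momR 0).aestronglyMeasurable
      ((ae_restrict_iff' measurableSet_Ioc).2 (Eventually.of_forall fun p hp => ?_))
    rw [Real.norm_eq_abs, abs_of_nonneg (momR_nonneg 0 hp.1.le)]
    exact momR_zero_le_inv_sqrt
  · have h := integrableOn_Ioi_rpow_of_lt (by norm_num : (-(3 / 2) : ℝ) < -1) (zero_lt_one (α := ℝ))
    refine h.mono' (measurable_momR 0).aestronglyMeasurable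
      ((ae_restrict_iff' measurableSet_Ioi).2 (Eventually.of_forall fun p hp => ?_))
    have hp0 : (0 : ℝ) < p := zero_lt_one.trans hp
    rw [Real.norm_eq_abs, abs_of_nonneg (momR_nonneg 0 hp0.le),
      show (-(3 / 2) : ℝ) = -1 - 1 / 2 by norm_num, Real.rpow_sub hp0, ← Real.sqrt_eq_rpow,
      Real.rpow_neg hp0.le, Real.rpow_one, momR, pow_zero, mul_one, div_eq_inv_mul]
    gcongr
    exact Real.le_sqrt_of_sq_le (by linarith)

lemma integrableOn_momR (k : ℕ) : IntegrableOn (momR k) (Set.Ioi 0) := by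
  refine integrableOn_momR_zero.mono' (measurable_momR k).aestronglyMeasurable
    ((ae_restrict_iff' measurableSet_Ioi).2 (Eventually.of_forall fun p hp => ?_))
  have hp0 : 0 < p := hp
  rw [Real.norm_eq_abs, abs_of_nonneg (momR_nonneg k hp0.le)]
  exact momR_le k hp0.le

/-- The inversion `p ↦ 1 / p` exchanges `(0, 1)` and `(1, ∞)`, which is why both pieces give the
same sum of `sqrtCoef j / (2 j + 1/2)`. -/
lemma integral_momR_zero_le : ∫ p in Set.Ioi 0, momR 0 p ≤ 3.7085 := by
  rw [← Set.Ioc_union_Ioi_eq_Ioi (zero_le_one (α := ℝ)), setIntegral_union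
    Set.Ioc_disjoint_Ioi_same measurableSet_Ioi
    (integrableOn_momR_zero.mono_set Set.Ioc_subset_Ioi_self)
    (integrableOn_momR_zero.mono_set (Set.Ioi_subset_Ioi zero_le_one))]
  have i1 : ∀ j ∈ Finset.range 5, IntegrableOn
      (fun p : ℝ => sqrtCoef j * p ^ (2 * j - 1 / 2 : ℝ)) (Set.Ioc 0 1) := fun j _ =>
    ((intervalIntegral.intervalIntegrable_rpow' (a := 0) (b := 1)
      (by have : (0 : ℝ) ≤ j := j.cast_nonneg
          linarith : (-1 : ℝ) < 2 * j - 1 / 2)).1).const_mul _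
  have i2 : ∀ j ∈ Finset.range 5, IntegrableOn
      (fun p : ℝ => sqrtCoef j * p ^ (-(2 * j) - 3 / 2 : ℝ)) (Set.Ioi 1) := fun j _ =>
    (integrableOn_Ioi_rpow_of_lt (by have : (0 : ℝ) ≤ j := j.cast_nonneg
                                     linarith) (zero_lt_one (α := ℝ))).const_mul _
  have h1 : ∫ p in Set.Ioc 0 1, momR 0 p ≤
      ∫ p in Set.Ioc 0 1, ∑ j ∈ Finset.range 5, sqrtCoef j * p ^ (2 * j - 1 / 2 : ℝ) :=
    setIntegral_mono_on (integrableOn_momR_zero.mono_set Set.Ioc_subset_Ioi_self)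
      (integrable_finsetSum _ i1) measurableSet_Ioc
      (fun p hp => momR_zero_le_of_le_one hp.1 hp.2)
  have h2 : ∫ p in Set.Ioi 1, momR 0 p ≤
      ∫ p in Set.Ioi 1, ∑ j ∈ Finset.range 5, sqrtCoef j * p ^ (-(2 * j) - 3 / 2 : ℝ) :=
    setIntegral_mono_on (integrableOn_momR_zero.mono_set (Set.Ioi_subset_Ioi zero_le_one))
      (integrable_finsetSum _ i2) measurableSet_Ioi
      (fun p hp => momR_zero_le_of_one_le (le_of_lt hp))
  rw [integral_finsetSum _ i1] at h1
  rw [integral_finsetSum _ i2] at h2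
  have e1 : ∀ j ∈ Finset.range 5, ∫ p in Set.Ioc (0 : ℝ) 1, sqrtCoef j * p ^ (2 * j - 1 / 2 : ℝ) =
      sqrtCoef j / (2 * j + 1 / 2) := by
    intro j _
    have hj : (0 : ℝ) ≤ j := j.cast_nonneg
    rw [integral_const_mul, ← intervalIntegral.integral_of_le zero_le_one,
      integral_rpow (Or.inl (by linarith)), Real.one_rpow, Real.zero_rpow (by linarith)]
    ring
  have e2 : ∀ j ∈ Finset.range 5, ∫ p in Set.Ioi (1 : ℝ), sqrtCoef j * p ^ (-(2 * j) - 3 / 2 : ℝ) =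
      sqrtCoef j / (2 * j + 1 / 2) := by
    intro j _
    have hj : (0 : ℝ) ≤ j := j.cast_nonneg
    rw [integral_const_mul, integral_Ioi_rpow_of_lt (by linarith) zero_lt_one, Real.one_rpow,
      div_eq_mul_inv (sqrtCoef j)]
    congr 1
    rw [show (-(2 * j) - 3 / 2 + 1 : ℝ) = -(2 * j + 1 / 2) by ring, neg_div_neg_eq, one_div]
  rw [Finset.sum_congr rfl e1] at h1
  rw [Finset.sum_congr rfl e2] at h2
  refine (add_le_add h1 h2).trans ?_
  simp only [Finset.sum_range_succ, Finset.range_zero, Finset.sum_empty, sqrtCoef]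
  norm_num

end LemniscateMoments

/-! ### Angular moments and recurrences for all moments. -/

section LemniscateValues

/-- The Chebyshev weight moments `y ^ j / √(y (1 - y))`. -/
noncomputable def chebMom (j : ℕ) (y : ℝ) : ℝ := (√y)⁻¹ * (√(1 - y))⁻¹ * y ^ j

lemma hasDerivAt_arcsin_cheb {y : ℝ} (hy : y ∈ Set.Ioo (0 : ℝ) 1) :
    HasDerivAt (fun y : ℝ => Real.arcsin (2 * y - 1)) (chebMom 0 y) y := by
  obtain ⟨h0, h1⟩ := hy
  have hd := (Real.hasDerivAt_arcsin (x := 2 * y - 1) (by linarith) (by linarith)).comp y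
    (((hasDerivAt_id' y).const_mul 2).sub_const 1)
  refine hd.congr_deriv ?_
  rw [show 1 - (2 * y - 1) ^ 2 = 2 ^ 2 * (y * (1 - y)) by ring, Real.sqrt_mul (by positivity),
    Real.sqrt_sq (by norm_num), Real.sqrt_mul h0.le, chebMom]
  have : 0 < √y := Real.sqrt_pos.2 h0
  have : 0 < √(1 - y) := Real.sqrt_pos.2 (by linarith)
  field_simp

lemma integrableOn_chebMom (j : ℕ) : IntegrableOn (chebMom j) (Set.Ioc 0 1) := by
  have h0 : IntegrableOn (chebMom 0) (Set.Ioc 0 1) :=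
    intervalIntegral.integrableOn_deriv_of_nonneg (g := fun y : ℝ => Real.arcsin (2 * y - 1))
      (Continuous.continuousOn (by fun_prop)) (fun y hy => hasDerivAt_arcsin_cheb hy)
      (fun y hy => by unfold chebMom; have := hy.1; positivity)
  refine h0.mono' (by unfold chebMom; fun_prop) ((ae_restrict_iff' measurableSet_Ioc).2
    (Eventually.of_forall fun y hy => ?_))
  have hy0 := hy.1
  have : y ^ j ≤ 1 := pow_le_one₀ hy.1.le hy.2
  rw [Real.norm_eq_abs, abs_of_nonneg (by unfold chebMom; positivity)]
  simp only [chebMom, pow_zero]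
  gcongr

lemma integral_chebMom_zero : ∫ y in (0 : ℝ)..1, chebMom 0 y = Real.pi := by
  rw [intervalIntegral.integral_eq_sub_of_hasDerivAt_of_le zero_le_one
    (f := fun y : ℝ => Real.arcsin (2 * y - 1)) (Continuous.continuousOn (by fun_prop))
    (fun y hy => hasDerivAt_arcsin_cheb hy)
    ((intervalIntegrable_iff_integrableOn_Ioc_of_le zero_le_one).2 (integrableOn_chebMom 0))]
  norm_num [Real.arcsin_one, Real.arcsin_neg_one]

/-- Integrate the derivative of `√y √(1 - y) y ^ j`, which vanishes at both ends. -/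
lemma integral_chebMom_succ (j : ℕ) : ∫ y in (0 : ℝ)..1, chebMom (j + 1) y =
    (j + 1 / 2) / (j + 1) * ∫ y in (0 : ℝ)..1, chebMom j y := by
  have hi (j : ℕ) : IntervalIntegrable (chebMom j) volume 0 1 :=
    (intervalIntegrable_iff_integrableOn_Ioc_of_le zero_le_one).2 (integrableOn_chebMom j)
  have h := intervalIntegral.integral_eq_sub_of_hasDerivAt_of_le (zero_le_one (α := ℝ))
    (f := fun y : ℝ => √y * √(1 - y) * y ^ j)
    (f' := fun y => (j + 1 / 2) * chebMom j y - (j + 1) * chebMom (j + 1) y)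
    (Continuous.continuousOn (by fun_prop)) (fun y hy => by
      obtain ⟨h0, h1⟩ := hy
      have h1' : 0 < 1 - y := by linarith
      have hs0 : 0 < √y := Real.sqrt_pos.2 h0
      have hs1 : 0 < √(1 - y) := Real.sqrt_pos.2 h1'
      have d := (((hasDerivAt_id' y).sqrt h0.ne').mul
        (((hasDerivAt_id' y).const_sub 1).sqrt h1'.ne')).mul (hasDerivAt_pow j y)
      refine d.congr_deriv ?_
      have q0 : √y ^ 2 = y := Real.sq_sqrt h0.le
      have q1 : √(1 - y) ^ 2 = 1 - y := Real.sq_sqrt h1'.le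
      simp only [chebMom, Pi.mul_apply]
      have hpow : (j : ℝ) * y ^ (j - 1) = j * y ^ j / y := by
        rcases j with _ | j
        · simp
        · simp only [Nat.add_sub_cancel, pow_succ]; field_simp
      rw [hpow]
      field_simp
      rw [q0, q1]
      field_simp
      ring) (((hi j).const_mul _).sub ((hi (j + 1)).const_mul _))
  rw [intervalIntegral.integral_sub ((hi j).const_mul _) ((hi (j + 1)).const_mul _),
    intervalIntegral.integral_const_mul, intervalIntegral.integral_const_mul] at h
  simp at h
  have : (0 : ℝ) < j + 1 := by positivity
  field_simp
  linarith

/-- Since `1 - y² = (1 - y)(1 + y)`, the regular factor `1 / √(1 + y)` is replaced by its polynomial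
majorant and Chebyshev moments remain. -/
lemma momA_zero_le {y : ℝ} (hy : y ∈ Set.Ioo (0 : ℝ) 1) :
    momA 0 y ≤ ∑ j ∈ Finset.range 5, sqrtCoef j * chebMom j y := by
  obtain ⟨h0, h1⟩ := hy
  have h := inv_sqrt_one_add_le_sum h0.le h1.le
  have e : ∑ j ∈ Finset.range 5, sqrtCoef j * chebMom j y =
      (√y)⁻¹ * (√(1 - y))⁻¹ * ∑ j ∈ Finset.range 5, sqrtCoef j * y ^ j := by
    rw [Finset.mul_sum]
    refine Finset.sum_congr rfl fun j _ => ?_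
    rw [chebMom]; ring
  rw [e, momA, pow_zero, mul_one, show 1 - y ^ 2 = (1 - y) * (1 + y) by ring,
    Real.sqrt_mul (by linarith), mul_inv, ← mul_assoc]
  gcongr

lemma integrableOn_momA_zero : IntegrableOn (momA 0) (Set.Ioo 0 1) := by
  refine ((integrableOn_chebMom 0).mono_set Set.Ioo_subset_Ioc_self).mono'
    (measurable_momA 0).aestronglyMeasurable
    ((ae_restrict_iff' measurableSet_Ioo).2 (Eventually.of_forall fun y hy => ?_))
  have : 0 < 1 - y := by linarith [hy.2]
  have h0 := hy.1
  rw [Real.norm_eq_abs, abs_of_nonneg (momA_nonneg 0 y)]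
  simp only [momA, chebMom, pow_zero, mul_one]
  gcongr
  nlinarith

lemma integrableOn_momA (k : ℕ) : IntegrableOn (momA k) (Set.Ioo 0 1) := by
  refine integrableOn_momA_zero.mono' (measurable_momA k).aestronglyMeasurable
    (Eventually.of_forall fun y => ?_)
  rw [Real.norm_eq_abs, abs_of_nonneg (momA_nonneg k y)]
  exact momA_le k

lemma integral_momA_zero_le : ∫ y in Set.Ioo (0 : ℝ) 1, momA 0 y ≤ 2.6224 := by
  have i1 : ∀ j ∈ Finset.range 5, IntegrableOn
      (fun y : ℝ => sqrtCoef j * chebMom j y) (Set.Ioo 0 1) := fun j _ =>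
    ((integrableOn_chebMom j).mono_set Set.Ioo_subset_Ioc_self).const_mul _
  have h1 := setIntegral_mono_on integrableOn_momA_zero (integrable_finsetSum _ i1)
    measurableSet_Ioo (fun y hy => momA_zero_le hy)
  rw [integral_finsetSum _ i1] at h1
  refine h1.trans ?_
  have e (j : ℕ) : ∫ y in Set.Ioo (0 : ℝ) 1, sqrtCoef j * chebMom j y =
      sqrtCoef j * ∫ y in (0 : ℝ)..1, chebMom j y := by
    rw [integral_const_mul, intervalIntegral.integral_of_le zero_le_one, integral_Ioc_eq_integral_Ioo]
  rw [Finset.sum_congr rfl fun j _ => e j]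
  simp only [Finset.sum_range_succ, Finset.range_zero, Finset.sum_empty, sqrtCoef,
    integral_chebMom_succ, integral_chebMom_zero]
  have := Real.pi_lt_d4
  push_cast
  nlinarith

lemma integral_momA_one : ∫ y in Set.Ioo (0 : ℝ) 1, momA 1 y = 2 := by
  have hi : IntervalIntegrable (momA 1) volume 0 1 :=
    (intervalIntegrable_iff_integrableOn_Ioo_of_le zero_le_one).2 (integrableOn_momA 1)
  have h := intervalIntegral.integral_eq_sub_of_hasDerivAt_of_le (zero_le_one (α := ℝ))
    (f := fun y : ℝ => 2 * √y) (f' := momA 1) (Continuous.continuousOn (by fun_prop))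
    (fun y hy => by
      refine ((((hasDerivAt_id' y).sqrt hy.1.ne').const_mul 2)).congr_deriv ?_
      have : 0 < √(1 - y ^ 2) := Real.sqrt_pos.2 (by nlinarith [hy.1, hy.2])
      have : 0 < √y := Real.sqrt_pos.2 hy.1
      rw [momA]
      field_simp) hi
  rw [← integral_Ioc_eq_integral_Ioo, ← intervalIntegral.integral_of_le zero_le_one, h]
  simp

/-- Integrate the derivative of `√y (1 - y²) ^ ((k + 1) / 2)`, which vanishes at both ends. -/
lemma integral_momA_add_two (k : ℕ) : ∫ y in Set.Ioo (0 : ℝ) 1, momA (k + 2) y =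
    (2 * k + 2) / (2 * k + 3) * ∫ y in Set.Ioo (0 : ℝ) 1, momA k y := by
  have hi (j : ℕ) : IntervalIntegrable (momA j) volume 0 1 :=
    (intervalIntegrable_iff_integrableOn_Ioo_of_le zero_le_one).2 (integrableOn_momA j)
  have h := intervalIntegral.integral_eq_sub_of_hasDerivAt_of_le (zero_le_one (α := ℝ))
    (f := fun y : ℝ => √y * √(1 - y ^ 2) ^ (k + 1))
    (f' := fun y => (k + 3 / 2) * momA (k + 2) y - (k + 1) * momA k y)
    (Continuous.continuousOn (by fun_prop)) (fun y hy => by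
      obtain ⟨h0, h1⟩ := hy
      have h1' : 0 < 1 - y ^ 2 := by nlinarith
      have hs0 : 0 < √y := Real.sqrt_pos.2 h0
      have hs1 : 0 < √(1 - y ^ 2) := Real.sqrt_pos.2 h1'
      have d := ((hasDerivAt_id' y).sqrt h0.ne').mul
        ((((hasDerivAt_pow 2 y).const_sub 1).sqrt h1'.ne').pow (k + 1))
      refine d.congr_deriv ?_
      have q0 : √y ^ 2 = y := Real.sq_sqrt h0.le
      have q1 : √(1 - y ^ 2) ^ 2 = 1 - y ^ 2 := Real.sq_sqrt h1'.le
      simp only [momA, Pi.pow_apply, Nat.add_sub_cancel, pow_succ √(1 - y ^ 2)]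
      set c := √(1 - y ^ 2)
      push_cast
      field_simp
      rw [q0, q1]
      ring) (((hi (k + 2)).const_mul _).sub ((hi k).const_mul _))
  rw [intervalIntegral.integral_sub ((hi (k + 2)).const_mul _) ((hi k).const_mul _),
    intervalIntegral.integral_const_mul, intervalIntegral.integral_const_mul] at h
  simp only [intervalIntegral.integral_of_le zero_le_one, integral_Ioc_eq_integral_Ioo] at h
  simp at h
  field_simp
  linarith

/-- Integrate the derivative of `√p / √(p² + 1) * (p / √(p² + 1)) ^ k`, which vanishes at `0` and at
infinity. -/
lemma integral_momR_add_two (k : ℕ) : ∫ p in Set.Ioi (0 : ℝ), momR (k + 2) p =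
    (2 * k + 1) / (2 * k + 2) * ∫ p in Set.Ioi (0 : ℝ), momR k p := by
  have h := integral_Ioi_of_hasDerivAt_of_tendsto (a := 0) (m := 0)
    (f := fun p : ℝ => √p * (√(p ^ 2 + 1))⁻¹ * (p / √(p ^ 2 + 1)) ^ k)
    (f' := fun p => (k + 1 / 2) * momR k p - (k + 1) * momR (k + 2) p)
    (by
      have hne : ∀ p : ℝ, √(p ^ 2 + 1) ≠ 0 := fun p => (Real.sqrt_pos.2 (by positivity)).ne'
      exact Continuous.continuousWithinAt (by fun_prop (disch := exact hne _))) (fun p hp => by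
      have h0 : 0 < p := hp
      have hE : 0 < √(p ^ 2 + 1) := Real.sqrt_pos.2 (by positivity)
      have hs0 : 0 < √p := Real.sqrt_pos.2 h0
      have dE := ((hasDerivAt_pow 2 p).add_const (1 : ℝ)).sqrt (by positivity)
      have d := (((hasDerivAt_id' p).sqrt h0.ne').mul (dE.inv hE.ne')).mul
        (((hasDerivAt_id' p).div dE hE.ne').pow k)
      refine d.congr_deriv ?_
      have q0 : √p ^ 2 = p := Real.sq_sqrt h0.le
      have q1 : √(p ^ 2 + 1) ^ 2 = p ^ 2 + 1 := Real.sq_sqrt (by positivity)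
      have hpow (x : ℝ) (hx : x ≠ 0) : (k : ℝ) * x ^ (k - 1) = k * x ^ k / x := by
        rcases k with _ | k
        · simp
        · simp only [Nat.add_sub_cancel, pow_succ]; field_simp
      simp only [momR, Pi.pow_apply, Pi.mul_apply, Pi.div_apply, Pi.inv_apply, pow_add]
      rw [hpow _ (by positivity)]
      set E := √(p ^ 2 + 1)
      have q2 : E ^ 4 = (p ^ 2 + 1) ^ 2 := by rw [← q1]; ring
      push_cast
      field_simp
      simp only [q0, q1]
      field_simp
      ring_nf) (((integrableOn_momR k).const_mul _).sub ((integrableOn_momR (k + 2)).const_mul _))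
    (by
      have hlim : Tendsto (fun p : ℝ => (√p)⁻¹) atTop (𝓝 0) :=
        tendsto_inv_atTop_zero.comp Real.tendsto_sqrt_atTop
      refine squeeze_zero' ?_ ?_ hlim
      · filter_upwards [eventually_gt_atTop 0] with p hp
        positivity
      · filter_upwards [eventually_gt_atTop 0] with p hp
        have h1 : p ≤ √(p ^ 2 + 1) := Real.le_sqrt_of_sq_le (by linarith)
        have h2 : (p / √(p ^ 2 + 1)) ^ k ≤ 1 :=
          pow_le_one₀ (by positivity) (by rw [div_le_one (by positivity)]; exact h1)
        calc √p * (√(p ^ 2 + 1))⁻¹ * (p / √(p ^ 2 + 1)) ^ k ≤ √p * p⁻¹ * 1 := by gcongr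
          _ = (√p)⁻¹ := by
            have : √p ^ 2 = p := Real.sq_sqrt hp.le
            have : 0 < √p := Real.sqrt_pos.2 hp
            field_simp
            linarith)
  rw [integral_sub ((integrableOn_momR k).const_mul _) ((integrableOn_momR (k + 2)).const_mul _),
    integral_const_mul, integral_const_mul] at h
  simp at h
  have : (0 : ℝ) < 2 * k + 2 := by positivity
  field_simp
  linarith

lemma integral_momR_one : ∫ p in Set.Ioi (0 : ℝ), momR 1 p = Real.pi / √2 := by
  have s2 : √2 ^ 2 = (2 : ℝ) := Real.sq_sqrt (by norm_num)
  have s20 : (0 : ℝ) < √2 := by positivity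
  have hneg (r : ℝ) : 0 < r ^ 2 - √2 * r + 1 := by nlinarith [sq_nonneg (2 * r - √2)]
  have hpos (r : ℝ) : 0 < r ^ 2 + √2 * r + 1 := by nlinarith [sq_nonneg (2 * r + √2)]
  -- With `p = r²` the integrand becomes `2 r² / (1 + r⁴)`; `Q` is its primitive by partial
  -- fractions.
  set Q : ℝ → ℝ := fun r => 1 / √2 * (Real.arctan (√2 * r + 1) + Real.arctan (√2 * r - 1)) +
    1 / (2 * √2) * (Real.log (r ^ 2 - √2 * r + 1) - Real.log (r ^ 2 + √2 * r + 1)) with hQ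
  have hQd (r : ℝ) : HasDerivAt Q (2 * r ^ 2 / (1 + r ^ 4)) r := by
    have l1 : HasDerivAt (fun r : ℝ => √2 * r + 1) √2 r := by
      simpa using ((hasDerivAt_id' r).const_mul √2).add_const (1 : ℝ)
    have l2 : HasDerivAt (fun r : ℝ => √2 * r - 1) √2 r := by
      simpa using ((hasDerivAt_id' r).const_mul √2).sub_const (1 : ℝ)
    have l3 : HasDerivAt (fun r : ℝ => r ^ 2 - √2 * r + 1) (2 * r - √2) r := by
      simpa using ((hasDerivAt_pow 2 r).sub ((hasDerivAt_id' r).const_mul √2)).add_const (1 : ℝ)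
    have l4 : HasDerivAt (fun r : ℝ => r ^ 2 + √2 * r + 1) (2 * r + √2) r := by
      simpa using ((hasDerivAt_pow 2 r).add ((hasDerivAt_id' r).const_mul √2)).add_const (1 : ℝ)
    have d := ((l1.arctan.add l2.arctan).const_mul (1 / √2)).add
      (((l3.log (hneg r).ne').sub (l4.log (hpos r).ne')).const_mul (1 / (2 * √2)))
    refine d.congr_deriv ?_
    have e1 : 1 + (√2 * r + 1) ^ 2 = 2 * (r ^ 2 + √2 * r + 1) := by linear_combination r ^ 2 * s2
    have e2 : 1 + (√2 * r - 1) ^ 2 = 2 * (r ^ 2 - √2 * r + 1) := by linear_combination r ^ 2 * s2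
    have e3 : 1 + r ^ 4 = (r ^ 2 + √2 * r + 1) * (r ^ 2 - √2 * r + 1) := by
      linear_combination r ^ 2 * s2
    have h1 := (hneg r).ne'
    have h2 := (hpos r).ne'
    rw [e1, e2, e3]
    have key : (2 * r - √2) * (r ^ 2 + √2 * r + 1) - (2 * r + √2) * (r ^ 2 - √2 * r + 1) =
        4 * √2 * r ^ 2 - √2 * ((r ^ 2 - √2 * r + 1) + (r ^ 2 + √2 * r + 1)) := by ring
    generalize r ^ 2 - √2 * r + 1 = a at *
    generalize r ^ 2 + √2 * r + 1 = b at *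
    have e4 : (2 * r - √2) / a - (2 * r + √2) / b =
        (4 * √2 * r ^ 2 - √2 * (a + b)) / (a * b) := by
      rw [← key]; field_simp
    rw [e4]
    field_simp
    ring
  have h := integral_Ioi_of_hasDerivAt_of_tendsto (a := 0) (m := Real.pi / √2)
    (f := fun p : ℝ => Q √p) (f' := momR 1)
    (by
      have : Continuous Q := continuous_iff_continuousAt.2 fun r => (hQd r).continuousAt
      exact (this.comp Real.continuous_sqrt).continuousWithinAt)
    (fun p hp => by
      have h0 : 0 < p := hp
      have hs0 : 0 < √p := Real.sqrt_pos.2 h0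
      have q0 : √p ^ 2 = p := Real.sq_sqrt h0.le
      refine ((hQd √p).comp p ((hasDerivAt_id' p).sqrt h0.ne')).congr_deriv ?_
      rw [show √p ^ 4 = (√p ^ 2) ^ 2 by ring, q0, momR, pow_one]
      have hE2 : √(p ^ 2 + 1) ^ 2 = p ^ 2 + 1 := Real.sq_sqrt (by positivity)
      have hE : 0 < √(p ^ 2 + 1) := Real.sqrt_pos.2 (by positivity)
      generalize √(p ^ 2 + 1) = E at *
      rw [show 1 + p ^ 2 = E ^ 2 by linarith]
      field_simp) (integrableOn_momR 1)
    (by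
      have hQ' : Tendsto Q atTop (𝓝 (1 / √2 * (Real.pi / 2 + Real.pi / 2) + 1 / (2 * √2) * 0)) := by
        have t0 : Tendsto (fun r : ℝ => √2 * r) atTop atTop := tendsto_id.const_mul_atTop s20
        have t1 := (Real.tendsto_arctan_atTop.mono_right nhdsWithin_le_nhds).comp
          (tendsto_atTop_add_const_right atTop (1 : ℝ) t0)
        have t2 := (Real.tendsto_arctan_atTop.mono_right nhdsWithin_le_nhds).comp
          (tendsto_atTop_add_const_right atTop (-1 : ℝ) t0)
        refine Tendsto.add ((t1.add t2).const_mul _) (Tendsto.const_mul _ ?_)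
        have e : (fun r : ℝ => Real.log (r ^ 2 - √2 * r + 1) - Real.log (r ^ 2 + √2 * r + 1)) =
            fun r => Real.log ((r ^ 2 - √2 * r + 1) / (r ^ 2 + √2 * r + 1)) := by
          funext r
          rw [Real.log_div (hneg r).ne' (hpos r).ne']
        rw [e, ← Real.log_one]
        refine (Real.continuousAt_log one_ne_zero).tendsto.comp ?_
        have hinv : Tendsto (fun r : ℝ => r⁻¹) atTop (𝓝 0) := tendsto_inv_atTop_zero
        have e2 : (fun r : ℝ => (r ^ 2 - √2 * r + 1) / (r ^ 2 + √2 * r + 1)) =ᶠ[atTop]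
            fun r => (1 - √2 * r⁻¹ + r⁻¹ ^ 2) / (1 + √2 * r⁻¹ + r⁻¹ ^ 2) := by
          filter_upwards [eventually_gt_atTop 0] with r hr
          have := hpos r
          have h5 : 0 < 1 + √2 * r⁻¹ + r⁻¹ ^ 2 := by positivity
          rw [div_eq_div_iff this.ne' h5.ne']
          field_simp
        refine Tendsto.congr' e2.symm ?_
        have h3 := (((tendsto_const_nhds (x := (1 : ℝ))).sub (hinv.const_mul √2)).add (hinv.pow 2)).div
          (((tendsto_const_nhds (x := (1 : ℝ))).add (hinv.const_mul √2)).add (hinv.pow 2))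
          (by norm_num)
        have e3 : ((1 - √2 * 0 + 0 ^ 2) / (1 + √2 * 0 + 0 ^ 2) : ℝ) = 1 := by norm_num
        rw [e3] at h3
        exact h3
      have h2 := hQ'.comp Real.tendsto_sqrt_atTop
      rw [show Real.pi / √2 = 1 / √2 * (Real.pi / 2 + Real.pi / 2) + 1 / (2 * √2) * 0 by ring]
      exact h2)
  rw [h]
  simp [hQ, Real.arctan_neg]

end LemniscateValues

/-! ### The numerical bound for all horizontal lines. -/

section HorizontalTotal

/-- The coefficients of the polynomial majorant of `1 + x ^ 2 / (1 + x)`. -/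
noncomputable def gapCoef : ℕ → ℝ
  | 0 => 1
  | 1 => 1 / 64
  | 2 => 55 / 64
  | 3 => -(33 / 64)
  | 4 => 9 / 64
  | _ => 0

lemma gapDensity_nonneg {G E : ℝ} (hG : 0 ≤ G) (hE : 0 ≤ E) : 0 ≤ gapDensity G E := by
  unfold gapDensity; positivity

/-- The total transport cost of the horizontal lines above height `1/2`. -/
lemma lintegral_lineCost_lt :
    ∫⁻ t in Set.Ioi (1 / 2 : ℝ), lineCost t ≤ ENNReal.ofReal (5.767 / 4) := by
  set S : ℝ → ℝ → ℝ := fun p y =>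
    ∑ k ∈ Finset.range 5, gapCoef k * (momR k p * momA k y) with hS
  have hle : ∀ p, 0 < p → ∀ y ∈ Set.Ioo (0 : ℝ) 1,
      p * ((p * y) ^ (1 / 2 - 1 : ℝ) * gapDensity √(p ^ 2 - (p * y) ^ 2) √(p ^ 2 + 1)) ≤
        1 / 4 * S p y := by
    intro p hp y hy
    refine (gap_integrand_le hp hy).trans_eq ?_
    simp only [hS, Finset.sum_range_succ, Finset.range_zero, Finset.sum_empty, gapCoef]
    ring
  have hS0 : ∀ p, 0 < p → ∀ y ∈ Set.Ioo (0 : ℝ) 1, 0 ≤ 1 / 4 * S p y := by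
    intro p hp y hy
    refine le_trans ?_ (hle p hp y hy)
    have := hy.1
    have := gapDensity_nonneg (Real.sqrt_nonneg (p ^ 2 - (p * y) ^ 2)) (Real.sqrt_nonneg (p ^ 2 + 1))
    positivity
  set N : ℕ → ℝ := fun k => ∫ y in Set.Ioo (0 : ℝ) 1, momA k y with hN
  set M : ℕ → ℝ := fun k => ∫ p in Set.Ioi (0 : ℝ), momR k p with hM
  have iS (p : ℝ) : ∀ k ∈ Finset.range 5, IntegrableOn
      (fun y => gapCoef k * (momR k p * momA k y)) (Set.Ioo 0 1) := fun k _ =>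
    ((integrableOn_momA k).const_mul _).const_mul _
  have eS (p : ℝ) : ∫ y in Set.Ioo (0 : ℝ) 1, 1 / 4 * S p y =
      1 / 4 * ∑ k ∈ Finset.range 5, gapCoef k * (momR k p * N k) := by
    rw [integral_const_mul, hS]
    simp only
    rw [integral_finsetSum _ (iS p)]
    simp only [integral_const_mul, hN]
  have inner (p : ℝ) (hp : 0 < p) : ∫⁻ y in Set.Ioo (0 : ℝ) 1, ENNReal.ofReal
      (p * ((p * y) ^ (1 / 2 - 1 : ℝ) * gapDensity √(p ^ 2 - (p * y) ^ 2) √(p ^ 2 + 1))) ≤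
      ENNReal.ofReal (1 / 4 * ∑ k ∈ Finset.range 5, gapCoef k * (momR k p * N k)) := by
    rw [← eS p, ofReal_integral_eq_lintegral_ofReal ((integrable_finsetSum _ (iS p)).const_mul _)
      ((ae_restrict_iff' measurableSet_Ioo).2 (Eventually.of_forall fun y hy => hS0 p hp y hy))]
    exact setLIntegral_mono' measurableSet_Ioo fun y hy => ENNReal.ofReal_le_ofReal (hle p hp y hy)
  have hT0 (p : ℝ) (hp : 0 < p) :
      0 ≤ 1 / 4 * ∑ k ∈ Finset.range 5, gapCoef k * (momR k p * N k) := by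
    rw [← eS p]
    exact setIntegral_nonneg measurableSet_Ioo fun y hy => hS0 p hp y hy
  have iT : ∀ k ∈ Finset.range 5, IntegrableOn
      (fun p => gapCoef k * (momR k p * N k)) (Set.Ioi 0) := fun k _ =>
    ((integrableOn_momR k).mul_const _).const_mul _
  have outer : ∫⁻ p in Set.Ioi (0 : ℝ), ENNReal.ofReal
      (1 / 4 * ∑ k ∈ Finset.range 5, gapCoef k * (momR k p * N k)) =
      ENNReal.ofReal (1 / 4 * ∑ k ∈ Finset.range 5, gapCoef k * (M k * N k)) := by
    rw [← ofReal_integral_eq_lintegral_ofReal ((integrable_finsetSum _ iT).const_mul _)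
      ((ae_restrict_iff' measurableSet_Ioi).2 (Eventually.of_forall fun p hp => hT0 p hp)),
      integral_const_mul, integral_finsetSum _ iT]
    simp only [integral_const_mul, integral_mul_const, hM]
  refine lintegral_lineCost_le.trans ?_
  calc _ ≤ ENNReal.ofReal (1 / 2) * ENNReal.ofReal
        (1 / 4 * ∑ k ∈ Finset.range 5, gapCoef k * (M k * N k)) := by
        rw [← outer]
        gcongr ENNReal.ofReal (1 / 2) * ?_
        exact setLIntegral_mono' measurableSet_Ioi fun p hp => inner p hp
    _ ≤ _ := by
        rw [← ENNReal.ofReal_mul (by norm_num)]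
        refine ENNReal.ofReal_le_ofReal ?_
        have m0 : M 0 ≤ 3.7085 := integral_momR_zero_le
        have n0 : N 0 ≤ 2.6224 := integral_momA_zero_le
        have m1 : M 1 = Real.pi / √2 := integral_momR_one
        have n1 : N 1 = 2 := integral_momA_one
        have m2 : M 2 = 1 / 2 * M 0 := by
          simp only [hM]; rw [integral_momR_add_two 0]; norm_num
        have m3 : M 3 = 3 / 4 * M 1 := by
          simp only [hM]; rw [integral_momR_add_two 1]; norm_num
        have m4 : M 4 = 5 / 6 * M 2 := by
          simp only [hM]; rw [integral_momR_add_two 2]; norm_num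
        have n2 : N 2 = 2 / 3 * N 0 := by
          simp only [hN]; rw [integral_momA_add_two 0]; norm_num
        have n3 : N 3 = 4 / 5 * N 1 := by
          simp only [hN]; rw [integral_momA_add_two 1]; norm_num
        have n4 : N 4 = 6 / 7 * N 2 := by
          simp only [hN]; rw [integral_momA_add_two 2]; norm_num
        have m00 : 0 ≤ M 0 := setIntegral_nonneg measurableSet_Ioi fun p hp =>
          momR_nonneg 0 (le_of_lt hp)
        have h00 : M 0 * N 0 ≤ 3.7085 * 2.6224 := by
          calc M 0 * N 0 ≤ M 0 * 2.6224 := by gcongr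
            _ ≤ _ := by gcongr
        -- The recurrences reduce everything to `M 0 * N 0` and `M 1 * N 1`. The odd moments have
        -- negative total weight `1/64 - (33/64)(3/5)`, so the second product needs a lower bound.
        have h11 : 4.4427 ≤ M 1 * N 1 := by
          rw [m1, n1, div_mul_eq_mul_div, le_div_iff₀ (by positivity)]
          have h1 := Real.pi_gt_d4
          have h2 : √2 ≤ 1.41422 := Real.sqrt_le_iff.2 ⟨by norm_num, by norm_num⟩
          linarith
        simp only [Finset.sum_range_succ, Finset.range_zero, Finset.sum_empty, gapCoef]
        rw [m4, m3, m2, n4, n3, n2]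
        nlinarith

end HorizontalTotal

/-! ### Densities for the vertical transport in the strip. -/

section StripDensities

lemma lintegral_deriv_Ioo {f f' : ℝ → ℝ} {a b : ℝ} (hab : a ≤ b)
    (hc : ContinuousOn f (Set.Icc a b)) (hd : ∀ x ∈ Set.Ioo a b, HasDerivAt f (f' x) x)
    (h0 : ∀ x ∈ Set.Ioo a b, 0 ≤ f' x) :
    ∫⁻ x in Set.Ioo a b, ENNReal.ofReal (f' x) = ENNReal.ofReal (f b - f a) := by
  have hi := intervalIntegral.integrableOn_deriv_of_nonneg hc hd h0
  rw [← ofReal_integral_eq_lintegral_ofReal (hi.mono_set Set.Ioo_subset_Ioc_self)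
    ((ae_restrict_iff' measurableSet_Ioo).2 (Eventually.of_forall h0)),
    ← integral_Ioc_eq_integral_Ioo, ← intervalIntegral.integral_of_le hab,
    intervalIntegral.integral_eq_sub_of_hasDerivAt_of_le hab hc hd
      ((intervalIntegrable_iff_integrableOn_Ioc_of_le hab).2 hi)]

/-- The kernel of the upper centre, at depth `l` below it. -/
noncomputable def kerA (s l : ℝ) : ℝ := 1 / 2 * ((s ^ 2 - l ^ 2) / (s ^ 2 + l ^ 2) ^ 2)

/-- Minus the kernel of the lower centre, at depth `l` below the upper one. -/
noncomputable def kerB (s l : ℝ) : ℝ :=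
  1 / 2 * (((1 - l) ^ 2 - s ^ 2) / ((1 - l) ^ 2 + s ^ 2) ^ 2)

/-- The cost density of the transport inside a vertical half line. -/
noncomputable def pairDens (s l : ℝ) : ℝ :=
  if s < l then (l ^ 2 - s ^ 2) / (s ^ 2 + l ^ 2) ^ 2 * √(l - s ^ 2 / l) else 0

/-- The mass density transported across the axis of the strip. -/
noncomputable def crossDens (s l : ℝ) : ℝ := kerB s l + if l < 2 * s ^ 2 then kerA s l else 0

/-- The part of `crossDens` that lies close to the centres. -/
noncomputable def nearDens (s l : ℝ) : ℝ :=
  if l < 0.005 ∧ l < 2 * s ^ 2 ∧ s < 0.09 then kerA s l else 0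

lemma kerA_nonneg {s l : ℝ} (hl : l ∈ Set.Ioo (0 : ℝ) (1 / 2)) (hs : 0 < s)
    (h : l < 2 * s ^ 2) : 0 ≤ kerA s l := by
  have h0 := hl.1
  have h1 := hl.2
  have : l ^ 2 ≤ s ^ 2 := by nlinarith
  unfold kerA
  have : 0 ≤ s ^ 2 - l ^ 2 := by linarith
  positivity

lemma kerB_nonneg {s l : ℝ} (hl : l < 1 / 2) (hs : 0 < s) (h : s ≤ 1 / 2) : 0 ≤ kerB s l := by
  have : 0 ≤ (1 - l) ^ 2 - s ^ 2 := by nlinarith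
  unfold kerB
  positivity

/-- Over a common denominator the numerator contains `(1 - l)² - l²`, positive above the axis. The
other factor is nonnegative because `l ≤ s`, a consequence of `l < 2 s²` and `l < 1/2`. -/
lemma kerA_add_kerB_nonneg {s l : ℝ} (hl : l ∈ Set.Ioo (0 : ℝ) (1 / 2)) (hs : 0 < s)
    (h : l < 2 * s ^ 2) : 0 ≤ kerA s l + kerB s l := by
  obtain ⟨h0, h1⟩ := hl
  have hls : l ^ 2 ≤ s ^ 2 := by nlinarith
  have hb : l ^ 2 ≤ (1 - l) ^ 2 := by nlinarith
  have e : kerA s l + kerB s l = 1 / 2 * (((1 - l) ^ 2 - l ^ 2) *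
      (3 * (s ^ 2) ^ 2 + s ^ 2 * ((1 - l) ^ 2 + l ^ 2) - l ^ 2 * (1 - l) ^ 2) /
      ((s ^ 2 + l ^ 2) ^ 2 * ((1 - l) ^ 2 + s ^ 2) ^ 2)) := by
    have hA : s ^ 2 + l ^ 2 ≠ 0 := by positivity
    have hB : (1 - l) ^ 2 + s ^ 2 ≠ 0 := by positivity
    rw [kerA, kerB]
    generalize (1 - l) ^ 2 = b at *
    field_simp
    ring
  rw [e]
  have hk : 0 ≤ 3 * (s ^ 2) ^ 2 + s ^ 2 * ((1 - l) ^ 2 + l ^ 2) - l ^ 2 * (1 - l) ^ 2 := by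
    nlinarith [mul_le_mul_of_nonneg_right hls (sq_nonneg (1 - l)), sq_nonneg (s ^ 2),
      mul_nonneg (sq_nonneg s) (sq_nonneg l)]
  have : 0 ≤ (1 - l) ^ 2 - l ^ 2 := by linarith
  positivity

/-- Where `kerA` is cut off one has `2 s² ≤ l < 1/2`, hence `s ≤ 1/2` and `kerB` is nonnegative. The
sign allows the crossing mass to be estimated pointwise. -/
lemma crossDens_nonneg {s l : ℝ} (hl : l ∈ Set.Ioo (0 : ℝ) (1 / 2)) (hs : 0 < s) :
    0 ≤ crossDens s l := by
  unfold crossDens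
  split_ifs with h
  · rw [add_comm]; exact kerA_add_kerB_nonneg hl hs h
  · rw [add_zero]
    refine kerB_nonneg hl.2 hs ?_
    nlinarith [hl.2]

lemma nearDens_nonneg {s l : ℝ} (hl : l ∈ Set.Ioo (0 : ℝ) (1 / 2)) (hs : 0 < s) :
    0 ≤ nearDens s l := by
  unfold nearDens
  split_ifs with h
  · exact kerA_nonneg hl hs h.2.1
  · exact le_rfl

lemma nearDens_le_crossDens {s l : ℝ} (hl : l ∈ Set.Ioo (0 : ℝ) (1 / 2)) (hs : 0 < s) :
    nearDens s l ≤ crossDens s l := by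
  by_cases h : l < 0.005 ∧ l < 2 * s ^ 2 ∧ s < 0.09
  · have := kerB_nonneg hl.2 hs (by linarith [h.2.2])
    rw [nearDens, crossDens, if_pos h, if_pos h.2.1]
    linarith
  · rw [nearDens, if_neg h]
    exact crossDens_nonneg hl hs

lemma measurable_kerA : Measurable fun q : ℝ × ℝ => kerA q.1 q.2 := by
  unfold kerA; fun_prop

lemma measurable_kerB : Measurable fun q : ℝ × ℝ => kerB q.1 q.2 := by
  unfold kerB; fun_prop

lemma measurable_pairDens : Measurable fun q : ℝ × ℝ => pairDens q.1 q.2 := by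
  unfold pairDens
  exact Measurable.ite (measurableSet_lt measurable_fst measurable_snd) (by fun_prop) (by fun_prop)

lemma measurable_crossDens : Measurable fun q : ℝ × ℝ => crossDens q.1 q.2 := by
  unfold crossDens
  exact measurable_kerB.add (Measurable.ite
    (measurableSet_lt measurable_snd (by fun_prop)) measurable_kerA (by fun_prop))

lemma measurable_nearDens : Measurable fun q : ℝ × ℝ => nearDens q.1 q.2 := by
  unfold nearDens
  refine Measurable.ite ?_ measurable_kerA (by fun_prop)
  exact (measurableSet_lt measurable_snd (by fun_prop)).inter
    ((measurableSet_lt measurable_snd (by fun_prop)).inter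
      (measurableSet_lt measurable_fst (by fun_prop)))

/-- A primitive of `(1 - σ²)^{3/2} / (1 + σ²)²`. -/
noncomputable def pairPrim (σ : ℝ) : ℝ :=
  Real.arcsin σ - 1 / √2 * Real.arcsin (√2 * σ / √(1 + σ ^ 2)) + σ * √(1 - σ ^ 2) / (1 + σ ^ 2)

lemma continuous_pairPrim : Continuous pairPrim := by
  have h1 : ∀ σ : ℝ, √(1 + σ ^ 2) ≠ 0 := fun σ => (Real.sqrt_pos.2 (by positivity)).ne'
  have h2 : ∀ σ : ℝ, 1 + σ ^ 2 ≠ 0 := fun σ => by positivity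
  unfold pairPrim
  refine ((Real.continuous_arcsin).sub (continuous_const.mul (Real.continuous_arcsin.comp ?_))).add ?_
  · exact Continuous.div (by fun_prop) (by fun_prop) h1
  · exact Continuous.div (by fun_prop) (by fun_prop) h2

lemma hasDerivAt_pairPrim {σ : ℝ} (h : σ ∈ Set.Ioo (0 : ℝ) 1) :
    HasDerivAt pairPrim (√(1 - σ ^ 2) ^ 3 / (1 + σ ^ 2) ^ 2) σ := by
  obtain ⟨h0, h1⟩ := h
  have hc2 : 0 < 1 - σ ^ 2 := by nlinarith
  have hE2 : (0 : ℝ) < 1 + σ ^ 2 := by positivity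
  have hc : 0 < √(1 - σ ^ 2) := Real.sqrt_pos.2 hc2
  have hE : 0 < √(1 + σ ^ 2) := Real.sqrt_pos.2 hE2
  have s2 : √2 ^ 2 = (2 : ℝ) := Real.sq_sqrt (by norm_num)
  have s20 : (0 : ℝ) < √2 := by positivity
  have qc : √(1 - σ ^ 2) ^ 2 = 1 - σ ^ 2 := Real.sq_sqrt hc2.le
  have qE : √(1 + σ ^ 2) ^ 2 = 1 + σ ^ 2 := Real.sq_sqrt hE2.le
  have harg : 1 - (√2 * σ / √(1 + σ ^ 2)) ^ 2 = (√(1 - σ ^ 2) / √(1 + σ ^ 2)) ^ 2 := by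
    rw [div_pow, div_pow, mul_pow, s2, qc, qE]; field_simp; ring
  have hsq : √(1 - (√2 * σ / √(1 + σ ^ 2)) ^ 2) = √(1 - σ ^ 2) / √(1 + σ ^ 2) := by
    rw [harg, Real.sqrt_sq (by positivity)]
  have hlt : √2 * σ / √(1 + σ ^ 2) < 1 := by
    have : (√2 * σ / √(1 + σ ^ 2)) ^ 2 < 1 := by
      have := pow_pos (div_pos hc hE) 2
      linarith
    nlinarith
  have hgt : -1 < √2 * σ / √(1 + σ ^ 2) := by
    have : 0 < √2 * σ / √(1 + σ ^ 2) := by positivity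
    linarith
  have dE := ((hasDerivAt_pow 2 σ).const_add (1 : ℝ)).sqrt hE2.ne'
  have dc := ((hasDerivAt_pow 2 σ).const_sub (1 : ℝ)).sqrt hc2.ne'
  have d1 := Real.hasDerivAt_arcsin (x := σ) (by linarith) (by linarith)
  have d2 := (Real.hasDerivAt_arcsin hgt.ne' hlt.ne).comp σ
    ((((hasDerivAt_id' σ).const_mul √2)).div dE hE.ne')
  have d3 := ((hasDerivAt_id' σ).mul dc).div ((hasDerivAt_pow 2 σ).const_add (1 : ℝ)) hE2.ne'
  refine ((d1.sub (d2.const_mul (1 / √2))).add d3).congr_deriv ?_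
  rw [hsq]
  have e3 : √(1 - σ ^ 2) ^ 3 = √(1 - σ ^ 2) * (1 - σ ^ 2) := by
    rw [pow_succ, Real.sq_sqrt hc2.le, mul_comm]
  rw [e3]
  simp only [Pi.mul_apply]
  generalize √(1 - σ ^ 2) = c at *
  generalize √(1 + σ ^ 2) = E at *
  have hE4 : E ^ 4 = (1 + σ ^ 2) ^ 2 := by rw [← qE]; ring
  push_cast
  field_simp
  simp only [qc, qE]
  ring_nf

lemma pairPrim_one : pairPrim 1 = Real.pi / 2 * (1 - 1 / √2) := by
  have : √2 * 1 / √(1 + 1 ^ 2) = 1 := by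
    norm_num
  rw [pairPrim, this, Real.arcsin_one]
  norm_num
  ring

/-- At depth `l` the scaling `s = σ l` gives `l ^ (-1/2)` times the integral of `(1 - σ²)^{3/2} / (1
+ σ²)²` over `(0, 1)`. -/
lemma lintegral_pairDens :
    ∫⁻ s in Set.Ioi (0 : ℝ), ∫⁻ l in Set.Ioo (0 : ℝ) (1 / 2), ENNReal.ofReal (pairDens s l) =
      ENNReal.ofReal (Real.pi / 2 * (√2 - 1)) := by
  rw [lintegral_lintegral_swap (measurable_pairDens.ennreal_ofReal.aemeasurable)]
  have inner : ∀ l ∈ Set.Ioo (0 : ℝ) (1 / 2), ∫⁻ s in Set.Ioi (0 : ℝ), ENNReal.ofReal (pairDens s l) =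
      ENNReal.ofReal ((√l)⁻¹ * pairPrim 1) := by
    intro l hl
    have hl0 := hl.1
    have e1 : ∀ s, ENNReal.ofReal (pairDens s l) = (Set.Iio l).indicator (fun s =>
        ENNReal.ofReal ((l ^ 2 - s ^ 2) / (s ^ 2 + l ^ 2) ^ 2 * √(l - s ^ 2 / l))) s := by
      intro s
      by_cases h : s < l <;> simp [pairDens, Set.indicator, h]
    simp only [e1]
    rw [lintegral_indicator measurableSet_Iio, Measure.restrict_restrict measurableSet_Iio,
      Set.inter_comm, Set.Ioi_inter_Iio]
    have hd : ∀ s ∈ Set.Ioo 0 l, HasDerivAt (fun s => (√l)⁻¹ * pairPrim (s / l))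
        ((l ^ 2 - s ^ 2) / (s ^ 2 + l ^ 2) ^ 2 * √(l - s ^ 2 / l)) s := by
      intro s hs
      have hσ : s / l ∈ Set.Ioo (0 : ℝ) 1 := ⟨div_pos hs.1 hl0, (div_lt_one hl0).2 hs.2⟩
      have d := ((hasDerivAt_pairPrim hσ).comp s ((hasDerivAt_id' s).div_const l)).const_mul (√l)⁻¹
      refine d.congr_deriv ?_
      have hsl : 0 < 1 - (s / l) ^ 2 := by nlinarith [hσ.1, hσ.2]
      have e2 : √(l - s ^ 2 / l) = √l * √(1 - (s / l) ^ 2) := by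
        rw [← Real.sqrt_mul hl0.le]; congr 1; field_simp
      have e3 : √(1 - (s / l) ^ 2) ^ 3 = √(1 - (s / l) ^ 2) * (1 - (s / l) ^ 2) := by
        rw [pow_succ, Real.sq_sqrt hsl.le, mul_comm]
      have q : √l ^ 2 = l := Real.sq_sqrt hl0.le
      have hl' : 0 < √l := Real.sqrt_pos.2 hl0
      rw [e2, e3]
      field_simp
      rw [q]
      ring
    rw [lintegral_deriv_Ioo hl0.le (Continuous.continuousOn
      (continuous_const.mul (continuous_pairPrim.comp (continuous_id.div_const l)))) hd]
    · simp [div_self hl0.ne', pairPrim]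
    · intro s hs
      have : 0 ≤ l ^ 2 - s ^ 2 := by nlinarith [hs.1, hs.2]
      positivity
  rw [setLIntegral_congr_fun measurableSet_Ioo inner]
  have hp : 0 ≤ pairPrim 1 := by
    rw [pairPrim_one]
    have : 1 / √2 ≤ 1 := by
      rw [div_le_one (by positivity)]; exact Real.one_le_sqrt.2 (by norm_num)
    have := Real.pi_pos
    have : 0 ≤ 1 - 1 / √2 := by linarith
    positivity
  rw [lintegral_deriv_Ioo (f := fun l => 2 * √l * pairPrim 1) (by norm_num)
    (Continuous.continuousOn (by fun_prop)) (fun l hl => ?_) (fun l hl => by positivity)]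
  · congr 1
    rw [pairPrim_one]
    have s2 : √2 ^ 2 = (2 : ℝ) := Real.sq_sqrt (by norm_num)
    have s20 : (0 : ℝ) < √2 := by positivity
    have : √(1 / 2 : ℝ) = 1 / √2 := by simp
    rw [this, Real.sqrt_zero]
    field_simp
    rw [s2]
    ring
  · refine ((((hasDerivAt_id' l).sqrt hl.1.ne').const_mul 2).mul_const _).congr_deriv ?_
    have : 0 < √l := Real.sqrt_pos.2 hl.1
    field_simp

end StripDensities

/-! ### Total cost of the mass that crosses the axis. -/

section CrossTotals

/-- The total mass that crosses the axis at depth `l`. -/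
noncomputable def crossMass (l : ℝ) : ℝ := (√(2 * l))⁻¹ / (1 + 2 * l)

/-- The part of `crossMass` that is close to the centres. -/
noncomputable def nearMassAt (l : ℝ) : ℝ :=
  if l < 0.005 then crossMass l - 1 / 2 * (0.09 / (0.0081 + l ^ 2)) else 0

/-- The total mass of `nearDens`. -/
noncomputable def nearMass : ℝ := Real.arctan (1 / 10) - 1 / 2 * Real.arctan (1 / 18)

lemma hasDerivAt_div_sq_add (c s : ℝ) (h : s ^ 2 + c ^ 2 ≠ 0) :
    HasDerivAt (fun s : ℝ => 1 / 2 * (s / (s ^ 2 + c ^ 2)))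
      (1 / 2 * ((c ^ 2 - s ^ 2) / (s ^ 2 + c ^ 2) ^ 2)) s := by
  refine (((hasDerivAt_id' s).div ((hasDerivAt_pow 2 s).add_const (c ^ 2)) h).const_mul
    (1 / 2)).congr_deriv ?_
  push_cast
  congr 2
  ring

lemma hasDerivAt_primB (s l : ℝ) (hl : l < 1 / 2) :
    HasDerivAt (fun s : ℝ => 1 / 2 * (s / (s ^ 2 + (1 - l) ^ 2))) (kerB s l) s := by
  have h1 : (0 : ℝ) < 1 - l := by linarith
  refine (hasDerivAt_div_sq_add (1 - l) s (by positivity)).congr_deriv ?_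
  rw [kerB, add_comm (s ^ 2)]

lemma hasDerivAt_primA {s l : ℝ} (hl : 0 < l) :
    HasDerivAt (fun s : ℝ => -(1 / 2 * (s / (s ^ 2 + l ^ 2)))) (kerA s l) s := by
  refine (hasDerivAt_div_sq_add l s (by positivity)).neg.congr_deriv ?_
  rw [kerA, ← mul_neg, ← neg_div, neg_sub]

lemma tendsto_div_sq_add (c : ℝ) (hc : 0 < c) :
    Tendsto (fun s : ℝ => 1 / 2 * (s / (s ^ 2 + c ^ 2))) atTop (𝓝 0) := by
  refine squeeze_zero' (g := fun s : ℝ => s⁻¹) ?_ ?_ tendsto_inv_atTop_zero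
  · filter_upwards [eventually_gt_atTop 0] with s hs
    positivity
  · filter_upwards [eventually_gt_atTop 0] with s hs
    rw [← one_div, ← mul_div_assoc, div_le_div_iff₀ (by positivity) hs]
    nlinarith [sq_nonneg s, sq_nonneg c]

lemma sqrt_half_div {l : ℝ} (hl : 0 < l) :
    1 / 2 * (√(l / 2) / (√(l / 2) ^ 2 + l ^ 2)) = crossMass l := by
  have e : √(2 * l) = 2 * √(l / 2) := by
    rw [show 2 * l = 2 ^ 2 * (l / 2) by ring, Real.sqrt_mul (by norm_num), Real.sqrt_sq (by norm_num)]
  rw [crossMass, e, Real.sq_sqrt (by positivity)]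
  have h : 0 < √(l / 2) := Real.sqrt_pos.2 (by positivity)
  have q : √(l / 2) ^ 2 = l / 2 := Real.sq_sqrt (by positivity)
  field_simp
  rw [q]
  ring

/-- The primitive of `kerB` in `s` vanishes at `0` and at infinity, so `kerB` contributes nothing;
what is left is `kerA` over `s > √(l / 2)`. -/
lemma lintegral_crossDens {l : ℝ} (hl : l ∈ Set.Ioo (0 : ℝ) (1 / 2)) :
    ∫⁻ s in Set.Ioi (0 : ℝ), ENNReal.ofReal (crossDens s l) = ENNReal.ofReal (crossMass l) := by
  obtain ⟨hl0, hl1⟩ := hl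
  have h0 : 0 < √(l / 2) := Real.sqrt_pos.2 (by positivity)
  have q : √(l / 2) ^ 2 = l / 2 := Real.sq_sqrt (by positivity)
  set a := √(l / 2)
  have hlow : ∀ s ∈ Set.Ioo 0 a, crossDens s l = kerB s l := by
    intro s hs
    have : ¬ l < 2 * s ^ 2 := by nlinarith [hs.1, hs.2]
    simp [crossDens, this]
  have hhigh : ∀ s ∈ Set.Ioi a, crossDens s l = kerB s l + kerA s l := by
    intro s hs
    have : l < 2 * s ^ 2 := by nlinarith [Set.mem_Ioi.1 hs]
    simp [crossDens, this]
  have nn : ∀ s, 0 < s → 0 ≤ crossDens s l := fun s hs => crossDens_nonneg ⟨hl0, hl1⟩ hs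
  rw [← Set.Ioc_union_Ioi_eq_Ioi h0.le, lintegral_union measurableSet_Ioi
    Set.Ioc_disjoint_Ioi_same, setLIntegral_congr (Ioo_ae_eq_Ioc (a := (0 : ℝ)) (b := a)).symm]
  have i1 : ∫⁻ s in Set.Ioo 0 a, ENNReal.ofReal (crossDens s l) =
      ENNReal.ofReal (1 / 2 * (a / (a ^ 2 + (1 - l) ^ 2))) := by
    rw [lintegral_deriv_Ioo (f := fun s : ℝ => 1 / 2 * (s / (s ^ 2 + (1 - l) ^ 2))) h0.le
      (fun s _ => (hasDerivAt_primB s l hl1).continuousAt.continuousWithinAt)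
      (fun s hs => by rw [hlow s hs]; exact hasDerivAt_primB s l hl1)
      (fun s hs => nn s hs.1)]
    simp
  have i2 : ∫⁻ s in Set.Ioi a, ENNReal.ofReal (crossDens s l) =
      ENNReal.ofReal (crossMass l - 1 / 2 * (a / (a ^ 2 + (1 - l) ^ 2))) := by
    have hd : ∀ s ∈ Set.Ici a, HasDerivAt (fun s : ℝ => 1 / 2 * (s / (s ^ 2 + (1 - l) ^ 2)) +
        -(1 / 2 * (s / (s ^ 2 + l ^ 2)))) (kerB s l + kerA s l) s := fun s _ =>
      (hasDerivAt_primB s l hl1).add (hasDerivAt_primA hl0)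
    have hd' : ∀ s ∈ Set.Ioi a, HasDerivAt (fun s : ℝ => 1 / 2 * (s / (s ^ 2 + (1 - l) ^ 2)) +
        -(1 / 2 * (s / (s ^ 2 + l ^ 2)))) (crossDens s l) s := fun s hs => by
      rw [hhigh s hs]; exact hd s (Set.mem_Ici_of_Ioi hs)
    have hc := (hd a Set.self_mem_Ici).continuousAt.continuousWithinAt (s := Set.Ici a)
    have hn : ∀ s ∈ Set.Ioi a, 0 ≤ crossDens s l := fun s hs => nn s (h0.trans hs)
    have ht : Tendsto (fun s : ℝ => 1 / 2 * (s / (s ^ 2 + (1 - l) ^ 2)) +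
        -(1 / 2 * (s / (s ^ 2 + l ^ 2)))) atTop (𝓝 (0 + -0)) :=
      (tendsto_div_sq_add (1 - l) (by linarith)).add (tendsto_div_sq_add l hl0).neg
    have hi := integrableOn_Ioi_deriv_of_nonneg hc hd' hn ht
    rw [← ofReal_integral_eq_lintegral_ofReal hi
      ((ae_restrict_iff' measurableSet_Ioi).2 (Eventually.of_forall hn)),
      integral_Ioi_of_hasDerivAt_of_nonneg hc hd' hn ht, ← sqrt_half_div hl0]
    congr 1
    ring
  have h2 : 1 / 2 * (a / (a ^ 2 + (1 - l) ^ 2)) ≤ crossMass l := by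
    rw [← sqrt_half_div hl0]
    have : l ^ 2 ≤ (1 - l) ^ 2 := by nlinarith
    gcongr
  rw [i1, i2, ← ENNReal.ofReal_add (by positivity) (by linarith)]
  congr 1
  ring

/-- For `l < 0.005` the cutoff `√(l / 2)` is below `0.09`, so the near set is the interval between
them, on which `kerA` has an explicit primitive. -/
lemma lintegral_nearDens {l : ℝ} (hl : l ∈ Set.Ioo (0 : ℝ) (1 / 2)) :
    ∫⁻ s in Set.Ioi (0 : ℝ), ENNReal.ofReal (nearDens s l) = ENNReal.ofReal (nearMassAt l) := by
  obtain ⟨hl0, hl1⟩ := hl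
  by_cases hs : l < 0.005
  swap
  · simp [nearDens, nearMassAt, hs]
  have h0 : 0 < √(l / 2) := Real.sqrt_pos.2 (by positivity)
  have q : √(l / 2) ^ 2 = l / 2 := Real.sq_sqrt (by positivity)
  have e0 := sqrt_half_div hl0
  set a := √(l / 2)
  have ha : a ≤ 0.09 := by nlinarith
  have e : ∀ s ∈ Set.Ioi (0 : ℝ), ENNReal.ofReal (nearDens s l) =
      (Set.Ioo a 0.09).indicator (fun s => ENNReal.ofReal (kerA s l)) s := by
    intro s hs0
    have : l < 2 * s ^ 2 ↔ a < s := by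
      rw [← pow_lt_pow_iff_left₀ h0.le (le_of_lt hs0) two_ne_zero, q]
      constructor <;> intro <;> linarith
    by_cases h : a < s ∧ s < 0.09
    · rw [Set.indicator_of_mem (Set.mem_Ioo.2 h), nearDens, if_pos ⟨hs, this.2 h.1, h.2⟩]
    · rw [Set.indicator_of_notMem (fun h' => h (Set.mem_Ioo.1 h')), nearDens,
        if_neg (fun h' => h ⟨this.1 h'.2.1, h'.2.2⟩), ENNReal.ofReal_zero]
  rw [setLIntegral_congr_fun measurableSet_Ioi e, lintegral_indicator measurableSet_Ioo,
    Measure.restrict_restrict measurableSet_Ioo, Set.inter_eq_left.2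
      (fun s hs => Set.mem_Ioi.2 (h0.trans (Set.mem_Ioo.1 hs).1)), lintegral_deriv_Ioo ha
      (fun s _ => (hasDerivAt_primA hl0).continuousAt.continuousWithinAt)
      (fun s _ => hasDerivAt_primA hl0) (fun s hs => kerA_nonneg ⟨hl0, hl1⟩ (h0.trans hs.1) ?_),
      nearMassAt, if_pos hs, ← e0]
  · congr 1
    norm_num
    ring
  · nlinarith [hs.1]

lemma crossMass_nonneg {l : ℝ} (hl : 0 < l) : 0 ≤ crossMass l := by
  unfold crossMass; positivity

lemma nearMassAt_nonneg {l : ℝ} (hl : 0 < l) : 0 ≤ nearMassAt l := by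
  unfold nearMassAt
  split_ifs with h
  · have h0 : 0 < √(l / 2) := Real.sqrt_pos.2 (by positivity)
    have q : √(l / 2) ^ 2 = l / 2 := Real.sq_sqrt (by positivity)
    rw [← sqrt_half_div hl]
    have ha : √(l / 2) ≤ 0.09 := by nlinarith
    have hk : l ^ 2 ≤ √(l / 2) * 0.09 := by
      have : l ≤ √(l / 2) := by rw [Real.le_sqrt hl.le (by positivity)]; nlinarith
      nlinarith
    have : 0.09 / (0.0081 + l ^ 2) ≤ √(l / 2) / (√(l / 2) ^ 2 + l ^ 2) := by
      rw [div_le_div_iff₀ (by positivity) (by positivity)]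
      nlinarith [mul_nonneg (sub_nonneg.2 ha) (sub_nonneg.2 hk)]
    linarith
  · exact le_rfl

lemma hasDerivAt_sqrt_two_mul {l : ℝ} (hl : 0 < l) :
    HasDerivAt (fun l : ℝ => √(2 * l)) (√(2 * l))⁻¹ l := by
  refine (((hasDerivAt_id' l).const_mul 2).sqrt (by positivity)).congr_deriv ?_
  have : 0 < √(2 * l) := Real.sqrt_pos.2 (by positivity)
  field_simp

lemma hasDerivAt_arctan_sqrt {l : ℝ} (hl : 0 < l) :
    HasDerivAt (fun l : ℝ => Real.arctan (√(2 * l))) (crossMass l) l := by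
  refine ((Real.hasDerivAt_arctan _).comp l (hasDerivAt_sqrt_two_mul hl)).congr_deriv ?_
  rw [crossMass, Real.sq_sqrt (by positivity)]
  ring

/-- A primitive of `√(1 - σ²) / (1 + σ²)`. -/
noncomputable def crossPrim (σ : ℝ) : ℝ :=
  √2 * Real.arcsin (√2 * σ / √(1 + σ ^ 2)) - Real.arcsin σ

lemma continuous_crossPrim : Continuous crossPrim := by
  have h1 : ∀ σ : ℝ, √(1 + σ ^ 2) ≠ 0 := fun σ => (Real.sqrt_pos.2 (by positivity)).ne'
  unfold crossPrim
  refine (continuous_const.mul (Real.continuous_arcsin.comp ?_)).sub Real.continuous_arcsin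
  exact Continuous.div (by fun_prop) (by fun_prop) h1

lemma hasDerivAt_crossPrim {σ : ℝ} (h : σ ∈ Set.Ioo (0 : ℝ) 1) :
    HasDerivAt crossPrim (√(1 - σ ^ 2) / (1 + σ ^ 2)) σ := by
  obtain ⟨h0, h1⟩ := h
  have hc2 : 0 < 1 - σ ^ 2 := by nlinarith
  have hE2 : (0 : ℝ) < 1 + σ ^ 2 := by positivity
  have hc : 0 < √(1 - σ ^ 2) := Real.sqrt_pos.2 hc2
  have hE : 0 < √(1 + σ ^ 2) := Real.sqrt_pos.2 hE2
  have s2 : √2 ^ 2 = (2 : ℝ) := Real.sq_sqrt (by norm_num)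
  have s20 : (0 : ℝ) < √2 := by positivity
  have qc : √(1 - σ ^ 2) ^ 2 = 1 - σ ^ 2 := Real.sq_sqrt hc2.le
  have qE : √(1 + σ ^ 2) ^ 2 = 1 + σ ^ 2 := Real.sq_sqrt hE2.le
  have harg : 1 - (√2 * σ / √(1 + σ ^ 2)) ^ 2 = (√(1 - σ ^ 2) / √(1 + σ ^ 2)) ^ 2 := by
    rw [div_pow, div_pow, mul_pow, s2, qc, qE]; field_simp; ring
  have hsq : √(1 - (√2 * σ / √(1 + σ ^ 2)) ^ 2) = √(1 - σ ^ 2) / √(1 + σ ^ 2) := by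
    rw [harg, Real.sqrt_sq (by positivity)]
  have hlt : √2 * σ / √(1 + σ ^ 2) < 1 := by
    have : (√2 * σ / √(1 + σ ^ 2)) ^ 2 < 1 := by
      have := pow_pos (div_pos hc hE) 2
      linarith
    nlinarith
  have hgt : -1 < √2 * σ / √(1 + σ ^ 2) := by
    have : 0 < √2 * σ / √(1 + σ ^ 2) := by positivity
    linarith
  have dE := ((hasDerivAt_pow 2 σ).const_add (1 : ℝ)).sqrt hE2.ne'
  have d1 := Real.hasDerivAt_arcsin (x := σ) (by linarith) (by linarith)
  have d2 := (Real.hasDerivAt_arcsin hgt.ne' hlt.ne).comp σ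
    ((((hasDerivAt_id' σ).const_mul √2)).div dE hE.ne')
  refine ((d2.const_mul √2).sub d1).congr_deriv ?_
  rw [hsq]
  generalize √(1 - σ ^ 2) = c at *
  generalize √(1 + σ ^ 2) = E at *
  push_cast
  field_simp
  simp only [qc, qE, s2]
  ring_nf

/-- With `σ = √(2 l)` the measure `crossMass l dl` becomes `dσ / (1 + σ²)` on `(0, 1)`, and `√(1 - 2
l)` becomes `√(1 - σ²)`. -/
lemma lintegral_crossMass_mul :
    ∫⁻ l in Set.Ioo (0 : ℝ) (1 / 2), ENNReal.ofReal (crossMass l * (√(1 - 2 * l) + 1)) =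
      ENNReal.ofReal (Real.pi / 2 * (√2 - 1) + Real.pi / 4) := by
  rw [lintegral_deriv_Ioo (f := fun l => crossPrim √(2 * l) + Real.arctan √(2 * l)) (by norm_num)]
  · congr 1
    have : √2 * 1 / √(1 + 1 ^ 2) = 1 := by
      norm_num
    norm_num [crossPrim, this]
    ring
  · exact Continuous.continuousOn ((continuous_crossPrim.comp (by fun_prop)).add
      (Real.continuous_arctan.comp (by fun_prop)))
  · intro l hl
    have h1 : 0 < √(2 * l) := Real.sqrt_pos.2 (by linarith [hl.1])
    have h2 : √(2 * l) < 1 := by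
      rw [Real.sqrt_lt' one_pos]; linarith [hl.2]
    have q : √(2 * l) ^ 2 = 2 * l := Real.sq_sqrt (by linarith [hl.1])
    refine (((hasDerivAt_crossPrim ⟨h1, h2⟩).comp l (hasDerivAt_sqrt_two_mul hl.1)).add
      (hasDerivAt_arctan_sqrt hl.1)).congr_deriv ?_
    rw [q, crossMass]
    ring
  · intro l hl
    exact mul_nonneg (crossMass_nonneg hl.1) (by positivity)

lemma lintegral_nearMassAt :
    ∫⁻ l in Set.Ioo (0 : ℝ) (1 / 2), ENNReal.ofReal (nearMassAt l) = ENNReal.ofReal nearMass := by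
  have e : ∀ l, ENNReal.ofReal (nearMassAt l) = (Set.Iio (0.005 : ℝ)).indicator
      (fun l => ENNReal.ofReal (crossMass l - 1 / 2 * (0.09 / (0.0081 + l ^ 2)))) l := by
    intro l
    by_cases h : l < 0.005 <;> simp [nearMassAt, Set.indicator, h]
  simp only [e]
  rw [lintegral_indicator measurableSet_Iio, Measure.restrict_restrict measurableSet_Iio,
    Set.inter_comm, Set.Ioo_inter_Iio, min_eq_right (by norm_num),
    lintegral_deriv_Ioo (f := fun l => Real.arctan √(2 * l) - 1 / 2 * Real.arctan (l / 0.09))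
      (by norm_num)]
  · congr 1
    have : √(2 * 0.005 : ℝ) = 1 / 10 := by
      rw [Real.sqrt_eq_iff_mul_self_eq] <;> norm_num
    rw [this, nearMass]
    norm_num
  · exact Continuous.continuousOn ((Real.continuous_arctan.comp (by fun_prop)).sub
      (continuous_const.mul (Real.continuous_arctan.comp (by fun_prop))))
  · intro l hl
    refine ((hasDerivAt_arctan_sqrt hl.1).sub (((Real.hasDerivAt_arctan _).comp l
      ((hasDerivAt_id' l).div_const 0.09)).const_mul (1 / 2))).congr_deriv ?_
    have : 0.0081 + l ^ 2 ≠ 0 := by positivity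
    have : 1 + (l / 0.09) ^ 2 ≠ 0 := by positivity
    congr 2
    field_simp
    norm_num
  · intro l hl
    have := nearMassAt_nonneg hl.1
    rwa [nearMassAt, if_pos hl.2] at this

lemma lintegral_lintegral_nearDens :
    ∫⁻ s in Set.Ioi (0 : ℝ), ∫⁻ l in Set.Ioo (0 : ℝ) (1 / 2), ENNReal.ofReal (nearDens s l) =
      ENNReal.ofReal nearMass := by
  rw [lintegral_lintegral_swap (measurable_nearDens.ennreal_ofReal.aemeasurable),
    setLIntegral_congr_fun measurableSet_Ioo (fun l hl => lintegral_nearDens hl),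
    lintegral_nearMassAt]

lemma measurable_nearMassAt : Measurable nearMassAt := by
  unfold nearMassAt crossMass
  exact Measurable.ite measurableSet_Iio (by fun_prop) (by fun_prop)

lemma nearMass_nonneg : 0 ≤ nearMass := by
  have h1 : Real.arctan (1 / 18) ≤ Real.arctan (1 / 10) :=
    Real.arctan_strictMono.monotone (by norm_num)
  have h2 : 0 ≤ Real.arctan (1 / 10) := Real.arctan_nonneg.2 (by norm_num)
  unfold nearMass; linarith

/-- On the near set `l < 0.005`, so each unit of mass removed there saves at least `√0.99 + 1`. -/
lemma lintegral_lintegral_farDens_le :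
    ∫⁻ s in Set.Ioi (0 : ℝ), ∫⁻ l in Set.Ioo (0 : ℝ) (1 / 2),
        ENNReal.ofReal ((crossDens s l - nearDens s l) * (√(1 - 2 * l) + 1)) ≤
      ENNReal.ofReal (Real.pi / 2 * (√2 - 1) + Real.pi / 4 - (√0.99 + 1) * nearMass) := by
  have hm : Measurable fun q : ℝ × ℝ =>
      ENNReal.ofReal ((crossDens q.1 q.2 - nearDens q.1 q.2) * (√(1 - 2 * q.2) + 1)) :=
    ((measurable_crossDens.sub measurable_nearDens).mul (by fun_prop)).ennreal_ofReal
  have nm := nearMass_nonneg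
  rw [lintegral_lintegral_swap hm.aemeasurable, ENNReal.ofReal_sub _ (by positivity)]
  refine ENNReal.le_sub_of_add_le_right ENNReal.ofReal_ne_top ?_
  rw [← lintegral_crossMass_mul, ENNReal.ofReal_mul (by positivity), ← lintegral_nearMassAt,
    ← lintegral_const_mul _ measurable_nearMassAt.ennreal_ofReal,
    ← lintegral_add_right _ (measurable_nearMassAt.ennreal_ofReal.const_mul _)]
  refine setLIntegral_mono' measurableSet_Ioo fun l hl => ?_
  have hr : 0 ≤ √(1 - 2 * l) + 1 := by positivity
  have hn := nearMassAt_nonneg hl.1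
  have hsum : (∫⁻ s in Set.Ioi (0 : ℝ), ENNReal.ofReal (crossDens s l - nearDens s l)) +
      ENNReal.ofReal (nearMassAt l) = ENNReal.ofReal (crossMass l) := by
    have mn : Measurable fun s => ENNReal.ofReal (nearDens s l) :=
      (measurable_nearDens.comp (measurable_id.prodMk measurable_const)).ennreal_ofReal
    rw [← lintegral_nearDens hl, ← lintegral_add_right _ mn, ← lintegral_crossDens hl]
    refine setLIntegral_congr_fun measurableSet_Ioi fun s hs => ?_
    rw [← ENNReal.ofReal_add (sub_nonneg.2 (nearDens_le_crossDens hl hs)) (nearDens_nonneg hl hs),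
      sub_add_cancel]
  have e : ∫⁻ s in Set.Ioi (0 : ℝ),
      ENNReal.ofReal ((crossDens s l - nearDens s l) * (√(1 - 2 * l) + 1)) =
      (∫⁻ s in Set.Ioi (0 : ℝ), ENNReal.ofReal (crossDens s l - nearDens s l)) *
        ENNReal.ofReal (√(1 - 2 * l) + 1) := by
    rw [← lintegral_mul_const' _ _ ENNReal.ofReal_ne_top]
    simp only [ENNReal.ofReal_mul' hr]
  rw [e, ENNReal.ofReal_mul' hr, ← hsum, add_mul, mul_comm (ENNReal.ofReal (√0.99 + 1))]
  refine add_le_add le_rfl ?_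
  by_cases h : l < 0.005
  · gcongr
    linarith
  · simp [nearMassAt, h]

end CrossTotals

/-! ### Transport along one vertical line in the strip. -/

section StripLine

lemma continuous_kerA {s : ℝ} (hs : 0 < s) : Continuous (kerA s) := by
  unfold kerA
  exact continuous_const.mul (Continuous.div (by fun_prop) (by fun_prop) fun l => by positivity)

lemma continuous_kerB {s : ℝ} (hs : 0 < s) : Continuous (kerB s) := by
  unfold kerB
  exact continuous_const.mul (Continuous.div (by fun_prop) (by fun_prop) fun l => by positivity)

lemma kerDiff_upper (s l : ℝ) : kerDiff s (1 / 2 - l) = kerA s l + kerB s l := by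
  simp only [kerDiff, K₂, kerA, kerB]
  ring

lemma kerDiff_lower (s l : ℝ) : kerDiff s (l - 1 / 2) = -(kerA s l + kerB s l) := by
  simp only [kerDiff, K₂, kerA, kerB]
  ring

/-- The kernel is odd in `t`, so points symmetric about the axis combine into the difference of the
values of `w`. -/
lemma integral_kerDiff_mul_eq {s : ℝ} (hs : 0 < s) {w : ℝ → ℝ} (hw : Continuous w) :
    ∫ t in Set.Ioo (-(1 / 2) : ℝ) (1 / 2), kerDiff s t * w t =
      ∫ l in (0 : ℝ)..(1 / 2), (kerA s l + kerB s l) * (w (1 / 2 - l) - w (l - 1 / 2)) := by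
  have hk : Continuous (kerDiff s) := by
    have : kerDiff s = fun t => kerA s (1 / 2 - t) + kerB s (1 / 2 - t) := by
      funext t
      rw [← kerDiff_upper]; congr 1; ring
    rw [this]
    exact ((continuous_kerA hs).comp (by fun_prop)).add ((continuous_kerB hs).comp (by fun_prop))
  have hc : Continuous fun t => kerDiff s t * w t := hk.mul hw
  rw [← integral_Ioc_eq_integral_Ioo, ← intervalIntegral.integral_of_le (by norm_num),
    ← intervalIntegral.integral_add_adjacent_intervals (b := 0) (hc.intervalIntegrable _ _)
      (hc.intervalIntegrable _ _)]
  have e1 := intervalIntegral.integral_comp_sub_right (fun t => kerDiff s t * w t)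
    (a := 0) (b := 1 / 2) (1 / 2)
  have e2 := intervalIntegral.integral_comp_sub_left (fun t => kerDiff s t * w t)
    (a := 0) (b := 1 / 2) (1 / 2)
  simp only [zero_sub, sub_self, sub_zero] at e1 e2
  rw [← e1, ← e2, ← intervalIntegral.integral_add]
  · refine intervalIntegral.integral_congr fun l _ => ?_
    simp only [kerDiff_upper, kerDiff_lower]
    ring
  · exact (hc.comp (continuous_id.sub continuous_const)).intervalIntegrable _ _
  · exact (hc.comp (continuous_const.sub continuous_id)).intervalIntegrable _ _

/-- The inversion `l = s² / m` exchanges the sides of the zero `l = s` of `kerA s` and reverses the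
sign of the mass element, so it matches positive mass with equal negative mass. -/
lemma kerA_inv {s m : ℝ} (hs : 0 < s) (hm : 0 < m) :
    kerA s (s ^ 2 / m) * (s ^ 2 / m ^ 2) = -kerA s m := by
  unfold kerA
  field_simp
  ring

lemma integral_kerA_inv {s : ℝ} (hs : 0 < s) (hs' : s ≤ 1 / 2) {g : ℝ → ℝ} (hg : Continuous g) :
    ∫ l in (2 * s ^ 2)..s, kerA s l * g l = ∫ m in s..(1 / 2), -kerA s m * g (s ^ 2 / m) := by
  have h := intervalIntegral.integral_comp_mul_deriv (a := s) (b := 1 / 2)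
    (f := fun m => s ^ 2 / m) (f' := fun m => -(s ^ 2 / m ^ 2)) (g := fun l => kerA s l * g l)
    (fun m hm => ?_) ?_ ((continuous_kerA hs).mul hg)
  · have e1 : s ^ 2 / s = s := by field_simp
    have e2 : s ^ 2 / (1 / 2) = 2 * s ^ 2 := by ring
    rw [e1, e2] at h
    rw [intervalIntegral.integral_symm, ← h, ← intervalIntegral.integral_neg]
    refine intervalIntegral.integral_congr fun m hm => ?_
    have hm0 : 0 < m := by rw [Set.uIcc_of_le hs'] at hm; linarith [hm.1]
    simp only [Function.comp_apply]
    rw [← kerA_inv hs hm0]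
    ring
  · have hm0 : m ≠ 0 := by rw [Set.uIcc_of_le hs'] at hm; linarith [hm.1]
    refine ((hasDerivAt_inv hm0).const_mul (s ^ 2)).congr_deriv ?_
    field_simp
  · refine ContinuousOn.neg (ContinuousOn.div (by fun_prop) (by fun_prop) fun m hm => ?_)
    have hm0 : m ≠ 0 := by rw [Set.uIcc_of_le hs'] at hm; linarith [hm.1]
    positivity

lemma integrableOn_crossDens_mul {s : ℝ} (hs : 0 < s) {g : ℝ → ℝ} (hg : Continuous g) :
    IntegrableOn (fun l => crossDens s l * g l) (Set.Ioo 0 (1 / 2)) := by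
  have e : (fun l => crossDens s l * g l) = fun l => kerB s l * g l +
      (Set.Iio (2 * s ^ 2)).indicator (fun l => kerA s l * g l) l := by
    funext l
    by_cases h : l < 2 * s ^ 2 <;> simp [crossDens, h, add_mul]
  have i1 : ∀ f : ℝ → ℝ, Continuous f → IntegrableOn f (Set.Ioo 0 (1 / 2)) := fun f hf =>
    (hf.integrableOn_Icc (a := 0) (b := 1 / 2)).mono_set Set.Ioo_subset_Icc_self
  rw [e]
  exact (i1 _ ((continuous_kerB hs).mul hg)).add
    ((i1 _ ((continuous_kerA hs).mul hg)).indicator measurableSet_Iio)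

/-- On a vertical line the mass is first moved within each half of the strip by the inversion
`l ↦ s² / l`; what remains crosses the axis. -/
lemma integral_ker_mul_eq {s : ℝ} (hs : 0 < s) {g : ℝ → ℝ} (hg : Continuous g) :
    ∫ l in (0 : ℝ)..(1 / 2), (kerA s l + kerB s l) * g l =
      (∫ l in Set.Ioo 0 (1 / 2), crossDens s l * g l) +
      ∫ m in Set.Ioo s (1 / 2), -kerA s m * (g (s ^ 2 / m) - g m) := by
  have hA : Continuous fun l => kerA s l * g l := (continuous_kerA hs).mul hg
  have hB : Continuous fun l => kerB s l * g l := (continuous_kerB hs).mul hg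
  have e0 : ∫ l in (0 : ℝ)..(1 / 2), (kerA s l + kerB s l) * g l =
      (∫ l in (0 : ℝ)..(1 / 2), kerA s l * g l) + ∫ l in (0 : ℝ)..(1 / 2), kerB s l * g l := by
    simp only [add_mul]
    exact intervalIntegral.integral_add (hA.intervalIntegrable _ _) (hB.intervalIntegrable _ _)
  have ec : ∀ l, crossDens s l * g l = kerB s l * g l +
      (Set.Iio (2 * s ^ 2)).indicator (fun l => kerA s l * g l) l := by
    intro l
    by_cases h : l < 2 * s ^ 2 <;> simp [crossDens, h, add_mul]
  have i1 : ∀ f : ℝ → ℝ, Continuous f → IntegrableOn f (Set.Ioo 0 (1 / 2)) := fun f hf =>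
    (hf.integrableOn_Icc (a := 0) (b := 1 / 2)).mono_set Set.Ioo_subset_Icc_self
  have e1 : ∫ l in Set.Ioo 0 (1 / 2), crossDens s l * g l =
      (∫ l in (0 : ℝ)..(1 / 2), kerB s l * g l) +
        ∫ l in (0 : ℝ)..(min (1 / 2) (2 * s ^ 2)), kerA s l * g l := by
    simp only [ec]
    rw [integral_add (i1 _ hB) ((i1 _ hA).indicator measurableSet_Iio),
      integral_indicator measurableSet_Iio, Measure.restrict_restrict measurableSet_Iio,
      Set.inter_comm, Set.Ioo_inter_Iio, ← integral_Ioc_eq_integral_Ioo,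
      ← integral_Ioc_eq_integral_Ioo, intervalIntegral.integral_of_le (by norm_num),
      intervalIntegral.integral_of_le (by positivity)]
  rw [e0, e1]
  rcases le_or_gt (1 / 2) s with h | h
  · rw [Set.Ioo_eq_empty (not_lt.2 h), setIntegral_empty, min_eq_left (by nlinarith)]
    ring
  -- The inversion carries `(s, 1/2)` onto `(2 s², s)`: the cutoff `2 s²` in `crossDens` is the
  -- image of the axis `l = 1/2`. In the preceding case `s ≥ 1/2` the cutoff lies beyond the axis
  -- and nothing is paired.
  · have hg2 : ContinuousOn (fun m => -kerA s m * g (s ^ 2 / m)) (Set.uIcc s (1 / 2)) := by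
      refine (continuous_kerA hs).neg.continuousOn.mul (hg.comp_continuousOn
        (ContinuousOn.div (by fun_prop) (by fun_prop) fun m hm => ?_))
      rw [Set.uIcc_of_le h.le] at hm; linarith [hm.1]
    have hg3 : Continuous fun m => -kerA s m * g m := (continuous_kerA hs).neg.mul hg
    rw [min_eq_right (by nlinarith), ← integral_Ioc_eq_integral_Ioo (x := s),
      ← intervalIntegral.integral_of_le h.le]
    simp only [mul_sub]
    rw [intervalIntegral.integral_sub hg2.intervalIntegrable (hg3.intervalIntegrable _ _),
      ← integral_kerA_inv hs h.le hg,
      ← intervalIntegral.integral_add_adjacent_intervals (a := 0) (b := 2 * s ^ 2) (c := 1 / 2)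
        (hA.intervalIntegrable _ _) (hA.intervalIntegrable _ _),
      ← intervalIntegral.integral_add_adjacent_intervals (a := 2 * s ^ 2) (b := s) (c := 1 / 2)
        (hA.intervalIntegrable _ _) (hA.intervalIntegrable _ _)]
    simp only [neg_mul, intervalIntegral.integral_neg]
    ring

/-- Testing with a constant removes the paired mass, so the crossing mass equals the integral of the
full kernel over a half strip. -/
lemma integral_crossDens {s : ℝ} (hs : 0 < s) :
    ∫ l in Set.Ioo 0 (1 / 2), crossDens s l =
      1 / 2 / (s ^ 2 + 1 / 4) - 1 / 2 / (s ^ 2 + 1) := by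
  have h := integral_ker_mul_eq hs (g := fun _ => 1) continuous_const
  simp only [mul_one, sub_self, mul_zero, integral_zero, add_zero] at h
  rw [← h]
  have hd : ∀ l : ℝ, HasDerivAt (fun l : ℝ => 1 / 2 * (l / (l ^ 2 + s ^ 2)) +
      1 / 2 * ((1 - l) / ((1 - l) ^ 2 + s ^ 2))) (kerA s l + kerB s l) l := by
    intro l
    refine ((hasDerivAt_div_sq_add s l (by positivity)).add
      ((hasDerivAt_div_sq_add s (1 - l) (by positivity)).comp l
        ((hasDerivAt_id' l).const_sub 1))).congr_deriv ?_
    unfold kerA kerB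
    rw [add_comm (l ^ 2)]
    ring
  rw [intervalIntegral.integral_eq_sub_of_hasDerivAt (fun l _ => hd l)
    (((continuous_kerA hs).add (continuous_kerB hs)).intervalIntegrable _ _)]
  field_simp
  ring

lemma ofReal_abs_integral_le {α : Type*} [MeasurableSpace α] (μ : Measure α) (f : α → ℝ) :
    ENNReal.ofReal |∫ x, f x ∂μ| ≤ ∫⁻ x, ENNReal.ofReal |f x| ∂μ := by
  have := enorm_integral_le_lintegral_enorm (μ := μ) f
  simpa only [Real.enorm_eq_ofReal_abs] using this

/-- The term in `e` carries the mass of `crossDens s`, so it adds `e` to the increment `g` under the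
crossing integral. Far from the centres `g` and `e` are bounded separately; near them `c` may record
their cancellation. In the paired part, the factor 2 from moving in both halves cancels the `1/2` in
`kerA`. -/
lemma ofReal_abs_strip_line_le_aux {s B e c : ℝ} {w : ℝ → ℝ} (hs : 0 < s) (hB : 0 ≤ B)
    (hw : ∀ t t', |w t - w t'| ≤ B * √|t - t'|) (he : |e| ≤ B) (hc : 0 ≤ c)
    (hnear : ∀ l ∈ Set.Ioo (0 : ℝ) (1 / 2), l < 0.005 → l < 2 * s ^ 2 → s < 0.09 →
      |w (1 / 2 - l) - w (l - 1 / 2) + e| ≤ c) :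
    ENNReal.ofReal |(∫ t in Set.Ioo (-(1 / 2) : ℝ) (1 / 2), kerDiff s t * w t) +
        e * (1 / 2 / (s ^ 2 + 1 / 4) - 1 / 2 / (s ^ 2 + 1))| ≤
      ENNReal.ofReal B * (∫⁻ l in Set.Ioo (0 : ℝ) (1 / 2), ENNReal.ofReal (pairDens s l)) +
      (ENNReal.ofReal B * (∫⁻ l in Set.Ioo (0 : ℝ) (1 / 2),
        ENNReal.ofReal ((crossDens s l - nearDens s l) * (√(1 - 2 * l) + 1))) +
      ENNReal.ofReal c * ∫⁻ l in Set.Ioo (0 : ℝ) (1 / 2), ENNReal.ofReal (nearDens s l)) := by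
  have hwc : Continuous w := continuous_of_sqrt_bound hw
  set g : ℝ → ℝ := fun l => w (1 / 2 - l) - w (l - 1 / 2) with hg
  have hgc : Continuous g := by fun_prop
  have hg1 : ∀ l ∈ Set.Ioo (0 : ℝ) (1 / 2), |g l| ≤ B * √(1 - 2 * l) := by
    intro l hl
    refine (hw _ _).trans (le_of_eq ?_)
    rw [show 1 / 2 - l - (l - 1 / 2) = 1 - 2 * l by ring, abs_of_nonneg (by linarith [hl.2])]
  have hg2 : ∀ l l', |g l - g l'| ≤ 2 * B * √|l - l'| := by
    intro l l'
    have h1 := hw (1 / 2 - l) (1 / 2 - l')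
    have h2 := hw (l - 1 / 2) (l' - 1 / 2)
    rw [show 1 / 2 - l - (1 / 2 - l') = -(l - l') by ring, abs_neg] at h1
    rw [show l - 1 / 2 - (l' - 1 / 2) = l - l' by ring] at h2
    calc |g l - g l'| = |(w (1 / 2 - l) - w (1 / 2 - l')) - (w (l - 1 / 2) - w (l' - 1 / 2))| := by
          congr 1; simp only [hg]; ring
      _ ≤ _ := abs_sub _ _
      _ ≤ _ := by linarith
  have hM : e * (1 / 2 / (s ^ 2 + 1 / 4) - 1 / 2 / (s ^ 2 + 1)) =
      ∫ l in Set.Ioo 0 (1 / 2), crossDens s l * e := by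
    rw [← integral_crossDens hs, integral_mul_const, mul_comm]
  rw [integral_kerDiff_mul_eq hs hwc, integral_ker_mul_eq hs hgc, hM, add_right_comm,
    ← integral_add (integrableOn_crossDens_mul hs hgc)
      (integrableOn_crossDens_mul hs continuous_const), add_comm (∫ l in Set.Ioo _ _, _ + _)]
  refine (ENNReal.ofReal_le_ofReal (abs_add_le _ _)).trans ?_
  rw [ENNReal.ofReal_add (abs_nonneg _) (abs_nonneg _)]
  refine add_le_add ((ofReal_abs_integral_le _ _).trans ?_)
    ((ofReal_abs_integral_le _ _).trans ?_)
  · rw [← lintegral_const_mul' _ _ ENNReal.ofReal_ne_top]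
    refine (setLIntegral_mono' measurableSet_Ioo fun m hm => ?_).trans
      (lintegral_mono_set (Set.Ioo_subset_Ioo_left hs.le))
    rw [← ENNReal.ofReal_mul hB]
    refine ENNReal.ofReal_le_ofReal ?_
    have hm0 : 0 < m := hs.trans hm.1
    have hk : 0 ≤ -kerA s m := by
      have : 0 ≤ m ^ 2 - s ^ 2 := by nlinarith [hm.1]
      have e : -kerA s m = 1 / 2 * ((m ^ 2 - s ^ 2) / (s ^ 2 + m ^ 2) ^ 2) := by
        unfold kerA; ring
      rw [e]; positivity
    have hle : s ^ 2 / m ≤ m := by rw [div_le_iff₀ hm0]; nlinarith [hm.1]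
    have h3 := hg2 (s ^ 2 / m) m
    rw [abs_sub_comm _ m, abs_of_nonneg (sub_nonneg.2 hle)] at h3
    rw [abs_mul, abs_of_nonneg hk, pairDens, if_pos hm.1]
    refine (mul_le_mul_of_nonneg_left h3 hk).trans (le_of_eq ?_)
    unfold kerA
    ring
  · rw [← lintegral_const_mul' _ _ ENNReal.ofReal_ne_top,
      ← lintegral_const_mul' _ _ ENNReal.ofReal_ne_top, ← lintegral_add_left]
    swap
    · exact (((measurable_crossDens.sub measurable_nearDens).comp
        (measurable_const.prodMk measurable_id)).mul (by fun_prop)).ennreal_ofReal.const_mul _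
    refine setLIntegral_mono' measurableSet_Ioo fun l hl => ?_
    have k0 := nearDens_nonneg hl hs
    have k1 := nearDens_le_crossDens hl hs
    rw [← ENNReal.ofReal_mul hB, ← ENNReal.ofReal_mul hc, ← ENNReal.ofReal_add
      (mul_nonneg hB (mul_nonneg (sub_nonneg.2 k1) (by positivity))) (mul_nonneg hc k0)]
    refine ENNReal.ofReal_le_ofReal ?_
    rw [← mul_add, abs_mul, abs_of_nonneg (k0.trans k1)]
    have b1 : |g l + e| ≤ B * (√(1 - 2 * l) + 1) :=
      (abs_add_le _ _).trans (by linarith [hg1 l hl])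
    have b2 : nearDens s l * |g l + e| ≤ c * nearDens s l := by
      by_cases h : l < 0.005 ∧ l < 2 * s ^ 2 ∧ s < 0.09
      · rw [mul_comm]
        exact mul_le_mul_of_nonneg_right (hnear l hl h.1 h.2.1 h.2.2) k0
      · simp [nearDens, h]
    have b3 := mul_le_mul_of_nonneg_left b1 (sub_nonneg.2 k1)
    linarith

/-- Only the values of `w` between the centres matter, so `w` is extended by constants; the odd
extension `W` may jump elsewhere on the line. -/
lemma ofReal_abs_strip_line_le {s B e c : ℝ} {w : ℝ → ℝ} (hs : 0 < s) (hB : 0 ≤ B)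
    (hw : ∀ t ∈ Set.Icc (-(1 / 2) : ℝ) (1 / 2), ∀ t' ∈ Set.Icc (-(1 / 2) : ℝ) (1 / 2),
      |w t - w t'| ≤ B * √|t - t'|) (he : |e| ≤ B) (hc : 0 ≤ c)
    (hnear : ∀ l ∈ Set.Ioo (0 : ℝ) (1 / 2), l < 0.005 → l < 2 * s ^ 2 → s < 0.09 →
      |w (1 / 2 - l) - w (l - 1 / 2) + e| ≤ c) :
    ENNReal.ofReal |(∫ t in Set.Ioo (-(1 / 2) : ℝ) (1 / 2), kerDiff s t * w t) +
        e * (1 / 2 / (s ^ 2 + 1 / 4) - 1 / 2 / (s ^ 2 + 1))| ≤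
      ENNReal.ofReal B * (∫⁻ l in Set.Ioo (0 : ℝ) (1 / 2), ENNReal.ofReal (pairDens s l)) +
      (ENNReal.ofReal B * (∫⁻ l in Set.Ioo (0 : ℝ) (1 / 2),
        ENNReal.ofReal ((crossDens s l - nearDens s l) * (√(1 - 2 * l) + 1))) +
      ENNReal.ofReal c * ∫⁻ l in Set.Ioo (0 : ℝ) (1 / 2), ENNReal.ofReal (nearDens s l)) := by
  have hI : (-(1 / 2) : ℝ) ≤ 1 / 2 := by norm_num
  set v : ℝ → ℝ := fun t => w (Set.projIcc _ _ hI t) with hv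
  have hvw : ∀ t ∈ Set.Icc (-(1 / 2) : ℝ) (1 / 2), v t = w t := fun t ht => by
    simp only [hv, Set.projIcc_of_mem hI ht]
  have e1 : ∫ t in Set.Ioo (-(1 / 2) : ℝ) (1 / 2), kerDiff s t * w t =
      ∫ t in Set.Ioo (-(1 / 2) : ℝ) (1 / 2), kerDiff s t * v t :=
    setIntegral_congr_fun measurableSet_Ioo fun t ht => by
      simp only [hvw t (Set.Ioo_subset_Icc_self ht)]
  rw [e1]
  refine ofReal_abs_strip_line_le_aux hs hB (fun t t' => ?_) he hc fun l hl h1 h2 h3 => ?_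
  · refine (hw _ (Subtype.coe_prop _) _ (Subtype.coe_prop _)).trans ?_
    exact mul_le_mul_of_nonneg_left (Real.sqrt_le_sqrt (Set.abs_projIcc_sub_projIcc hI)) hB
  · rw [hvw _ ⟨by linarith [hl.1, hl.2], by linarith [hl.1, hl.2]⟩,
      hvw _ ⟨by linarith [hl.1, hl.2], by linarith [hl.1, hl.2]⟩]
    exact hnear l hl h1 h2 h3

end StripLine

/-! ### The three regions for centres at distance one. -/

section UnitConfiguration

/-- The integrand `K₂(x - y) W(y)`, regularized by subtracting `W(x)` in the square `Q_r(x)`. -/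
noncomputable def regInt (W : ℝ × ℝ → ℝ) (r : ℝ) (x y : ℝ × ℝ) : ℝ :=
  K₂ (x - y) * (W y - (sq x r).indicator (fun _ => W x) y)

/-- The difference of the regularized integrands at the points `(0, 1/2)` and `(0, -1/2)`. -/
noncomputable def unitDiff (W : ℝ × ℝ → ℝ) (y : ℝ × ℝ) : ℝ :=
  regInt W 1 (0, 1 / 2) y - regInt W 1 (0, -(1 / 2)) y

lemma K₂_sub_unit (s t : ℝ) : K₂ ((0, 1 / 2) - (s, t)) = K₂ (s, t - 1 / 2) := by
  simp only [K₂, Prod.mk_sub_mk]; ring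

lemma K₂_sub_unit' (s t : ℝ) : K₂ ((0, -(1 / 2)) - (s, t)) = K₂ (s, t + 1 / 2) := by
  simp only [K₂, Prod.mk_sub_mk]; ring

lemma indicator_const_congr {S T : Set (ℝ × ℝ)} {x y : ℝ × ℝ} (h : x ∈ S ↔ y ∈ T) (a : ℝ) :
    S.indicator (fun _ => a) x = T.indicator (fun _ => a) y := by
  by_cases hx : x ∈ S
  · rw [Set.indicator_of_mem hx, Set.indicator_of_mem (h.1 hx)]
  · rw [Set.indicator_of_notMem hx, Set.indicator_of_notMem (fun h' => hx (h.2 h'))]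

/-- Reflection in the axis exchanges the two centres, and the sign change of `W` compensates; the
lower region is thereby reduced to the upper one. -/
lemma unitDiff_reflect (W : ℝ × ℝ → ℝ) (s t : ℝ) :
    unitDiff (fun y => -W (y.1, -y.2)) (s, t) = unitDiff W (s, -t) := by
  have e1 : K₂ (s, -t - 1 / 2) = K₂ (s, t + 1 / 2) := by simp only [K₂]; ring
  have e2 : K₂ (s, -t + 1 / 2) = K₂ (s, t - 1 / 2) := by simp only [K₂]; ring
  have m1 : (s, -t) ∈ sq (0, 1 / 2) 1 ↔ (s, t) ∈ sq (0, -(1 / 2)) 1 := by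
    simp only [sq, Set.mem_ofPred_eq]
    rw [show (1 / 2 : ℝ) - -t = -(-(1 / 2) - t) by ring, abs_neg (-(1 / 2) - t)]
  have m2 : (s, -t) ∈ sq (0, -(1 / 2)) 1 ↔ (s, t) ∈ sq (0, 1 / 2) 1 := by
    simp only [sq, Set.mem_ofPred_eq]
    rw [show -(1 / 2 : ℝ) - -t = -((1 / 2) - t) by ring, abs_neg ((1 / 2) - t)]
  simp only [unitDiff, regInt, K₂_sub_unit, K₂_sub_unit', e1, e2]
  have c1 : ∀ a : ℝ, (sq (0, 1 / 2) 1).indicator (fun _ => a) (s, -t) =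
      (sq (0, -(1 / 2)) 1).indicator (fun _ => a) (s, t) := fun a => indicator_const_congr m1 a
  have c2 : ∀ a : ℝ, (sq (0, -(1 / 2)) 1).indicator (fun _ => a) (s, -t) =
      (sq (0, 1 / 2) 1).indicator (fun _ => a) (s, t) := fun a => indicator_const_congr m2 a
  have c3 : ∀ (S : Set (ℝ × ℝ)) (a : ℝ) (y : ℝ × ℝ), S.indicator (fun _ => -a) y =
      -S.indicator (fun _ => a) y := fun S a y => by by_cases h : y ∈ S <;> simp [h]
  rw [c1, c2, c3, c3, neg_neg]
  ring

lemma integral_K₂_Icc {c : ℝ} (hc : 0 < c) :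
    ∫ s in Set.Icc (-1 : ℝ) 1, K₂ (s, c) = -(1 / (1 + c ^ 2)) := by
  have hd : ∀ s : ℝ, HasDerivAt (fun s : ℝ => -(1 / 2 * (s / (s ^ 2 + c ^ 2)))) (K₂ (s, c)) s :=
    fun s => hasDerivAt_primA hc
  have hk : Continuous fun s => K₂ (s, c) := by
    unfold K₂
    exact continuous_const.mul (Continuous.div (by fun_prop) (by fun_prop) fun l => by positivity)
  rw [integral_Icc_eq_integral_Ioc, ← intervalIntegral.integral_of_le (by norm_num),
    intervalIntegral.integral_eq_sub_of_hasDerivAt (fun s _ => hd s) (hk.intervalIntegrable _ _)]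
  have : (1 : ℝ) + c ^ 2 ≠ 0 := by positivity
  norm_num
  field_simp
  ring

/-- The square about the lower centre ends at height `1/2`, so above it only the upper centre is
regularized, up to height `3/2`. -/
lemma unitDiff_upper (W : ℝ × ℝ → ℝ) {t : ℝ} (ht : 1 / 2 < t) (s : ℝ) :
    unitDiff W (s, t) = kerDiff s t * W (s, t) -
      (Set.Icc (-1 : ℝ) 1).indicator
        (fun s => (if t ≤ 3 / 2 then W (0, 1 / 2) else 0) * K₂ (s, t - 1 / 2)) s := by
  have m1 : (s, t) ∈ sq (0, 1 / 2) 1 ↔ s ∈ Set.Icc (-1 : ℝ) 1 ∧ t ≤ 3 / 2 := by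
    simp only [sq, Set.mem_ofPred_eq, abs_le, Set.mem_Icc]
    constructor
    · rintro ⟨⟨_, _⟩, _, _⟩; refine ⟨⟨?_, ?_⟩, ?_⟩ <;> linarith
    · rintro ⟨⟨_, _⟩, _⟩; refine ⟨⟨?_, ?_⟩, ?_, ?_⟩ <;> linarith
  have m2 : (s, t) ∉ sq (0, -(1 / 2)) 1 := by
    simp only [sq, Set.mem_ofPred_eq, abs_le]
    rintro ⟨-, h, -⟩; linarith
  rw [unitDiff, regInt, regInt, K₂_sub_unit, K₂_sub_unit', Set.indicator_of_notMem m2, kerDiff]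
  by_cases h1 : s ∈ Set.Icc (-1 : ℝ) 1
  · rw [Set.indicator_of_mem h1]
    by_cases h2 : t ≤ 3 / 2
    · rw [Set.indicator_of_mem (m1.2 ⟨h1, h2⟩), if_pos h2]; ring
    · rw [Set.indicator_of_notMem (fun h => h2 (m1.1 h).2), if_neg h2]; ring
  · rw [Set.indicator_of_notMem h1, Set.indicator_of_notMem (fun h => h1 (m1.1 h).1)]; ring

lemma continuous_K₂_left {c : ℝ} (hc : c ≠ 0) : Continuous fun s => K₂ (s, c) := by
  unfold K₂
  exact continuous_const.mul (Continuous.div (by fun_prop) (by fun_prop) fun l => by positivity)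

lemma continuous_K₂_right {c : ℝ} (hc : c ≠ 0) : Continuous fun s => K₂ (c, s) := by
  unfold K₂
  exact continuous_const.mul (Continuous.div (by fun_prop) (by fun_prop) fun l => by positivity)

lemma integral_inv_one_add_sq_shift :
    ∫ t in Set.Ioi (1 / 2 : ℝ), (Set.Iic (3 / 2 : ℝ)).indicator
      (fun t => 1 / (1 + (t - 1 / 2) ^ 2)) t = Real.pi / 4 := by
  rw [integral_indicator measurableSet_Iic, Measure.restrict_restrict measurableSet_Iic,
    Set.inter_comm, Set.Ioi_inter_Iic, ← intervalIntegral.integral_of_le (by norm_num),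
    intervalIntegral.integral_comp_sub_right (fun t => 1 / (1 + t ^ 2)), integral_one_div_one_add_sq]
  norm_num

lemma integrableOn_inv_one_add_sq_shift :
    IntegrableOn ((Set.Iic (3 / 2 : ℝ)).indicator (fun t => 1 / (1 + (t - 1 / 2) ^ 2)))
      (Set.Ioi (1 / 2 : ℝ)) := by
  rw [IntegrableOn, integrable_indicator_iff measurableSet_Iic, IntegrableOn,
    Measure.restrict_restrict measurableSet_Iic, Set.inter_comm, Set.Ioi_inter_Iic]
  have : Continuous fun t : ℝ => 1 / (1 + (t - 1 / 2) ^ 2) :=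
    Continuous.div (by fun_prop) (by fun_prop) fun t => by positivity
  exact (this.integrableOn_Icc (a := 1 / 2) (b := 3 / 2)).mono_set Set.Ioc_subset_Icc_self

/-- The term `π/4` comes from the subtracted constant: integrated first in `s`, the kernel over a
half square gives `-π/4`. Each remaining line integral is bounded by its transport cost. -/
lemma abs_integral_unitDiff_upper_le {W : ℝ × ℝ → ℝ} {A : ℝ} (hA : 0 ≤ A)
    (hX : ∀ t s s', |W (s, t) - W (s', t)| ≤ A * √|s - s'|) (hF : Integrable (unitDiff W)) :
    |(∫ y in Set.univ ×ˢ Set.Ioi (1 / 2 : ℝ), unitDiff W y) - Real.pi / 4 * W (0, 1 / 2)| ≤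
      A * (5.767 / 2) := by
  have hFr : Integrable (unitDiff W) ((volume : Measure ℝ).prod (volume.restrict (Set.Ioi (1 / 2 : ℝ)))) := by
    have := hF.integrableOn (s := Set.univ ×ˢ Set.Ioi (1 / 2 : ℝ))
    rwa [IntegrableOn, Measure.volume_eq_prod, ← Measure.prod_restrict, Measure.restrict_univ] at this
  have e1 : ∫ y in Set.univ ×ˢ Set.Ioi (1 / 2 : ℝ), unitDiff W y =
      ∫ t in Set.Ioi (1 / 2 : ℝ), ∫ s, unitDiff W (s, t) := by
    rw [Measure.volume_eq_prod, ← Measure.prod_restrict, Measure.restrict_univ,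
      integral_prod_symm _ hFr]
  have e2 : Real.pi / 4 * W (0, 1 / 2) = ∫ t in Set.Ioi (1 / 2 : ℝ), W (0, 1 / 2) *
      (Set.Iic (3 / 2 : ℝ)).indicator (fun t => 1 / (1 + (t - 1 / 2) ^ 2)) t := by
    rw [integral_const_mul, integral_inv_one_add_sq_shift, mul_comm]
  rw [e1, e2, ← integral_sub hFr.integral_prod_right
    (integrableOn_inv_one_add_sq_shift.const_mul _)]
  rw [← ENNReal.ofReal_le_ofReal_iff (by positivity)]
  refine (ofReal_abs_integral_le _ _).trans ?_
  have hle : ∫⁻ t in Set.Ioi (1 / 2 : ℝ), ENNReal.ofReal (2 * A) * lineCost t ≤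
      ENNReal.ofReal (A * (5.767 / 2)) := by
    rw [lintegral_const_mul' _ _ ENNReal.ofReal_ne_top]
    refine (mul_le_mul' le_rfl lintegral_lineCost_lt).trans (le_of_eq ?_)
    rw [← ENNReal.ofReal_mul (by positivity)]
    congr 1
    ring
  refine le_trans (lintegral_mono_ae ?_) hle
  filter_upwards [hFr.prod_left_ae, ae_restrict_mem measurableSet_Ioi] with t hti ht
  rw [Set.mem_Ioi] at ht
  have hi : Integrable ((Set.Icc (-1 : ℝ) 1).indicator
      fun s => (if t ≤ 3 / 2 then W (0, 1 / 2) else 0) * K₂ (s, t - 1 / 2)) :=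
    (IntegrableOn.integrable_indicator ((continuous_K₂_left (by linarith)).integrableOn_Icc.const_mul _)
      measurableSet_Icc)
  have hk : Integrable fun s => kerDiff s t * W (s, t) := by
    refine (hti.add hi).congr (Eventually.of_forall fun s => ?_)
    simp only [Pi.add_apply, unitDiff_upper W ht]
    ring
  have e3 : (∫ s, unitDiff W (s, t)) - W (0, 1 / 2) *
      (Set.Iic (3 / 2 : ℝ)).indicator (fun t => 1 / (1 + (t - 1 / 2) ^ 2)) t =
      ∫ s, kerDiff s t * W (s, t) := by
    simp only [unitDiff_upper W ht]
    rw [integral_sub hk hi, integral_indicator measurableSet_Icc, integral_const_mul,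
      integral_K₂_Icc (by linarith)]
    by_cases h : t ≤ 3 / 2 <;> simp [Set.indicator, h]
  rw [e3]
  exact abs_integral_kerDiff_mul_le ht hA (hX t) hk

lemma measurePreserving_reflect :
    MeasurePreserving (fun y : ℝ × ℝ => (y.1, -y.2)) volume volume :=
  (MeasurePreserving.id volume).prod (Measure.measurePreserving_neg volume)

lemma measurableEmbedding_reflect :
    MeasurableEmbedding (fun y : ℝ × ℝ => (y.1, -y.2)) :=
  ((MeasurableEquiv.refl ℝ).prodCongr (MeasurableEquiv.neg ℝ)).measurableEmbedding

lemma abs_integral_unitDiff_lower_le {W : ℝ × ℝ → ℝ} {A : ℝ} (hA : 0 ≤ A)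
    (hX : ∀ t s s', |W (s, t) - W (s', t)| ≤ A * √|s - s'|) (hF : Integrable (unitDiff W)) :
    |(∫ y in Set.univ ×ˢ Set.Iio (-(1 / 2) : ℝ), unitDiff W y) +
      Real.pi / 4 * W (0, -(1 / 2))| ≤ A * (5.767 / 2) := by
  have e0 : unitDiff (fun y => -W (y.1, -y.2)) = unitDiff W ∘ fun y => (y.1, -y.2) := by
    funext ⟨s, t⟩
    exact unitDiff_reflect W s t
  have h := abs_integral_unitDiff_upper_le (W := fun y => -W (y.1, -y.2)) hA
    (fun t s s' => by
      simp only
      rw [show -W (s, -t) - -W (s', -t) = -(W (s, -t) - W (s', -t)) by ring, abs_neg]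
      exact hX (-t) s s')
    (by rw [e0]; exact (measurePreserving_reflect.integrable_comp_emb
          measurableEmbedding_reflect).2 hF)
  have e1 : ∫ y in Set.univ ×ˢ Set.Ioi (1 / 2 : ℝ), unitDiff (fun y => -W (y.1, -y.2)) y =
      ∫ y in Set.univ ×ˢ Set.Iio (-(1 / 2) : ℝ), unitDiff W y := by
    rw [← measurePreserving_reflect.setIntegral_preimage_emb measurableEmbedding_reflect, e0]
    congr 2
    · exact Set.ext fun y => by simp [lt_neg]
    · funext y; simp
  rw [e1] at h
  refine le_trans (le_of_eq ?_) h
  congr 1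
  ring

lemma unitDiff_strip (W : ℝ × ℝ → ℝ) {t : ℝ} (ht : t ∈ Set.Ioo (-(1 / 2) : ℝ) (1 / 2)) (s : ℝ) :
    unitDiff W (s, t) = kerDiff s t * W (s, t) -
      (if s ∈ Set.Icc (-1 : ℝ) 1 then 1 else 0) *
        (W (0, 1 / 2) * K₂ (s, t - 1 / 2) - W (0, -(1 / 2)) * K₂ (s, t + 1 / 2)) := by
  have m1 : (s, t) ∈ sq (0, 1 / 2) 1 ↔ s ∈ Set.Icc (-1 : ℝ) 1 := by
    simp only [sq, Set.mem_ofPred_eq, abs_le, Set.mem_Icc]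
    constructor
    · rintro ⟨⟨_, _⟩, _, _⟩; refine ⟨?_, ?_⟩ <;> linarith
    · rintro ⟨_, _⟩; refine ⟨⟨?_, ?_⟩, ?_, ?_⟩ <;> linarith [ht.1, ht.2]
  have m2 : (s, t) ∈ sq (0, -(1 / 2)) 1 ↔ s ∈ Set.Icc (-1 : ℝ) 1 := by
    simp only [sq, Set.mem_ofPred_eq, abs_le, Set.mem_Icc]
    constructor
    · rintro ⟨⟨_, _⟩, _, _⟩; refine ⟨?_, ?_⟩ <;> linarith
    · rintro ⟨_, _⟩; refine ⟨⟨?_, ?_⟩, ?_, ?_⟩ <;> linarith [ht.1, ht.2]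
  rw [unitDiff, regInt, regInt, K₂_sub_unit, K₂_sub_unit', kerDiff]
  by_cases h1 : s ∈ Set.Icc (-1 : ℝ) 1
  · rw [Set.indicator_of_mem (m1.2 h1), Set.indicator_of_mem (m2.2 h1), if_pos h1]; ring
  · rw [Set.indicator_of_notMem (fun h => h1 (m1.1 h)),
      Set.indicator_of_notMem (fun h => h1 (m2.1 h)), if_neg h1]; ring

lemma integral_K₂_vertical {s : ℝ} (hs : s ≠ 0) (c a b : ℝ) (hab : a ≤ b) :
    ∫ t in Set.Ioo a b, K₂ (s, t - c) =
      1 / 2 * ((b - c) / ((b - c) ^ 2 + s ^ 2)) - 1 / 2 * ((a - c) / ((a - c) ^ 2 + s ^ 2)) := by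
  have hd : ∀ t : ℝ, HasDerivAt (fun t : ℝ => 1 / 2 * ((t - c) / ((t - c) ^ 2 + s ^ 2)))
      (K₂ (s, t - c)) t := by
    intro t
    refine ((hasDerivAt_div_sq_add s (t - c) (by positivity)).comp t
      ((hasDerivAt_id' t).sub_const c)).congr_deriv ?_
    simp only [K₂]
    ring
  have hk : Continuous fun t => K₂ (s, t - c) := (continuous_K₂_right hs).comp (by fun_prop)
  rw [← integral_Ioc_eq_integral_Ioo, ← intervalIntegral.integral_of_le hab,
    intervalIntegral.integral_eq_sub_of_hasDerivAt (fun s _ => hd s) (hk.intervalIntegrable _ _)]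

/-- The mass of `crossDens s`. -/
noncomputable def axisMass (s : ℝ) : ℝ := 1 / 2 / (s ^ 2 + 1 / 4) - 1 / 2 / (s ^ 2 + 1)

lemma integrable_axisMass : Integrable axisMass := by
  have h1 : Integrable fun s : ℝ => 1 / 2 / (s ^ 2 + 1) := by
    refine (integrable_inv_one_add_sq.const_mul (1 / 2)).congr (Eventually.of_forall fun s => ?_)
    simp only
    rw [add_comm, one_div, div_eq_mul_inv]
  have h2 : Integrable fun s : ℝ => 1 / 2 / (s ^ 2 + 1 / 4) := by
    refine ((integrable_inv_one_add_sq.comp_mul_left' (R := 2) two_ne_zero).const_mul 2).congr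
      (Eventually.of_forall fun s => ?_)
    have : s ^ 2 + 1 / 4 ≠ 0 := by positivity
    have : 1 + (2 * s) ^ 2 ≠ 0 := by positivity
    simp only
    field_simp
    ring
  exact h2.sub h1

/-- This equals the weight of the local term `ω/2` after multiplication by `π`, so that term can be
distributed over the strip with density `axisMass`. -/
lemma integral_axisMass : ∫ s, axisMass s = Real.pi / 2 := by
  have h1 : ∀ s : ℝ, axisMass s = 2 * (1 + (2 * s) ^ 2)⁻¹ - 1 / 2 * (1 + s ^ 2)⁻¹ := by
    intro s
    have : s ^ 2 + 1 / 4 ≠ 0 := by positivity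
    have : s ^ 2 + 1 ≠ 0 := by positivity
    have : 1 + s ^ 2 ≠ 0 := by positivity
    have : 1 + (2 * s) ^ 2 ≠ 0 := by positivity
    unfold axisMass
    field_simp
    ring
  simp only [h1]
  rw [integral_sub ((integrable_inv_one_add_sq.comp_mul_left' (R := 2) two_ne_zero).const_mul 2)
    (integrable_inv_one_add_sq.const_mul _), integral_const_mul, integral_const_mul,
    Measure.integral_comp_mul_left (fun s : ℝ => (1 + s ^ 2)⁻¹) 2, integral_univ_inv_one_add_sq]
  norm_num
  ring

lemma lintegral_le_two_mul_of_symm {f g : ℝ → ℝ≥0∞}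
    (h1 : ∀ s, 0 < s → f s ≤ g s) (h2 : ∀ s, 0 < s → f (-s) ≤ g s) :
    ∫⁻ s, f s ≤ 2 * ∫⁻ s in Set.Ioi 0, g s := by
  rw [← lintegral_add_compl f (measurableSet_Ioi (a := (0 : ℝ))), two_mul]
  refine add_le_add (setLIntegral_mono' measurableSet_Ioi fun s hs => h1 s hs) ?_
  rw [Set.compl_Ioi, setLIntegral_congr (Iio_ae_eq_Iic (a := (0 : ℝ))).symm,
    ← (Measure.measurePreserving_neg (volume : Measure ℝ)).setLIntegral_comp_preimage_emb
      (MeasurableEquiv.neg ℝ).measurableEmbedding]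
  have : (Neg.neg ⁻¹' Set.Iio (0 : ℝ)) = Set.Ioi 0 := by ext; simp
  rw [this]
  exact setLIntegral_mono' measurableSet_Ioi fun s hs => h2 s hs

lemma continuousOn_of_sqrt_bound {a b B : ℝ} (hI : a ≤ b) (hB : 0 ≤ B) {w : ℝ → ℝ}
    (hw : ∀ t ∈ Set.Icc a b, ∀ t' ∈ Set.Icc a b, |w t - w t'| ≤ B * √|t - t'|) :
    ContinuousOn w (Set.Icc a b) := by
  have hc : Continuous fun t => w (Set.projIcc _ _ hI t) :=
    continuous_of_sqrt_bound (A := B) fun t t' =>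
      (hw _ (Subtype.coe_prop _) _ (Subtype.coe_prop _)).trans
        (mul_le_mul_of_nonneg_left (Real.sqrt_le_sqrt (Set.abs_projIcc_sub_projIcc hI)) hB)
  exact hc.continuousOn.congr fun t ht => by simp only [Set.projIcc_of_mem hI ht]

lemma nearMass_le : nearMass ≤ 1 / 10 := by
  have h0 : 0 ≤ Real.arctan (1 / 10) := Real.arctan_nonneg.2 (by norm_num)
  have h1 := Real.le_tan h0 (Real.arctan_lt_pi_div_two _)
  rw [Real.tan_arctan] at h1
  have h2 : 0 ≤ Real.arctan (1 / 18) := Real.arctan_nonneg.2 (by norm_num)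
  unfold nearMass; linarith

/-- Integrating first in `t`, the subtracted constants give `-π/4` times the difference of the
central values, and `e * (π/2)` is spread over the lines by `axisMass`. Each line is then estimated
by vertical transport. -/
lemma abs_integral_unitDiff_strip_le {W : ℝ × ℝ → ℝ} {B e c : ℝ} (hB : 0 ≤ B)
    (hY : ∀ s, ∀ t ∈ Set.Icc (-(1 / 2) : ℝ) (1 / 2), ∀ t' ∈ Set.Icc (-(1 / 2) : ℝ) (1 / 2),
      |W (s, t) - W (s, t')| ≤ B * √|t - t'|) (he : |e| ≤ B) (hc : 0 ≤ c)
    (hnear : ∀ s, |s| < 0.09 → ∀ l ∈ Set.Ioo (0 : ℝ) (1 / 2), l < 0.005 →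
      |W (s, 1 / 2 - l) - W (s, l - 1 / 2) + e| ≤ c) (hF : Integrable (unitDiff W)) :
    |(∫ y in Set.univ ×ˢ Set.Ioo (-(1 / 2) : ℝ) (1 / 2), unitDiff W y) +
      Real.pi / 4 * (W (0, 1 / 2) - W (0, -(1 / 2))) + e * (Real.pi / 2)| ≤
      2 * (B * (Real.pi / 2 * (√2 - 1)) + (B * (Real.pi / 2 * (√2 - 1) + Real.pi / 4 -
        (√0.99 + 1) * nearMass) + c * nearMass)) := by
  set D := W (0, 1 / 2) - W (0, -(1 / 2)) with hD
  have hFr : Integrable (unitDiff W)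
      ((volume : Measure ℝ).prod (volume.restrict (Set.Ioo (-(1 / 2) : ℝ) (1 / 2)))) := by
    have := hF.integrableOn (s := Set.univ ×ˢ Set.Ioo (-(1 / 2) : ℝ) (1 / 2))
    rwa [IntegrableOn, Measure.volume_eq_prod, ← Measure.prod_restrict,
      Measure.restrict_univ] at this
  have e1 : ∫ y in Set.univ ×ˢ Set.Ioo (-(1 / 2) : ℝ) (1 / 2), unitDiff W y =
      ∫ s, ∫ t in Set.Ioo (-(1 / 2) : ℝ) (1 / 2), unitDiff W (s, t) := by
    rw [Measure.volume_eq_prod, ← Measure.prod_restrict, Measure.restrict_univ,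
      integral_prod _ hFr]
  have hχi : Integrable fun s : ℝ => (Set.Icc (-1 : ℝ) 1).indicator
      (fun s => D * (1 / 2 * (1 + s ^ 2)⁻¹)) s :=
    ((integrable_inv_one_add_sq.const_mul (1 / 2)).const_mul D).indicator measurableSet_Icc
  have e2 : Real.pi / 4 * D = ∫ s : ℝ, (Set.Icc (-1 : ℝ) 1).indicator
      (fun s => D * (1 / 2 * (1 + s ^ 2)⁻¹)) s := by
    rw [integral_indicator measurableSet_Icc, integral_const_mul, integral_const_mul,
      integral_Icc_eq_integral_Ioc, ← intervalIntegral.integral_of_le (by norm_num),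
      integral_inv_one_add_sq, Real.arctan_neg, Real.arctan_one]
    ring
  have e3 : e * (Real.pi / 2) = ∫ s, e * axisMass s := by
    rw [integral_const_mul, integral_axisMass]
  have hsum : Integrable fun s => (∫ t in Set.Ioo (-(1 / 2) : ℝ) (1 / 2), unitDiff W (s, t)) +
      (Set.Icc (-1 : ℝ) 1).indicator (fun s => D * (1 / 2 * (1 + s ^ 2)⁻¹)) s :=
    hFr.integral_prod_left.add hχi
  rw [e1, e2, e3, ← integral_add hFr.integral_prod_left hχi,
    ← integral_add hsum (integrable_axisMass.const_mul e)]
  have nm := nearMass_nonneg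
  have s1 : 1 ≤ √2 := Real.one_le_sqrt.2 (by norm_num)
  have hP : 0 ≤ B * (Real.pi / 2 * (√2 - 1)) :=
    mul_nonneg hB (mul_nonneg (by positivity) (by linarith))
  have hQ : 0 ≤ Real.pi / 2 * (√2 - 1) + Real.pi / 4 - (√0.99 + 1) * nearMass := by
    have h3 := nearMass_le
    have h4 : √0.99 ≤ 1 := Real.sqrt_le_one.2 (by norm_num)
    have h5 : 0 ≤ Real.pi / 2 * (√2 - 1) := mul_nonneg (by positivity) (by linarith)
    nlinarith [Real.pi_gt_three]
  rw [← ENNReal.ofReal_le_ofReal_iff (by positivity)]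
  refine (ofReal_abs_integral_le _ _).trans ?_
  -- The kernel is even in the horizontal variable, so the lines at `s` and `-s` obey the same
  -- bound; this gives the factor 2.
  have key : ∀ s : ℝ, 0 < s → ∀ σ : ℝ, (σ = s ∨ σ = -s) →
      ENNReal.ofReal |(∫ t in Set.Ioo (-(1 / 2) : ℝ) (1 / 2), unitDiff W (σ, t)) +
        (Set.Icc (-1 : ℝ) 1).indicator (fun s => D * (1 / 2 * (1 + s ^ 2)⁻¹)) σ +
        e * axisMass σ| ≤
      ENNReal.ofReal B * (∫⁻ l in Set.Ioo (0 : ℝ) (1 / 2), ENNReal.ofReal (pairDens s l)) +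
      (ENNReal.ofReal B * (∫⁻ l in Set.Ioo (0 : ℝ) (1 / 2),
        ENNReal.ofReal ((crossDens s l - nearDens s l) * (√(1 - 2 * l) + 1))) +
      ENNReal.ofReal c * ∫⁻ l in Set.Ioo (0 : ℝ) (1 / 2), ENNReal.ofReal (nearDens s l)) := by
    intro s hs σ hσ
    have hσ0 : σ ≠ 0 := by rcases hσ with rfl | rfl <;> simp [hs.ne']
    have hσ2 : σ ^ 2 = s ^ 2 := by rcases hσ with rfl | rfl <;> ring
    have hσa : |σ| = s := by rcases hσ with rfl | rfl <;> simp [abs_of_pos hs]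
    have hker : ∀ t, kerDiff σ t = kerDiff s t := by
      intro t
      rcases hσ with rfl | rfl
      · rfl
      · exact kerDiff_neg_left s t
    have h := ofReal_abs_strip_line_le (s := s) (w := fun t => W (σ, t)) hs hB (hY σ) he hc
      (fun l hl h1 _ h3 => hnear σ (by rwa [hσa]) l hl h1)
    refine le_trans (le_of_eq ?_) h
    congr 2
    rw [show e * axisMass σ = e * (1 / 2 / (s ^ 2 + 1 / 4) - 1 / 2 / (s ^ 2 + 1)) by
      rw [axisMass, hσ2]]
    congr 1
    have i1 : ∀ a : ℝ, IntegrableOn (fun t => K₂ (σ, t - a)) (Set.Ioo (-(1 / 2) : ℝ) (1 / 2)) :=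
      fun a => (((continuous_K₂_right hσ0).comp (continuous_sub_right a)).integrableOn_Icc
        (a := -(1 / 2)) (b := 1 / 2)).mono_set Set.Ioo_subset_Icc_self
    have i2 : IntegrableOn (fun t => K₂ (σ, t + 1 / 2)) (Set.Ioo (-(1 / 2) : ℝ) (1 / 2)) := by
      simpa using i1 (-(1 / 2))
    have v1 := integral_K₂_vertical hσ0 (1 / 2) (-(1 / 2)) (1 / 2) (by norm_num)
    have v2 := integral_K₂_vertical hσ0 (-(1 / 2)) (-(1 / 2)) (1 / 2) (by norm_num)
    simp only [sub_neg_eq_add] at v2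
    have iw : IntegrableOn (fun t => kerDiff s t * W (σ, t)) (Set.Ioo (-(1 / 2) : ℝ) (1 / 2)) := by
      have hk : Continuous (kerDiff s) := by
        have h1 := continuous_K₂_right hs.ne'
        exact (h1.comp (continuous_sub_right _)).sub (h1.comp (continuous_add_const _))
      exact ((hk.continuousOn.mul (continuousOn_of_sqrt_bound (by norm_num) hB
        (hY σ))).integrableOn_compact isCompact_Icc).mono_set Set.Ioo_subset_Icc_self
    rw [setIntegral_congr_fun measurableSet_Ioo (fun t ht => unitDiff_strip W ht σ)]
    simp only [hker]
    have i3 : IntegrableOn (fun t => (if σ ∈ Set.Icc (-1 : ℝ) 1 then 1 else 0) *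
        (W (0, 1 / 2) * K₂ (σ, t - 1 / 2) - W (0, -(1 / 2)) * K₂ (σ, t + 1 / 2)))
        (Set.Ioo (-(1 / 2) : ℝ) (1 / 2)) :=
      (((i1 (1 / 2)).const_mul _).sub (i2.const_mul _)).const_mul _
    rw [integral_sub iw i3, integral_const_mul, integral_sub ((i1 (1 / 2)).const_mul _) (i2.const_mul _),
      integral_const_mul, integral_const_mul, v1, v2]
    have : 1 + σ ^ 2 ≠ 0 := by positivity
    by_cases h1 : σ ∈ Set.Icc (-1 : ℝ) 1
    · rw [Set.indicator_of_mem h1, if_pos h1, hD]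
      norm_num
      field_simp
      ring
    · rw [Set.indicator_of_notMem h1, if_neg h1]
      ring
  refine (lintegral_le_two_mul_of_symm (fun s hs => key s hs s (Or.inl rfl))
    (fun s hs => key s hs (-s) (Or.inr rfl))).trans ?_
  have mP : Measurable fun s => ∫⁻ l in Set.Ioo (0 : ℝ) (1 / 2), ENNReal.ofReal (pairDens s l) :=
    measurable_pairDens.ennreal_ofReal.lintegral_prod_right'
  have mN : Measurable fun s => ∫⁻ l in Set.Ioo (0 : ℝ) (1 / 2), ENNReal.ofReal (nearDens s l) :=
    measurable_nearDens.ennreal_ofReal.lintegral_prod_right'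
  rw [lintegral_add_left (mP.const_mul _), lintegral_add_right _ (mN.const_mul _),
    lintegral_const_mul' _ _ ENNReal.ofReal_ne_top, lintegral_const_mul' _ _ ENNReal.ofReal_ne_top,
    lintegral_const_mul' _ _ ENNReal.ofReal_ne_top, lintegral_pairDens,
    lintegral_lintegral_nearDens, ENNReal.ofReal_mul (by norm_num : (0 : ℝ) ≤ 2),
    ENNReal.ofReal_add hP (by positivity), ENNReal.ofReal_add (by positivity) (by positivity),
    ENNReal.ofReal_mul hB, ENNReal.ofReal_mul hB, ENNReal.ofReal_mul hc, ENNReal.ofReal_ofNat]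
  gcongr
  exact lintegral_lintegral_farDens_le

end UnitConfiguration

/-! ### Assembly of the constants and scaling to arbitrary pairs. -/

section SamePairEstimate

/-- In the sum over the three regions the `π/4` terms of the regularization cancel. -/
lemma abs_integral_unitDiff_le {W : ℝ × ℝ → ℝ} {A B e c : ℝ} (hA : 0 ≤ A) (hB : 0 ≤ B)
    (hX : ∀ t s s', |W (s, t) - W (s', t)| ≤ A * √|s - s'|)
    (hY : ∀ s, ∀ t ∈ Set.Icc (-(1 / 2) : ℝ) (1 / 2), ∀ t' ∈ Set.Icc (-(1 / 2) : ℝ) (1 / 2),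
      |W (s, t) - W (s, t')| ≤ B * √|t - t'|) (he : |e| ≤ B) (hc : 0 ≤ c)
    (hnear : ∀ s, |s| < 0.09 → ∀ l ∈ Set.Ioo (0 : ℝ) (1 / 2), l < 0.005 →
      |W (s, 1 / 2 - l) - W (s, l - 1 / 2) + e| ≤ c) (hF : Integrable (unitDiff W)) :
    |(∫ y, unitDiff W y) + Real.pi / 2 * e| ≤ A * 5.767 +
      2 * (B * (Real.pi / 2 * (√2 - 1)) + (B * (Real.pi / 2 * (√2 - 1) + Real.pi / 4 -
        (√0.99 + 1) * nearMass) + c * nearMass)) := by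
  have h1 := abs_integral_unitDiff_upper_le hA hX hF
  have h2 := abs_integral_unitDiff_lower_le hA hX hF
  have h3 := abs_integral_unitDiff_strip_le hB hY he hc hnear hF
  have m : ∀ {S : Set ℝ}, MeasurableSet S → MeasurableSet ((Set.univ : Set ℝ) ×ˢ S) :=
    fun hS => MeasurableSet.univ.prod hS
  have ae : ∀ {S T : Set ℝ}, S =ᵐ[volume] T →
      ((Set.univ : Set ℝ) ×ˢ S : Set (ℝ × ℝ)) =ᵐ[volume] ((Set.univ : Set ℝ) ×ˢ T : Set (ℝ × ℝ)) := by
    intro S T h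
    rw [Measure.volume_eq_prod]
    exact Measure.set_prod_ae_eq (ae_eq_refl _) h
  have e1 : ∫ y, unitDiff W y = (∫ y in Set.univ ×ˢ Set.Ioi (1 / 2 : ℝ), unitDiff W y) +
      ((∫ y in Set.univ ×ˢ Set.Iio (-(1 / 2) : ℝ), unitDiff W y) +
        ∫ y in Set.univ ×ˢ Set.Ioo (-(1 / 2) : ℝ) (1 / 2), unitDiff W y) := by
    have hs : ((Set.univ : Set ℝ) ×ˢ Set.Ioi (1 / 2 : ℝ) : Set (ℝ × ℝ))ᶜ =
        Set.univ ×ˢ Set.Iic (1 / 2) := Set.ext fun y => by simp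
    rw [← integral_add_compl (m measurableSet_Ioi) hF, hs,
      ← Set.Iic_union_Ioc_eq_Iic (show (-(1 / 2) : ℝ) ≤ 1 / 2 by norm_num), Set.prod_union,
      setIntegral_union _ (m measurableSet_Ioc) hF.integrableOn hF.integrableOn,
      setIntegral_congr_set (ae Ioo_ae_eq_Ioc), setIntegral_congr_set (ae Iio_ae_eq_Iic)]
    exact Set.Disjoint.set_prod_right (Set.Iic_disjoint_Ioc le_rfl) _ _
  rw [e1]
  rw [abs_le] at *
  constructor <;> linarith [h1.1, h1.2, h2.1, h2.2, h3.1, h3.2]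

/-- The constant of the estimate for `v_x`. -/
noncomputable def constV (τ : ℝ) : ℝ :=
  5.767 + 1.2 * nearMass + τ * (2 * Real.pi * (√2 - 1) + Real.pi / 2 -
    2 * (√0.99 + 1 - 2 * √0.005) * nearMass)

/-- The constant of the estimate for `u_y`. -/
noncomputable def constU (τ : ℝ) : ℝ :=
  5.767 + τ * (2 * Real.pi * (√2 - 1) + Real.pi / 2 + 2 * (1 - √0.99) * nearMass)

lemma coeffV_nonneg : 0 ≤ 2 * Real.pi * (√2 - 1) + Real.pi / 2 -
    2 * (√0.99 + 1 - 2 * √0.005) * nearMass := by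
  have h1 := nearMass_le
  have h0 := nearMass_nonneg
  have h2 : √0.99 ≤ 1 := Real.sqrt_le_one.2 (by norm_num)
  have h3 : 0 ≤ √0.005 := Real.sqrt_nonneg _
  have h4 : 1 ≤ √2 := Real.one_le_sqrt.2 (by norm_num)
  have h5 : 0 ≤ 2 * Real.pi * (√2 - 1) := mul_nonneg (by positivity) (by linarith)
  nlinarith [Real.pi_gt_three, mul_nonneg h3 h0]

lemma coeffU_nonneg : 0 ≤ 2 * Real.pi * (√2 - 1) + Real.pi / 2 + 2 * (1 - √0.99) * nearMass := by
  have h0 := nearMass_nonneg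
  have h2 : √0.99 ≤ 1 := Real.sqrt_le_one.2 (by norm_num)
  have h4 : 1 ≤ √2 := Real.one_le_sqrt.2 (by norm_num)
  have h5 : 0 ≤ 2 * Real.pi * (√2 - 1) := mul_nonneg (by positivity) (by linarith)
  have := mul_nonneg (sub_nonneg.2 h2) h0
  nlinarith [Real.pi_gt_three]

lemma constV_pos {τ : ℝ} (hτ : 0 < τ) : 0 < constV τ := by
  have h0 := nearMass_nonneg
  have := mul_nonneg hτ.le coeffV_nonneg
  unfold constV
  linarith

lemma constU_pos {τ : ℝ} (hτ : 0 < τ) : 0 < constU τ := by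
  have := mul_nonneg hτ.le coeffU_nonneg
  unfold constU
  linarith

/-- At `τ = 0.582` the saving outweighs the cost `1.2 * nearMass` in `constV`, so a lower bound on
`nearMass` is what the numerical estimate needs. -/
lemma le_nearMass : 0.06 ≤ nearMass := by
  have h1 : 0.09 ≤ Real.arctan (1 / 10) := by
    have hc : 1 - 0.09 ^ 2 / 2 ≤ Real.cos 0.09 := Real.one_sub_sq_div_two_le_cos
    have hs : Real.sin 0.09 ≤ 0.09 := Real.sin_le (by norm_num)
    have ht : Real.tan 0.09 ≤ 1 / 10 := by
      rw [Real.tan_eq_sin_div_cos, div_le_iff₀ (by linarith)]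
      linarith
    have hp := Real.pi_gt_three
    rw [← Real.arctan_tan (x := 0.09) (by linarith) (by linarith)]
    exact Real.arctan_strictMono.monotone ht
  have h2 : Real.arctan (1 / 18) ≤ 1 / 18 := by
    have h := Real.le_tan (Real.arctan_nonneg.2 (by norm_num : (0 : ℝ) ≤ 1 / 18))
      (Real.arctan_lt_pi_div_two _)
    rwa [Real.tan_arctan] at h
  unfold nearMass
  linarith

lemma sqrt_two_lt' : √2 < 1.41422 := by
  rw [Real.sqrt_lt' (by norm_num)]; norm_num

lemma constV_le : 1 / Real.pi * constV 0.582 ≤ 2.60 := by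
  have hp := Real.pi_gt_d4
  have hp' := Real.pi_lt_d4
  have hp0 := Real.pi_pos
  have h2 := sqrt_two_lt'
  have h4 : 1 ≤ √2 := Real.one_le_sqrt.2 (by norm_num)
  have h3 : 0.99 ≤ √0.99 := Real.le_sqrt_of_sq_le (by norm_num)
  have h5 : √0.005 ≤ 0.08 := Real.sqrt_le_iff.2 (by norm_num)
  have m1 := le_nearMass
  have h6 : 2 * Real.pi * (√2 - 1) ≤ 2 * Real.pi * 0.41422 := by
    gcongr; linarith
  have h7 : 1.83 * nearMass ≤ (√0.99 + 1 - 2 * √0.005) * nearMass := by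
    gcongr; linarith
  rw [one_div, inv_mul_le_iff₀ hp0, constV]
  nlinarith

lemma constU_le : 1 / Real.pi * constU 0.582 ≤ 2.61 := by
  have hp := Real.pi_gt_d4
  have hp' := Real.pi_lt_d4
  have hp0 := Real.pi_pos
  have h2 := sqrt_two_lt'
  have h3 : 0.994 ≤ √0.99 := Real.le_sqrt_of_sq_le (by norm_num)
  have m0 := nearMass_nonneg
  have m1 := nearMass_le
  have h6 : 2 * Real.pi * (√2 - 1) ≤ 2 * Real.pi * 0.41422 := by
    gcongr; linarith
  have h7 : (1 - √0.99) * nearMass ≤ 0.006 * nearMass := by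
    gcongr; linarith
  rw [one_div, inv_mul_le_iff₀ hp0, constU]
  nlinarith

variable {W : ℝ × ℝ → ℝ} {A B τ M : ℝ}

/-- Here `e` has the sign of the increments across the axis, so nothing cancels near the centres and
the trivial `c = 2 * B` is taken. -/
lemma abs_integral_unitDiff_add_le (hA : 0 ≤ A) (hB : 0 ≤ B) (hAM : A ≤ M)
    (hBM : B ≤ τ * M)
    (hX : ∀ t s s', |W (s, t) - W (s', t)| ≤ A * √|s - s'|)
    (hY : ∀ s, ∀ t ∈ Set.Icc (-(1 / 2) : ℝ) (1 / 2), ∀ t' ∈ Set.Icc (-(1 / 2) : ℝ) (1 / 2),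
      |W (s, t) - W (s, t')| ≤ B * √|t - t'|) (hF : Integrable (unitDiff W)) :
    |(∫ y, unitDiff W y) + Real.pi / 2 * (W (0, 1 / 2) - W (0, -(1 / 2)))| ≤ constU τ * M := by
  have he : |W (0, 1 / 2) - W (0, -(1 / 2))| ≤ B := by
    refine (hY 0 (1 / 2) (by norm_num) (-(1 / 2)) (by norm_num)).trans (le_of_eq ?_)
    norm_num
  refine (abs_integral_unitDiff_le hA hB hX hY he (c := 2 * B) (by positivity)
    (fun s _ l hl _ => ?_) hF).trans ?_
  · have h1 := hY s (1 / 2 - l) ⟨by linarith [hl.1, hl.2], by linarith [hl.1, hl.2]⟩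
      (l - 1 / 2) ⟨by linarith [hl.1, hl.2], by linarith [hl.1, hl.2]⟩
    have h2 : √|1 / 2 - l - (l - 1 / 2)| ≤ 1 := by
      rw [Real.sqrt_le_one, abs_le]
      constructor <;> linarith [hl.1, hl.2]
    have h3 := mul_le_mul_of_nonneg_left h2 hB
    exact (abs_add_le _ _).trans (by linarith)
  · have h1 := mul_le_mul_of_nonneg_right hBM coeffU_nonneg
    rw [constU]
    linarith

lemma abs_integral_unitDiff_sub_le (hA : 0 ≤ A) (hB : 0 ≤ B) (hAM : A ≤ M)
    (hBM : B ≤ τ * M)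
    (hX : ∀ t s s', |W (s, t) - W (s', t)| ≤ A * √|s - s'|)
    (hY : ∀ s, ∀ t ∈ Set.Icc (-(1 / 2) : ℝ) (1 / 2), ∀ t' ∈ Set.Icc (-(1 / 2) : ℝ) (1 / 2),
      |W (s, t) - W (s, t')| ≤ B * √|t - t'|) (hF : Integrable (unitDiff W)) :
    |(∫ y, unitDiff W y) - Real.pi / 2 * (W (0, 1 / 2) - W (0, -(1 / 2)))| ≤ constV τ * M := by
  have he : |-(W (0, 1 / 2) - W (0, -(1 / 2)))| ≤ B := by
    rw [abs_neg]
    refine (hY 0 (1 / 2) (by norm_num) (-(1 / 2)) (by norm_num)).trans (le_of_eq ?_)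
    norm_num
  rw [sub_eq_add_neg, ← mul_neg]
  -- Now `e` opposes the increments. Close to the centres the sum is controlled by two horizontal
  -- moves of length below `0.09`, each costing `0.3 * A`, and two vertical moves of length below
  -- `0.005`.
  refine (abs_integral_unitDiff_le hA hB hX hY he (c := 0.6 * A + 2 * √0.005 * B) (by positivity)
    (fun s hs l hl h5 => ?_) hF).trans ?_
  · have hs' : √|s - 0| ≤ 0.3 := by
      rw [sub_zero, Real.sqrt_le_iff]
      norm_num
      linarith
    have a1 := (hX (1 / 2) s 0).trans (mul_le_mul_of_nonneg_left hs' hA)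
    have a2 := (hX (-(1 / 2)) s 0).trans (mul_le_mul_of_nonneg_left hs' hA)
    have hl' : √|l| ≤ √0.005 := Real.sqrt_le_sqrt (by rw [abs_of_pos hl.1]; exact h5.le)
    have b1 := hY s (1 / 2 - l) ⟨by linarith [hl.1, hl.2], by linarith [hl.1, hl.2]⟩
      (1 / 2) (by norm_num)
    have b2 := hY s (l - 1 / 2) ⟨by linarith [hl.1, hl.2], by linarith [hl.1, hl.2]⟩
      (-(1 / 2)) (by norm_num)
    rw [show 1 / 2 - l - 1 / 2 = -l by ring, abs_neg] at b1
    rw [show l - 1 / 2 - -(1 / 2) = l by ring] at b2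
    have b3 := mul_le_mul_of_nonneg_left hl' hB
    rw [abs_le] at *
    constructor <;> linarith [a1.1, a1.2, a2.1, a2.2, b1.1, b1.2, b2.1, b2.2]
  · have h1 := mul_le_mul_of_nonneg_right hBM coeffV_nonneg
    have h2 := mul_le_mul_of_nonneg_right hAM nearMass_nonneg
    rw [constV]
    linarith

/-- The affine map that carries `(0, ±1/2)` to two points on a vertical line. -/
def scaleMap (p m d : ℝ) (y : ℝ × ℝ) : ℝ × ℝ := (p, m) + d • y

lemma scaleMap_mk (p m d s t : ℝ) : scaleMap p m d (s, t) = (p + d * s, m + d * t) := by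
  simp [scaleMap]

lemma K₂_smul {d : ℝ} (hd : d ≠ 0) (y : ℝ × ℝ) : K₂ (d • y) = (d ^ 2)⁻¹ * K₂ y := by
  rcases eq_or_ne (y.1 ^ 2 + y.2 ^ 2) 0 with h | h
  · have h1 : y.1 ^ 2 - y.2 ^ 2 = 0 := by nlinarith [sq_nonneg y.1, sq_nonneg y.2]
    simp only [K₂, Prod.smul_fst, Prod.smul_snd, smul_eq_mul]
    rw [show (d * y.1) ^ 2 - (d * y.2) ^ 2 = d ^ 2 * (y.1 ^ 2 - y.2 ^ 2) by ring, h1]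
    simp
  · simp only [K₂, Prod.smul_fst, Prod.smul_snd, smul_eq_mul]
    rw [show (d * y.1) ^ 2 - (d * y.2) ^ 2 = d ^ 2 * (y.1 ^ 2 - y.2 ^ 2) by ring,
      show (d * y.1) ^ 2 + (d * y.2) ^ 2 = d ^ 2 * (y.1 ^ 2 + y.2 ^ 2) by ring]
    field_simp

/-- The kernel is homogeneous of degree `-2`, so the factor `d ^ 2` is the planar Jacobian and the
integrals are scale invariant. -/
lemma regInt_scaleMap (W : ℝ × ℝ → ℝ) {d : ℝ} (hd : 0 < d) (p m : ℝ) (x y : ℝ × ℝ) :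
    regInt (fun y => W (scaleMap p m d y)) 1 x y =
      d ^ 2 * regInt W d (scaleMap p m d x) (scaleMap p m d y) := by
  have e1 : scaleMap p m d x - scaleMap p m d y = d • (x - y) := by
    simp only [scaleMap, smul_sub]; abel
  have e2 : y ∈ sq x 1 ↔ scaleMap p m d y ∈ sq (scaleMap p m d x) d := by
    have f1 : (scaleMap p m d x).1 - (scaleMap p m d y).1 = d * (x.1 - y.1) := by
      simp only [scaleMap, Prod.fst_add, Prod.smul_fst, smul_eq_mul]; ring
    have f2 : (scaleMap p m d x).2 - (scaleMap p m d y).2 = d * (x.2 - y.2) := by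
      simp only [scaleMap, Prod.snd_add, Prod.smul_snd, smul_eq_mul]; ring
    simp only [sq, Set.mem_ofPred_eq, f1, f2, abs_mul, abs_of_pos hd,
      mul_le_iff_le_one_right hd]
  rw [regInt, regInt, e1, K₂_smul hd.ne', indicator_const_congr e2]
  field_simp

lemma integral_comp_scaleMap {d : ℝ} (hd : 0 < d) (p m : ℝ) (f : ℝ × ℝ → ℝ) :
    ∫ y, f (scaleMap p m d y) = (d ^ 2)⁻¹ * ∫ y, f y := by
  unfold scaleMap
  rw [Measure.integral_comp_smul volume (fun y => f ((p, m) + y)) d,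
    integral_add_left_eq_self (μ := (volume : Measure (ℝ × ℝ))) f (p, m)]
  simp [Module.finrank_prod, abs_of_pos (pow_pos hd 2)]

lemma integrable_comp_scaleMap {d : ℝ} (hd : 0 < d) (p m : ℝ) {f : ℝ × ℝ → ℝ}
    (hf : Integrable f) : Integrable fun y => f (scaleMap p m d y) :=
  (hf.comp_add_left (p, m)).comp_smul hd.ne'

section Scaled

variable {p a b : ℝ}

lemma unitDiff_scaleMap (W : ℝ × ℝ → ℝ) (hab : b < a) (y : ℝ × ℝ) :
    unitDiff (fun y => W (scaleMap p ((a + b) / 2) (a - b) y)) y = (a - b) ^ 2 *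
      (regInt W (a - b) (p, a) (scaleMap p ((a + b) / 2) (a - b) y) -
        regInt W (a - b) (p, b) (scaleMap p ((a + b) / 2) (a - b) y)) := by
  have e1 : scaleMap p ((a + b) / 2) (a - b) (0, 1 / 2) = (p, a) := by
    rw [scaleMap_mk]; congr 1 <;> ring
  have e2 : scaleMap p ((a + b) / 2) (a - b) (0, -(1 / 2)) = (p, b) := by
    rw [scaleMap_mk]; congr 1 <;> ring
  rw [unitDiff, regInt_scaleMap W (sub_pos.2 hab), regInt_scaleMap W (sub_pos.2 hab), e1, e2]
  ring

/-- Scaling to distance one multiplies both Hölder constants by `√d`, which is the source of `√(a -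
b)`. Vertical regularity is required only at heights between the two points. -/
lemma abs_integral_regInt_sub_le (hA : 0 ≤ A) (hB : 0 ≤ B) (hAM : A ≤ M)
    (hBM : B ≤ τ * M) (hab : b < a)
    (hX : ∀ t s s', |W (s, t) - W (s', t)| ≤ A * √|s - s'|)
    (hY : ∀ s, ∀ t ∈ Set.Icc b a, ∀ t' ∈ Set.Icc b a, |W (s, t) - W (s, t')| ≤ B * √|t - t'|)
    (hF : Integrable fun y => regInt W (a - b) (p, a) y - regInt W (a - b) (p, b) y) :
    |(∫ y, (regInt W (a - b) (p, a) y - regInt W (a - b) (p, b) y)) +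
      Real.pi / 2 * (W (p, a) - W (p, b))| ≤ constU τ * M * √(a - b) ∧
    |(∫ y, (regInt W (a - b) (p, a) y - regInt W (a - b) (p, b) y)) -
      Real.pi / 2 * (W (p, a) - W (p, b))| ≤ constV τ * M * √(a - b) := by
  have hd : 0 < a - b := sub_pos.2 hab
  set d := a - b with hdef
  set m := (a + b) / 2 with hm
  have e1 : scaleMap p m d (0, 1 / 2) = (p, a) := by
    rw [scaleMap_mk]; congr 1 <;> rw [hdef] <;> linarith
  have e2 : scaleMap p m d (0, -(1 / 2)) = (p, b) := by
    rw [scaleMap_mk]; congr 1 <;> rw [hdef] <;> linarith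
  have hu : ∀ y, unitDiff (fun y => W (scaleMap p m d y)) y = d ^ 2 *
      (regInt W d (p, a) (scaleMap p m d y) - regInt W d (p, b) (scaleMap p m d y)) :=
    fun y => unitDiff_scaleMap W hab y
  have hi : Integrable (unitDiff fun y => W (scaleMap p m d y)) := by
    rw [funext hu]
    exact (integrable_comp_scaleMap hd p m hF).const_mul _
  have hint : ∫ y, unitDiff (fun y => W (scaleMap p m d y)) y =
      ∫ y, (regInt W d (p, a) y - regInt W d (p, b) y) := by
    simp only [hu]
    rw [integral_const_mul,
      integral_comp_scaleMap hd p m (fun y => regInt W d (p, a) y - regInt W d (p, b) y)]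
    field_simp
  have hX' : ∀ t s s', |W (scaleMap p m d (s, t)) - W (scaleMap p m d (s', t))| ≤
      A * √d * √|s - s'| := by
    intro t s s'
    simp only [scaleMap_mk]
    refine (hX _ _ _).trans (le_of_eq ?_)
    rw [add_sub_add_left_eq_sub, ← mul_sub, abs_mul, abs_of_pos hd, Real.sqrt_mul hd.le]
    ring
  have hY' : ∀ s, ∀ t ∈ Set.Icc (-(1 / 2) : ℝ) (1 / 2), ∀ t' ∈ Set.Icc (-(1 / 2) : ℝ) (1 / 2),
      |W (scaleMap p m d (s, t)) - W (scaleMap p m d (s, t'))| ≤ B * √d * √|t - t'| := by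
    intro s t ht t' ht'
    simp only [scaleMap_mk]
    have hmem : ∀ t ∈ Set.Icc (-(1 / 2) : ℝ) (1 / 2), m + d * t ∈ Set.Icc b a := by
      intro t ht
      constructor <;> nlinarith [ht.1, ht.2]
    refine (hY _ _ (hmem t ht) _ (hmem t' ht')).trans (le_of_eq ?_)
    rw [add_sub_add_left_eq_sub, ← mul_sub, abs_mul, abs_of_pos hd, Real.sqrt_mul hd.le]
    ring
  have hAM' : A * √d ≤ M * √d := mul_le_mul_of_nonneg_right hAM (Real.sqrt_nonneg _)
  have hBM' : B * √d ≤ τ * (M * √d) := by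
    rw [← mul_assoc]; exact mul_le_mul_of_nonneg_right hBM (Real.sqrt_nonneg _)
  have k1 := abs_integral_unitDiff_add_le (W := fun y => W (scaleMap p m d y)) (by positivity)
    (by positivity) hAM' hBM' hX' hY' hi
  have k2 := abs_integral_unitDiff_sub_le (W := fun y => W (scaleMap p m d y)) (by positivity)
    (by positivity) hAM' hBM' hX' hY' hi
  rw [hint, e1, e2, ← mul_assoc] at k1 k2
  exact ⟨k1, k2⟩

end Scaled

end SamePairEstimate

/-! ### Existence of the principal value. -/

section PrincipalValue

/-- The properties of the odd extension that are used for the existence of the integrals. -/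
structure HalfHolder (W : ℝ × ℝ → ℝ) (A B G : ℝ) : Prop where
  meas : Measurable W
  A_nonneg : 0 ≤ A
  B_nonneg : 0 ≤ B
  G_nonneg : 0 ≤ G
  horiz : ∀ t s s', |W (s, t) - W (s', t)| ≤ A * √|s - s'|
  vert : ∀ s t t', (0 ≤ t ∧ 0 ≤ t') ∨ (t < 0 ∧ t' < 0) → |W (s, t) - W (s, t')| ≤ B * √|t - t'|
  growth : ∀ y, |W y| ≤ G + A * √|y.1| + B * √|y.2|
  odd : ∀ y : ℝ × ℝ, y.2 ≠ 0 → W (y.1, -y.2) = -W y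

lemma sq_eq_closedBall (x : ℝ × ℝ) (a : ℝ) : sq x a = Metric.closedBall x a := by
  refine Set.ext fun y => ?_
  simp only [sq, Set.mem_ofPred_eq, Metric.mem_closedBall, Prod.dist_eq, max_le_iff, Real.dist_eq]
  rw [abs_sub_comm y.1, abs_sub_comm y.2]

lemma measurableSet_sq (x : ℝ × ℝ) (a : ℝ) : MeasurableSet (sq x a) := by
  rw [sq_eq_closedBall]; exact Metric.isClosed_closedBall.measurableSet

lemma mem_sq_iff {x y : ℝ × ℝ} {a : ℝ} : y ∈ sq x a ↔ ‖x - y‖ ≤ a := by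
  rw [sq_eq_closedBall, Metric.mem_closedBall, dist_eq_norm, norm_sub_rev]

lemma abs_K₂_le_norm (ξ : ℝ × ℝ) : |K₂ ξ| ≤ 1 / 2 * (‖ξ‖ ^ 2)⁻¹ := by
  refine (abs_K₂_le ξ.1 ξ.2).trans ?_
  rcases eq_or_ne ξ 0 with h | h
  · simp [h]
  · have h0 : 0 < ‖ξ‖ := norm_pos_iff.2 h
    have h1 : ‖ξ‖ ^ 2 ≤ ξ.1 ^ 2 + ξ.2 ^ 2 := by
      rw [Prod.norm_def]
      rcases max_choice ‖ξ.1‖ ‖ξ.2‖ with h | h <;> rw [h, Real.norm_eq_abs, sq_abs] <;>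
        nlinarith [sq_nonneg ξ.1, sq_nonneg ξ.2]
    gcongr

lemma measurable_regInt {W : ℝ × ℝ → ℝ} (hW : Measurable W) (r : ℝ) (x : ℝ × ℝ) :
    Measurable (regInt W r x) := by
  unfold regInt
  exact (measurable_K₂.comp (measurable_const.sub measurable_id)).mul
    (hW.sub (measurable_const.indicator (measurableSet_sq x r)))

lemma measurable_ker_sub (x : ℝ × ℝ) : Measurable fun y => K₂ (x - y) :=
  measurable_K₂.comp (measurable_const.sub measurable_id)

variable {W : ℝ × ℝ → ℝ} {A B G : ℝ}

/-- The ball of radius `|x.2|` does not cross the boundary, where `W` may jump. -/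
lemma HalfHolder.abs_sub_le_near (h : HalfHolder W A B G) {x y : ℝ × ℝ}
    (hy : ‖x - y‖ < |x.2|) : |W x - W y| ≤ (A + B) * √‖x - y‖ := by
  have h1 : |x.1 - y.1| ≤ ‖x - y‖ := norm_fst_le (x - y)
  have h2 : |x.2 - y.2| ≤ ‖x - y‖ := norm_snd_le (x - y)
  have hs : (0 ≤ x.2 ∧ 0 ≤ y.2) ∨ (x.2 < 0 ∧ y.2 < 0) := by
    have h3 := abs_le.1 (h2.trans hy.le)
    have h4 := h2.trans_lt hy
    rcases le_or_gt 0 x.2 with hx | hx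
    · left
      rw [abs_of_nonneg hx] at h3
      exact ⟨hx, by linarith [h3.2]⟩
    · right
      rw [abs_of_neg hx, abs_lt] at h4
      exact ⟨hx, by linarith [h4.1]⟩
  have k1 := (h.horiz x.2 x.1 y.1).trans
    (mul_le_mul_of_nonneg_left (Real.sqrt_le_sqrt h1) h.A_nonneg)
  have k2 := (h.vert y.1 x.2 y.2 hs).trans
    (mul_le_mul_of_nonneg_left (Real.sqrt_le_sqrt h2) h.B_nonneg)
  have := abs_sub_le (W (x.1, x.2)) (W (y.1, x.2)) (W (y.1, y.2))
  simp only [Prod.mk.eta] at *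
  linarith

lemma HalfHolder.abs_le_of_mem (h : HalfHolder W A B G) {x y : ℝ × ℝ} {a : ℝ}
    (hy : y ∈ sq x a) : |W y| ≤ G + (A + B) * √(‖x‖ + a) := by
  have h0 : ‖y‖ ≤ ‖x‖ + a := by
    have := norm_sub_norm_le y x
    rw [norm_sub_rev] at this
    linarith [mem_sq_iff.1 hy]
  have h1 : |y.1| ≤ ‖x‖ + a := (norm_fst_le y).trans h0
  have h2 : |y.2| ≤ ‖x‖ + a := (norm_snd_le y).trans h0
  have k1 := mul_le_mul_of_nonneg_left (Real.sqrt_le_sqrt h1) h.A_nonneg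
  have k2 := mul_le_mul_of_nonneg_left (Real.sqrt_le_sqrt h2) h.B_nonneg
  linarith [h.growth y]

lemma integrableOn_bounded_mul_ker {g : ℝ × ℝ → ℝ} (hg : Measurable g) (x : ℝ × ℝ) {C a ρ : ℝ}
    (hρ : 0 < ρ) (hC : ∀ y ∈ sq x a, |g y| ≤ C) :
    IntegrableOn (fun y => K₂ (x - y) * g y) (sq x a \ Metric.ball x ρ) := by
  have hm : MeasurableSet (sq x a \ Metric.ball x ρ) :=
    (measurableSet_sq x a).diff Metric.isOpen_ball.measurableSet
  refine Measure.integrableOn_of_bounded (M := 1 / 2 * (ρ ^ 2)⁻¹ * C) ?_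
    ((measurable_ker_sub x).mul hg).aestronglyMeasurable ?_
  · refine ((measure_mono Set.sdiff_subset).trans_lt ?_).ne
    rw [sq_eq_closedBall]
    exact measure_closedBall_lt_top
  · filter_upwards [ae_restrict_mem hm] with y hy
    have h1 : ρ ≤ ‖x - y‖ := by
      have := hy.2
      rwa [Metric.mem_ball, not_lt, dist_eq_norm, norm_sub_rev] at this
    rw [Real.norm_eq_abs, abs_mul]
    refine mul_le_mul ((abs_K₂_le_norm _).trans ?_) (hC y hy.1) (abs_nonneg _) (by positivity)
    gcongr

/-- After subtraction of `W x` the integrand is of order `‖ξ‖ ^ (-3/2)`, which is integrable in the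
plane. -/
lemma HalfHolder.integrableOn_regInt_ball (h : HalfHolder W A B G) {x : ℝ × ℝ} {r ρ : ℝ}
    (hρ : ρ ≤ |x.2|) (hr : ρ ≤ r) : IntegrableOn (regInt W r x) (Metric.ball x ρ) := by
  have hf : IntegrableOn (fun ξ => regInt W r x (x + ξ)) (Metric.ball 0 ρ) := by
    refine integrableOn_ball_of_norm_le_rpow (C := 1 / 2 * (A + B)) (α := 3 / 2)
      (by simp [Module.finrank_prod]) (by simp [Module.finrank_prod]; norm_num) ?_
      ((measurable_regInt h.meas r x).comp (measurable_const.add measurable_id)).aestronglyMeasurable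
    filter_upwards [ae_restrict_mem Metric.isOpen_ball.measurableSet] with ξ hξ
    rw [mem_ball_zero_iff] at hξ
    have e1 : x - (x + ξ) = -ξ := by abel
    have h1 : x + ξ ∈ sq x r := by
      rw [mem_sq_iff, e1, norm_neg]; linarith
    rw [regInt, Set.indicator_of_mem h1, e1, Real.norm_eq_abs, abs_mul, abs_sub_comm]
    have h2 := h.abs_sub_le_near (x := x) (y := x + ξ) (by rw [e1, norm_neg]; linarith)
    have h3 := abs_K₂_le_norm (-ξ)
    rw [e1] at h2
    rw [norm_neg] at h2 h3
    refine (mul_le_mul h3 h2 (abs_nonneg _) (by positivity)).trans (le_of_eq ?_)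
    rcases eq_or_ne ξ 0 with h0 | h0
    · simp [h0]
    · have h0 : 0 < ‖ξ‖ := norm_pos_iff.2 h0
      rw [Real.sqrt_eq_rpow, ← Real.rpow_natCast, ← Real.rpow_neg h0.le,
        show (-(3 / 2) : ℝ) = -((2 : ℕ) : ℝ) + 1 / 2 by norm_num, Real.rpow_add h0]
      ring
  have hp := (measurePreserving_add_left (volume : Measure (ℝ × ℝ)) x)
  have he : MeasurableEmbedding fun ξ : ℝ × ℝ => x + ξ := measurableEmbedding_addLeft x
  have e : (fun ξ => x + ξ) ⁻¹' Metric.ball x ρ = Metric.ball 0 ρ :=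
    Set.ext fun ξ => by simp
  rw [← hp.integrableOn_comp_preimage he, e]
  exact hf

lemma HalfHolder.integrableOn_regInt (h : HalfHolder W A B G) {x : ℝ × ℝ} {r : ℝ}
    (hx : x.2 ≠ 0) (hr : 0 < r) (a : ℝ) : IntegrableOn (regInt W r x) (sq x a) := by
  have hρ : 0 < min |x.2| r := lt_min (abs_pos.2 hx) hr
  have h1 := h.integrableOn_regInt_ball (x := x) (r := r) (min_le_left _ _) (min_le_right _ _)
  have h2 : IntegrableOn (regInt W r x) (sq x a \ Metric.ball x (min |x.2| r)) :=
    integrableOn_bounded_mul_ker (C := G + (A + B) * √(‖x‖ + a) + |W x|)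
      (h.meas.sub (measurable_const.indicator (measurableSet_sq x r))) x hρ fun y hy => by
        refine (abs_sub _ _).trans (add_le_add (h.abs_le_of_mem hy) ?_)
        exact norm_indicator_le_norm_self (fun _ => W x) y
  refine (h1.union h2).mono_set fun y hy => ?_
  by_cases hb : y ∈ Metric.ball x (min |x.2| r)
  · exact Or.inl hb
  · exact Or.inr ⟨hy, hb⟩

lemma HalfHolder.integrableOn_ker_mul (h : HalfHolder W A B G) (x : ℝ × ℝ) (a : ℝ) {ε : ℝ}
    (hε : 0 < ε) : IntegrableOn (fun y => K₂ (x - y) * W y) (sq x a \ sq x ε) :=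
  (integrableOn_bounded_mul_ker h.meas x hε fun _ hy => h.abs_le_of_mem hy).mono_set
    (Set.sdiff_subset_sdiff_right (by rw [sq_eq_closedBall]; exact Metric.ball_subset_closedBall))

lemma integrableOn_ker (x : ℝ × ℝ) (a : ℝ) {ε : ℝ} (hε : 0 < ε) :
    IntegrableOn (fun y => K₂ (x - y)) (sq x a \ sq x ε) := by
  have h := integrableOn_bounded_mul_ker (g := fun _ => 1) measurable_const x (C := 1) (a := a) hε
    (fun _ _ => by simp)
  simp only [mul_one] at h
  refine h.mono_set (Set.sdiff_subset_sdiff_right ?_)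
  rw [sq_eq_closedBall x ε]
  exact Metric.ball_subset_closedBall

/-- The kernel has mean zero on square annuli. -/
lemma setIntegral_ker_annulus (x : ℝ × ℝ) (a ε : ℝ) :
    ∫ y in sq x a \ sq x ε, K₂ (x - y) = 0 := by
  -- With this shift `y.swap + c` exchanges the coordinates relative to `x`: it preserves the
  -- measure and all squares about `x`, and changes the sign of the kernel.
  set c : ℝ × ℝ := (x.1 - x.2, x.2 - x.1)
  have hp : MeasurePreserving (fun y : ℝ × ℝ => y.swap + c) volume volume :=
    (measurePreserving_add_right volume c).comp Measure.measurePreserving_swap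
  have he : MeasurableEmbedding (fun y : ℝ × ℝ => y.swap + c) :=
    (measurableEmbedding_addRight c).comp MeasurableEquiv.prodComm.measurableEmbedding
  have hm : ∀ b, ∀ y : ℝ × ℝ, y.swap + c ∈ sq x b ↔ y ∈ sq x b := by
    intro b y
    simp only [sq, Set.mem_ofPred_eq, Prod.fst_add, Prod.snd_add, Prod.fst_swap, Prod.snd_swap, c]
    rw [show x.1 - (y.2 + (x.1 - x.2)) = x.2 - y.2 by ring,
      show x.2 - (y.1 + (x.2 - x.1)) = x.1 - y.1 by ring, and_comm]
  have hK : ∀ y : ℝ × ℝ, K₂ (x - (y.swap + c)) = -K₂ (x - y) := by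
    intro y
    simp only [K₂, Prod.fst_add, Prod.snd_add, Prod.fst_swap, Prod.snd_swap, Prod.fst_sub,
      Prod.snd_sub, c]
    rw [show x.1 - (y.2 + (x.1 - x.2)) = x.2 - y.2 by ring,
      show x.2 - (y.1 + (x.2 - x.1)) = x.1 - y.1 by ring,
      add_comm ((x.2 - y.2) ^ 2)]
    ring
  have h := hp.setIntegral_preimage_emb he (fun y => K₂ (x - y)) (sq x a \ sq x ε)
  have hs : (fun y : ℝ × ℝ => y.swap + c) ⁻¹' (sq x a \ sq x ε) = sq x a \ sq x ε :=
    Set.ext fun y => by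
      rw [Set.mem_preimage, Set.mem_sdiff, Set.mem_sdiff, hm, hm]
  rw [hs] at h
  simp only [hK, integral_neg] at h
  linarith

/-- The subtracted part is a constant times the kernel on a square annulus, whose integral is zero.
-/
lemma HalfHolder.setIntegral_annulus_eq (h : HalfHolder W A B G) (x : ℝ × ℝ) {a r ε : ℝ}
    (hε : 0 < ε) (hr : r ≤ a) :
    ∫ y in sq x a \ sq x ε, K₂ (x - y) * W y = ∫ y in sq x a \ sq x ε, regInt W r x y := by
  have hm : MeasurableSet (sq x a \ sq x ε) := (measurableSet_sq x a).diff (measurableSet_sq x ε)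
  have e : ∀ y, regInt W r x y = K₂ (x - y) * W y -
      (sq x r).indicator (fun y => W x * K₂ (x - y)) y := by
    intro y
    by_cases hy : y ∈ sq x r
    · rw [regInt, Set.indicator_of_mem hy, Set.indicator_of_mem hy]; ring
    · rw [regInt, Set.indicator_of_notMem hy, Set.indicator_of_notMem hy]; ring
  simp only [e]
  rw [integral_sub (h.integrableOn_ker_mul x a hε)
    (((integrableOn_ker x a hε).const_mul _).indicator (measurableSet_sq x r)),
    integral_indicator (measurableSet_sq x r), Measure.restrict_restrict (measurableSet_sq x r),
    ← Set.inter_sdiff_assoc, Set.inter_eq_left.2, integral_const_mul, setIntegral_ker_annulus]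
  · simp
  · intro y hy
    rw [mem_sq_iff] at *
    linarith

lemma HalfHolder.tendsto_annulus (h : HalfHolder W A B G) {x : ℝ × ℝ} (hx : x.2 ≠ 0) {a r : ℝ}
    (hr : 0 < r) (hra : r ≤ a) :
    Tendsto (fun ε => ∫ y in sq x a \ sq x ε, K₂ (x - y) * W y) (𝓝[>] 0)
      (𝓝 (∫ y in sq x a, regInt W r x y)) := by
  have hc : AECover (volume.restrict (sq x a)) (𝓝[>] (0 : ℝ)) fun ε => (sq x ε)ᶜ := by
    refine ⟨?_, fun ε => (measurableSet_sq x ε).compl⟩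
    refine ae_restrict_of_ae ?_
    have : ∀ᵐ y : ℝ × ℝ, y ≠ x := by
      simp [ae_iff]
    filter_upwards [this] with y hy
    have h0 : 0 < ‖x - y‖ := norm_pos_iff.2 (sub_ne_zero.2 hy.symm)
    filter_upwards [mem_nhdsWithin_of_mem_nhds (Iio_mem_nhds h0)] with ε hε
    rw [Set.mem_compl_iff, mem_sq_iff, not_le]
    exact hε
  have ht := hc.integral_tendsto_of_countably_generated (h.integrableOn_regInt hx hr a)
  refine ht.congr' ?_
  filter_upwards [self_mem_nhdsWithin] with ε hε
  rw [Measure.restrict_restrict (measurableSet_sq x ε).compl, Set.inter_comm, ← Set.sdiff_eq,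
    h.setIntegral_annulus_eq x hε hra]

end PrincipalValue

/-! ### Convergence over growing squares. -/

section LimitAtInfinity

lemma K₂_eq_re (ξ : ℝ × ℝ) : K₂ ξ = 1 / 2 * ((⟨ξ.1, ξ.2⟩ : ℂ) ^ 2)⁻¹.re := by
  have e1 : ((⟨ξ.1, ξ.2⟩ : ℂ) ^ 2).re = ξ.1 ^ 2 - ξ.2 ^ 2 := by
    simp [pow_two]
  have e2 : Complex.normSq ((⟨ξ.1, ξ.2⟩ : ℂ) ^ 2) = (ξ.1 ^ 2 + ξ.2 ^ 2) ^ 2 := by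
    rw [map_pow, Complex.normSq_mk]; ring
  rw [Complex.inv_re, e1, e2, K₂]

/-- As `K₂` is half the real part of `z⁻²`, the difference is controlled by `(w - z)(w + z) / (z²
w²)`. -/
lemma abs_K₂_sub_le {ξ η : ℝ × ℝ} {δ : ℝ} (h : ‖ξ - η‖ ≤ δ) (h2 : 2 * δ ≤ ‖ξ‖) (h0 : 0 < ‖ξ‖) :
    |K₂ ξ - K₂ η| ≤ 20 * δ * (‖ξ‖ ^ 3)⁻¹ := by
  have upper : ∀ v : ℝ × ℝ, ‖(⟨v.1, v.2⟩ : ℂ)‖ ≤ 2 * ‖v‖ := fun v => by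
    refine (Complex.norm_le_abs_re_add_abs_im _).trans ?_
    have h1 : |v.1| ≤ ‖v‖ := norm_fst_le v
    have h2 : |v.2| ≤ ‖v‖ := norm_snd_le v
    simp only
    linarith
  have lower : ∀ v : ℝ × ℝ, ‖v‖ ≤ ‖(⟨v.1, v.2⟩ : ℂ)‖ := fun v => by
    rw [Prod.norm_def]
    exact max_le (Complex.abs_re_le_norm (⟨v.1, v.2⟩ : ℂ)) (Complex.abs_im_le_norm (⟨v.1, v.2⟩ : ℂ))
  have hη : ‖ξ‖ / 2 ≤ ‖η‖ := by
    have := norm_sub_norm_le ξ η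
    linarith
  have hη' : ‖η‖ ≤ 3 / 2 * ‖ξ‖ := by
    have := norm_sub_norm_le η ξ
    rw [norm_sub_rev] at this
    linarith
  set z : ℂ := ⟨ξ.1, ξ.2⟩ with hz
  set w : ℂ := ⟨η.1, η.2⟩ with hw
  have z0 : 0 < ‖z‖ := h0.trans_le (lower ξ)
  have w0 : 0 < ‖w‖ := by linarith [lower η]
  have hzw : ‖w - z‖ ≤ 2 * δ := by
    have := upper (ξ - η)
    rw [norm_sub_rev]
    have e : z - w = ⟨(ξ - η).1, (ξ - η).2⟩ := by
      apply Complex.ext <;> simp [hz, hw]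
    rw [e]; linarith
  have e : (z ^ 2)⁻¹ - (w ^ 2)⁻¹ = (w - z) * (w + z) / (z ^ 2 * w ^ 2) := by
    have : z ≠ 0 := norm_pos_iff.1 z0
    have : w ≠ 0 := norm_pos_iff.1 w0
    field_simp
    ring
  have hδ : 0 ≤ δ := (norm_nonneg _).trans h
  rw [K₂_eq_re, K₂_eq_re, ← hz, ← hw, ← mul_sub, ← Complex.sub_re, abs_mul,
    abs_of_pos (by norm_num : (0 : ℝ) < 1 / 2)]
  have k1 : ‖w + z‖ ≤ 5 * ‖ξ‖ := by
    refine (norm_add_le _ _).trans ?_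
    linarith [upper ξ, upper η]
  have k2 : ‖ξ‖ ^ 2 * (‖ξ‖ / 2) ^ 2 ≤ ‖z‖ ^ 2 * ‖w‖ ^ 2 := by
    have := lower ξ
    have := hη.trans (lower η)
    gcongr
  calc 1 / 2 * |((z ^ 2)⁻¹ - (w ^ 2)⁻¹).re| ≤ 1 / 2 * ‖(z ^ 2)⁻¹ - (w ^ 2)⁻¹‖ := by
        gcongr; exact Complex.abs_re_le_norm _
    _ = 1 / 2 * (‖w - z‖ * ‖w + z‖ / (‖z‖ ^ 2 * ‖w‖ ^ 2)) := by
        rw [e, norm_div, norm_mul, norm_mul, norm_pow, norm_pow]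
    _ ≤ 1 / 2 * (2 * δ * (5 * ‖ξ‖) / (‖ξ‖ ^ 2 * (‖ξ‖ / 2) ^ 2)) := by
        gcongr
    _ = 20 * δ * (‖ξ‖ ^ 3)⁻¹ := by
        field_simp
        ring

variable {W : ℝ × ℝ → ℝ} {A B G : ℝ}

/-- Far away the kernel difference decays like `n⁻³` and `W` grows like `√n`, so the integrand is of
order `n ^ (-5/2)`, integrable in the plane. -/
lemma HalfHolder.integrable_regInt_sub (h : HalfHolder W A B G) {x z : ℝ × ℝ} {r : ℝ}
    (hx : x.2 ≠ 0) (hz : z.2 ≠ 0) (hr : 0 < r) :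
    Integrable fun y => regInt W r x y - regInt W r z y := by
  set δ := ‖x - z‖ with hδ
  have hδ0 : 0 ≤ δ := norm_nonneg _
  set R := 2 * δ + r + ‖x‖ + 1 with hR
  have hx0 := norm_nonneg x
  have h1 : IntegrableOn (fun y => regInt W r x y - regInt W r z y) (sq x R) := by
    refine (h.integrableOn_regInt hx hr R).sub ((h.integrableOn_regInt hz hr (R + δ)).mono_set ?_)
    intro y hy
    rw [mem_sq_iff] at *
    have := norm_add_le (z - x) (x - y)
    rw [sub_add_sub_cancel, norm_sub_rev z x] at this
    linarith
  have h2 : IntegrableOn (fun y => regInt W r x y - regInt W r z y) (sq x R)ᶜ := by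
    have hi : Integrable fun y => (20 * δ * (G + 2 * (A + B)) * 2 ^ (5 / 2 : ℝ)) *
        (1 + ‖x - y‖) ^ (-(5 / 2) : ℝ) :=
      ((integrable_one_add_norm (μ := (volume : Measure (ℝ × ℝ))) (r := 5 / 2)
        (by simp [Module.finrank_prod]; norm_num)).comp_sub_left x).const_mul _
    refine Integrable.mono' hi.integrableOn
      ((measurable_regInt h.meas r x).sub (measurable_regInt h.meas r z)).aestronglyMeasurable ?_
    filter_upwards [ae_restrict_mem (measurableSet_sq x R).compl] with y hy
    rw [Set.mem_compl_iff, mem_sq_iff, not_le] at hy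
    have hzy : ‖x - y‖ - δ ≤ ‖z - y‖ := by
      have := norm_add_le (x - z) (z - y)
      rw [sub_add_sub_cancel] at this
      linarith
    have n1 : y ∉ sq x r := by rw [mem_sq_iff]; linarith
    have n2 : y ∉ sq z r := by rw [mem_sq_iff]; linarith
    rw [regInt, regInt, Set.indicator_of_notMem n1, Set.indicator_of_notMem n2, sub_zero,
      ← sub_mul, Real.norm_eq_abs, abs_mul]
    set n := ‖x - y‖ with hn
    have n0 : 1 ≤ n := by linarith
    have k1 : |K₂ (x - y) - K₂ (z - y)| ≤ 20 * δ * (n ^ 3)⁻¹ :=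
      abs_K₂_sub_le (by rw [sub_sub_sub_cancel_right]) (by linarith) (by linarith)
    have k2 : |W y| ≤ (G + 2 * (A + B)) * √n := by
      have hm : y ∈ sq x n := mem_sq_iff.2 le_rfl
      have s1 : √(‖x‖ + n) ≤ 2 * √n := by
        rw [Real.sqrt_le_left (by positivity), mul_pow, Real.sq_sqrt (by linarith)]
        linarith
      have s2 : 1 ≤ √n := Real.one_le_sqrt.2 n0
      have t1 := mul_le_mul_of_nonneg_left s1 (add_nonneg h.A_nonneg h.B_nonneg)
      have t2 := mul_le_mul_of_nonneg_left s2 h.G_nonneg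
      linarith [h.abs_le_of_mem hm]
    have hAB : 0 ≤ G + 2 * (A + B) := by linarith [h.A_nonneg, h.B_nonneg, h.G_nonneg]
    have k3 : (n ^ 3)⁻¹ * √n ≤ 2 ^ (5 / 2 : ℝ) * (1 + n) ^ (-(5 / 2) : ℝ) := by
      have np : 0 < n := by linarith
      have e1 : (n ^ 3)⁻¹ * √n = n ^ (-(5 / 2) : ℝ) := by
        rw [Real.sqrt_eq_rpow, ← Real.rpow_natCast, ← Real.rpow_neg np.le, ← Real.rpow_add np]
        norm_num
      have e2 : (2 : ℝ) ^ (5 / 2 : ℝ) * (1 + n) ^ (-(5 / 2) : ℝ) = ((1 + n) / 2) ^ (-(5 / 2) : ℝ) := by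
        rw [Real.div_rpow (by linarith) (by norm_num), Real.rpow_neg (by norm_num : (0 : ℝ) ≤ 2),
          div_inv_eq_mul, mul_comm]
      rw [e1, e2]
      exact Real.rpow_le_rpow_of_nonpos (by linarith) (by linarith) (by norm_num)
    calc |K₂ (x - y) - K₂ (z - y)| * |W y|
        ≤ 20 * δ * (n ^ 3)⁻¹ * ((G + 2 * (A + B)) * √n) :=
          mul_le_mul k1 k2 (abs_nonneg _) (by positivity)
      _ = 20 * δ * (G + 2 * (A + B)) * ((n ^ 3)⁻¹ * √n) := by ring
      _ ≤ 20 * δ * (G + 2 * (A + B)) * (2 ^ (5 / 2 : ℝ) * (1 + n) ^ (-(5 / 2) : ℝ)) := by gcongr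
      _ = _ := by ring
  rw [← integrableOn_univ, ← Set.union_compl_self (sq x R)]
  exact h1.union h2

lemma volume_real_sq (x : ℝ × ℝ) {a : ℝ} (ha : 0 ≤ a) : volume.real (sq x a) = (2 * a) ^ 2 := by
  rw [sq_eq_closedBall, ← closedBall_prod_same, Measure.volume_eq_prod, measureReal_prod_prod,
    Real.volume_real_closedBall ha, Real.volume_real_closedBall ha, pow_two]

/-- Shifting a square of half side `a` by a bounded amount changes a set of area `O(a)`, on which
the integrand is `O(a ^ (-3/2))`. -/
lemma HalfHolder.abs_setIntegral_sdiff_le (h : HalfHolder W A B G) {x z : ℝ × ℝ} {r a : ℝ}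
    {S : Set (ℝ × ℝ)} (hS : S ⊆ sq x (a + ‖x - z‖) \ sq x (a - ‖x - z‖))
    (hS' : ∀ y ∈ S, a - ‖x - z‖ ≤ ‖z - y‖) (hr : 0 < r)
    (ha : 2 * ‖x - z‖ + 2 * r + ‖x‖ + 1 ≤ a) :
    |∫ y in S, regInt W r z y| ≤ 32 * ‖x - z‖ * (G + 2 * (A + B)) * (√a)⁻¹ := by
  set δ := ‖x - z‖ with hδ
  have hδ0 : 0 ≤ δ := norm_nonneg _
  have hx0 := norm_nonneg x
  have a0 : 0 < a := by linarith
  have hAB : 0 ≤ G + 2 * (A + B) := by linarith [h.A_nonneg, h.B_nonneg, h.G_nonneg]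
  have hsub : sq x (a - δ) ⊆ sq x (a + δ) := by
    rw [sq_eq_closedBall, sq_eq_closedBall]
    exact Metric.closedBall_subset_closedBall (by linarith)
  have hfin : volume (sq x (a + δ)) ≠ ∞ := by
    rw [sq_eq_closedBall]; exact measure_closedBall_lt_top.ne
  have hvol : volume.real S ≤ 16 * a * δ := by
    refine (measureReal_mono hS (measure_ne_top_of_subset Set.sdiff_subset hfin)).trans ?_
    rw [measureReal_sdiff hsub (measurableSet_sq x _), volume_real_sq x (by linarith),
      volume_real_sq x (by linarith)]
    nlinarith
  have hb : ∀ y ∈ S, ‖regInt W r z y‖ ≤ 2 * (G + 2 * (A + B)) * (√a / a ^ 2) := by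
    intro y hy
    have hny := hS' y hy
    have n2 : y ∉ sq z r := by rw [mem_sq_iff]; linarith
    rw [regInt, Set.indicator_of_notMem n2, sub_zero, Real.norm_eq_abs, abs_mul]
    have k1 : |K₂ (z - y)| ≤ 2 * (a ^ 2)⁻¹ := by
      refine (abs_K₂_le_norm _).trans ?_
      have : a / 2 ≤ ‖z - y‖ := by linarith
      calc 1 / 2 * (‖z - y‖ ^ 2)⁻¹ ≤ 1 / 2 * ((a / 2) ^ 2)⁻¹ := by gcongr
        _ = 2 * (a ^ 2)⁻¹ := by ring
    have k2 : |W y| ≤ (G + 2 * (A + B)) * √a := by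
      have s1 : √(‖x‖ + (a + δ)) ≤ 2 * √a := by
        rw [Real.sqrt_le_left (by positivity), mul_pow, Real.sq_sqrt a0.le]
        linarith
      have s2 : 1 ≤ √a := Real.one_le_sqrt.2 (by linarith)
      have t1 := mul_le_mul_of_nonneg_left s1 (add_nonneg h.A_nonneg h.B_nonneg)
      have t2 := mul_le_mul_of_nonneg_left s2 h.G_nonneg
      linarith [h.abs_le_of_mem (hS hy).1]
    refine (mul_le_mul k1 k2 (abs_nonneg _) (by positivity)).trans (le_of_eq ?_)
    ring
  have := norm_setIntegral_le_of_norm_le_const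
    (measure_ne_top_of_subset (hS.trans Set.sdiff_subset) hfin).lt_top hb
  rw [Real.norm_eq_abs] at this
  refine this.trans ?_
  calc 2 * (G + 2 * (A + B)) * (√a / a ^ 2) * volume.real S
      ≤ 2 * (G + 2 * (A + B)) * (√a / a ^ 2) * (16 * a * δ) := by gcongr
    _ = 32 * δ * (G + 2 * (A + B)) * (√a / a) := by field_simp; ring
    _ = _ := by
      rw [Real.sqrt_div_self', one_div]

lemma HalfHolder.tendsto_setIntegral_sub (h : HalfHolder W A B G) {x z : ℝ × ℝ} {r : ℝ}
    (hz : z.2 ≠ 0) (hr : 0 < r) :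
    Tendsto (fun a => (∫ y in sq x a, regInt W r z y) - ∫ y in sq z a, regInt W r z y)
      atTop (𝓝 0) := by
  have hlim : Tendsto (fun a : ℝ => 2 * (32 * ‖x - z‖ * (G + 2 * (A + B)) * (√a)⁻¹)) atTop
      (𝓝 0) := by
    have := ((tendsto_inv_atTop_zero.comp Real.tendsto_sqrt_atTop).const_mul
      (32 * ‖x - z‖ * (G + 2 * (A + B)))).const_mul 2
    simpa only [mul_zero, Function.comp_def] using this
  refine squeeze_zero_norm' ?_ hlim
  filter_upwards [eventually_ge_atTop (2 * ‖x - z‖ + 2 * r + ‖x‖ + 1)] with a ha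
  have hδ0 : 0 ≤ ‖x - z‖ := norm_nonneg _
  have hx0 := norm_nonneg x
  have i1 : IntegrableOn (regInt W r z) (sq x a) :=
    (h.integrableOn_regInt hz hr (a + ‖x - z‖)).mono_set fun y hy => by
      rw [mem_sq_iff] at *
      have := norm_add_le (z - x) (x - y)
      rw [sub_add_sub_cancel, norm_sub_rev z x] at this
      linarith
  have i2 := h.integrableOn_regInt hz hr a
  rw [← integral_inter_add_sdiff (measurableSet_sq z a) i1,
    ← integral_inter_add_sdiff (measurableSet_sq x a) i2, Set.inter_comm (sq z a),
    add_sub_add_left_eq_sub, Real.norm_eq_abs, two_mul]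
  refine (abs_sub _ _).trans (add_le_add (h.abs_setIntegral_sdiff_le ?_ ?_ hr ha)
    (h.abs_setIntegral_sdiff_le ?_ ?_ hr ha))
  · rintro y ⟨h1, h2⟩
    rw [mem_sq_iff] at h1 h2
    rw [Set.mem_sdiff, mem_sq_iff, mem_sq_iff]
    have := norm_add_le (z - x) (x - y)
    rw [sub_add_sub_cancel, norm_sub_rev z x] at this
    constructor <;> linarith
  · rintro y ⟨h1, h2⟩
    rw [mem_sq_iff] at h2
    linarith
  · rintro y ⟨h1, h2⟩
    rw [mem_sq_iff] at h1 h2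
    rw [Set.mem_sdiff, mem_sq_iff, mem_sq_iff]
    have := norm_add_le (x - z) (z - y)
    rw [sub_add_sub_cancel] at this
    constructor <;> linarith
  · rintro y ⟨h1, h2⟩
    rw [mem_sq_iff] at h2
    have := norm_add_le (x - z) (z - y)
    rw [sub_add_sub_cancel] at this
    linarith

lemma HalfHolder.tendsto_regInt_sub (h : HalfHolder W A B G) {x z : ℝ × ℝ} {r : ℝ}
    (hx : x.2 ≠ 0) (hz : z.2 ≠ 0) (hr : 0 < r) :
    Tendsto (fun a => (∫ y in sq x a, regInt W r x y) - ∫ y in sq z a, regInt W r z y)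
      atTop (𝓝 (∫ y, (regInt W r x y - regInt W r z y))) := by
  have hc : AECover (volume : Measure (ℝ × ℝ)) atTop fun a => sq x a := by
    simp only [sq_eq_closedBall]
    exact aecover_closedBall tendsto_id
  have h1 := hc.integral_tendsto_of_countably_generated (h.integrable_regInt_sub hx hz hr)
  have h2 := h1.add (h.tendsto_setIntegral_sub (x := x) hz hr)
  rw [add_zero] at h2
  refine h2.congr fun a => ?_
  have i1 : IntegrableOn (regInt W r z) (sq x a) :=
    (h.integrableOn_regInt hz hr (a + ‖x - z‖)).mono_set fun y hy => by
      rw [mem_sq_iff] at *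
      have := norm_add_le (z - x) (x - y)
      rw [sub_add_sub_cancel, norm_sub_rev z x] at this
      linarith
  rw [integral_sub (h.integrableOn_regInt hx hr a) i1]
  ring

lemma HalfHolder.setIntegral_reflect (h : HalfHolder W A B G) {x : ℝ × ℝ} (hx : x.2 ≠ 0)
    (r a : ℝ) :
    ∫ y in sq (x.1, -x.2) a, regInt W r (x.1, -x.2) y = -∫ y in sq x a, regInt W r x y := by
  have hm : ∀ b, ∀ y : ℝ × ℝ, (y.1, -y.2) ∈ sq (x.1, -x.2) b ↔ y ∈ sq x b := by
    intro b y
    simp only [sq, Set.mem_ofPred_eq]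
    rw [show -x.2 - -y.2 = -(x.2 - y.2) by ring, abs_neg]
  rw [← measurePreserving_reflect.setIntegral_preimage_emb measurableEmbedding_reflect,
    ← integral_neg]
  have hs : (fun y : ℝ × ℝ => (y.1, -y.2)) ⁻¹' sq (x.1, -x.2) a = sq x a :=
    Set.ext fun y => hm a y
  rw [hs]
  refine integral_congr_ae (ae_restrict_of_ae ?_)
  have hae : ∀ᵐ y : ℝ × ℝ, y.2 ≠ 0 :=
    (Measure.quasiMeasurePreserving_snd (μ := (volume : Measure ℝ))
      (ν := (volume : Measure ℝ))).ae (Measure.ae_ne volume 0)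
  filter_upwards [hae] with y hy
  have hK : K₂ ((x.1, -x.2) - (y.1, -y.2)) = K₂ (x - y) := by
    simp only [K₂, Prod.fst_sub, Prod.snd_sub]
    ring
  rw [regInt, regInt, hK, h.odd y hy, indicator_const_congr (hm r y), h.odd x hx]
  by_cases hxy : y ∈ sq x r
  · rw [Set.indicator_of_mem hxy, Set.indicator_of_mem hxy]; ring
  · rw [Set.indicator_of_notMem hxy, Set.indicator_of_notMem hxy]; ring

/-- The limit of the principal values over growing squares. -/
noncomputable def pvLimit (W : ℝ × ℝ → ℝ) (x : ℝ × ℝ) : ℝ :=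
  1 / 2 * ∫ y, (regInt W 1 x y - regInt W 1 (x.1, -x.2) y)

/-- A single integral need not converge absolutely at infinity. By oddness the integral about the
mirror point is its negative, so it is half a difference of integrals at two centres, and such
differences converge. -/
lemma HalfHolder.tendsto_pvLimit (h : HalfHolder W A B G) {x : ℝ × ℝ} (hx : x.2 ≠ 0) :
    Tendsto (fun a => ∫ y in sq x a, regInt W 1 x y) atTop (𝓝 (pvLimit W x)) := by
  have h1 := (h.tendsto_regInt_sub hx (z := (x.1, -x.2)) (neg_ne_zero.2 hx) one_pos).const_mul (1 / 2)
  refine h1.congr fun a => ?_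
  rw [h.setIntegral_reflect hx]
  ring

/-- Both sides are the same principal value, so the regularization radius can be matched to the
distance of the points. -/
lemma HalfHolder.setIntegral_regInt_eq (h : HalfHolder W A B G) {x : ℝ × ℝ} (hx : x.2 ≠ 0)
    {a r r' : ℝ} (hr : 0 < r) (hr' : 0 < r') (hra : r ≤ a) (hra' : r' ≤ a) :
    ∫ y in sq x a, regInt W r x y = ∫ y in sq x a, regInt W r' x y :=
  tendsto_nhds_unique (h.tendsto_annulus hx hr hra) (h.tendsto_annulus hx hr' hra')

lemma HalfHolder.pvLimit_sub (h : HalfHolder W A B G) {x z : ℝ × ℝ} {r : ℝ}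
    (hx : x.2 ≠ 0) (hz : z.2 ≠ 0) (hr : 0 < r) :
    pvLimit W x - pvLimit W z = ∫ y, (regInt W r x y - regInt W r z y) := by
  refine tendsto_nhds_unique ((h.tendsto_pvLimit hx).sub (h.tendsto_pvLimit hz))
    ((h.tendsto_regInt_sub hx hz hr).congr' ?_)
  filter_upwards [eventually_ge_atTop (max 1 r)] with a ha
  rw [h.setIntegral_regInt_eq hx hr one_pos (le_of_max_le_right ha) (le_of_max_le_left ha),
    h.setIntegral_regInt_eq hz hr one_pos (le_of_max_le_right ha) (le_of_max_le_left ha)]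

end LimitAtInfinity

/-! ### Regularity of the odd extension. -/

section OddExtension

variable {ω : ℝ × ℝ → ℝ}

lemma abs_sub_le_of_ofReal_div_le {a d : ℝ} {S : ℝ≥0∞} (hS : S ≠ ∞) (hd : d = 0 → a = 0)
    (h : ENNReal.ofReal |a| / ENNReal.ofReal (|d| ^ (1 / 2 : ℝ)) ≤ S) :
    |a| ≤ S.toReal * √|d| := by
  rcases eq_or_ne d 0 with h0 | h0
  · rw [hd h0, h0]; simp
  · have hp : 0 < √|d| := Real.sqrt_pos.2 (abs_pos.2 h0)
    rw [← Real.sqrt_eq_rpow, ENNReal.div_le_iff (by simpa using h0) ENNReal.ofReal_ne_top,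
      ← ENNReal.ofReal_toReal hS, ← ENNReal.ofReal_mul ENNReal.toReal_nonneg,
      ENNReal.ofReal_le_ofReal_iff (by positivity)] at h
    exact h

lemma abs_sub_le_semiX (h : semiX (1 / 2) halfPlane ω ≠ ∞) {t : ℝ} (ht : 0 ≤ t) (s s' : ℝ) :
    |ω (s, t) - ω (s', t)| ≤ (semiX (1 / 2) halfPlane ω).toReal * √|s - s'| := by
  refine abs_sub_le_of_ofReal_div_le h (fun h0 => ?_) ?_
  · rw [sub_eq_zero.1 h0, sub_self]
  · exact le_iSup₂_of_le (s, t) (by exact ht) (le_iSup₂_of_le (s', t) (by exact ht)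
      (le_iSup_of_le rfl le_rfl))

lemma abs_sub_le_semiY (h : semiY (1 / 2) halfPlane ω ≠ ∞) {t t' : ℝ} (ht : 0 ≤ t) (ht' : 0 ≤ t')
    (s : ℝ) :
    |ω (s, t) - ω (s, t')| ≤ (semiY (1 / 2) halfPlane ω).toReal * √|t - t'| := by
  refine abs_sub_le_of_ofReal_div_le h (fun h0 => ?_) ?_
  · rw [sub_eq_zero.1 h0, sub_self]
  · exact le_iSup₂_of_le (s, t) (by exact ht) (le_iSup₂_of_le (s, t') (by exact ht')
      (le_iSup_of_le rfl le_rfl))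

lemma oddExt_of_nonneg {y : ℝ × ℝ} (h : 0 ≤ y.2) : oddExt ω y = ω y := if_pos h

lemma oddExt_of_neg {y : ℝ × ℝ} (h : y.2 < 0) : oddExt ω y = -ω (y.1, -y.2) :=
  if_neg (not_le.2 h)

/-- The odd extension may jump at the boundary; its measurability is deduced from this continuous
even version and a sign. -/
lemma continuous_even_reflection {A B : ℝ}
    (hX : ∀ t, 0 ≤ t → ∀ s s', |ω (s, t) - ω (s', t)| ≤ A * √|s - s'|)
    (hY : ∀ s t t', 0 ≤ t → 0 ≤ t' → |ω (s, t) - ω (s, t')| ≤ B * √|t - t'|) :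
    Continuous fun y : ℝ × ℝ => ω (y.1, |y.2|) := by
  rw [continuous_iff_continuousAt]
  intro x
  rw [ContinuousAt, tendsto_iff_dist_tendsto_zero]
  have hlim : Tendsto (fun y : ℝ × ℝ => A * √|y.1 - x.1| + B * √|(|y.2| - |x.2|)|) (𝓝 x) (𝓝 0) := by
    have : Continuous fun y : ℝ × ℝ => A * √|y.1 - x.1| + B * √|(|y.2| - |x.2|)| := by fun_prop
    simpa using this.tendsto x
  refine squeeze_zero (fun _ => dist_nonneg) (fun y => ?_) hlim
  rw [Real.dist_eq]
  exact (abs_sub_le _ (ω (x.1, |y.2|)) _).trans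
    (add_le_add (hX _ (abs_nonneg _) _ _) (hY _ _ _ (abs_nonneg _) (abs_nonneg _)))

lemma halfHolder_oddExt (h1 : semiX (1 / 2) halfPlane ω ≠ ∞) (h2 : semiY (1 / 2) halfPlane ω ≠ ∞) :
    HalfHolder (oddExt ω) (semiX (1 / 2) halfPlane ω).toReal (semiY (1 / 2) halfPlane ω).toReal
      |ω (0, 0)| where
  meas := by
    have hc := (continuous_even_reflection (ω := ω)
      (fun t ht s s' => abs_sub_le_semiX h1 ht s s')
      (fun s t t' ht ht' => abs_sub_le_semiY h2 ht ht' s)).measurable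
    have e : oddExt ω = fun y => if 0 ≤ y.2 then ω (y.1, |y.2|) else -ω (y.1, |y.2|) := by
      funext y
      rcases le_or_gt 0 y.2 with h | h
      · rw [oddExt_of_nonneg h, if_pos h, abs_of_nonneg h]
      · rw [oddExt_of_neg h, if_neg (not_le.2 h), abs_of_neg h]
    rw [e]
    exact Measurable.ite (measurableSet_le measurable_const measurable_snd) hc hc.neg
  A_nonneg := ENNReal.toReal_nonneg
  B_nonneg := ENNReal.toReal_nonneg
  G_nonneg := abs_nonneg _
  horiz t s s' := by
    rcases le_or_gt 0 t with h | h
    · rw [oddExt_of_nonneg h, oddExt_of_nonneg h]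
      exact abs_sub_le_semiX h1 h s s'
    · rw [oddExt_of_neg h, oddExt_of_neg h, neg_sub_neg, abs_sub_comm]
      exact abs_sub_le_semiX h1 (by simpa using h.le) s s'
  vert s t t' ht := by
    rcases ht with ⟨h, h'⟩ | ⟨h, h'⟩
    · rw [oddExt_of_nonneg h, oddExt_of_nonneg h']
      exact abs_sub_le_semiY h2 h h' s
    · rw [oddExt_of_neg h, oddExt_of_neg h', neg_sub_neg]
      refine (abs_sub_le_semiY h2 (by simpa using h'.le) (by simpa using h.le) s).trans (le_of_eq ?_)
      rw [neg_sub_neg]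
  growth y := by
    have e : |oddExt ω y| = |ω (y.1, |y.2|)| := by
      rcases le_or_gt 0 y.2 with h | h
      · rw [oddExt_of_nonneg h, abs_of_nonneg h]
      · rw [oddExt_of_neg h, abs_neg, abs_of_neg h]
    have k1 := abs_sub_le_semiX h1 (le_refl 0) y.1 0
    have k2 := abs_sub_le_semiY h2 (abs_nonneg y.2) le_rfl y.1
    simp only [sub_zero, abs_abs] at k1 k2
    have k3 := abs_add_three (ω (y.1, |y.2|) - ω (y.1, 0)) (ω (y.1, 0) - ω (0, 0)) (ω (0, 0))
    rw [sub_add_sub_cancel, sub_add_cancel] at k3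
    rw [e]
    linarith
  odd y hy := by
    rcases hy.lt_or_gt with h | h
    · rw [oddExt_of_neg h, oddExt_of_nonneg (by simpa using h.le), neg_neg]
    · rw [oddExt_of_nonneg h.le, oddExt_of_neg (by simpa using h), neg_neg]

end OddExtension

/-! ### Hölder bounds for the velocity gradient up to the boundary. -/

section Velocity

variable {ω : ℝ × ℝ → ℝ} {A B G : ℝ}

lemma HalfHolder.tendsto_truncInt (h : HalfHolder (oddExt ω) A B G) {x : ℝ × ℝ} (hx : 0 < x.2)
    {a r : ℝ} (hr : 0 < r) (hra : r ≤ a) :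
    Tendsto (truncInt ω x a) (𝓝[>] 0) (𝓝 (∫ y in sq x a, regInt (oddExt ω) r x y)) :=
  h.tendsto_annulus hx.ne' hr hra

lemma HalfHolder.tendsto_pvInt (h : HalfHolder (oddExt ω) A B G) {x : ℝ × ℝ} (hx : 0 < x.2) :
    Tendsto (pvInt ω x) atTop (𝓝 (pvLimit (oddExt ω) x)) := by
  refine (h.tendsto_pvLimit hx.ne').congr' ?_
  filter_upwards [eventually_ge_atTop 1] with a ha
  exact (h.tendsto_truncInt hx one_pos ha).limUnder_eq.symm

lemma HalfHolder.tendsto_uyLoc (h : HalfHolder (oddExt ω) A B G) {x : ℝ × ℝ} (hx : 0 < x.2) :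
    Tendsto (uyLoc ω x) atTop (𝓝 (1 / Real.pi * pvLimit (oddExt ω) x + ω x / 2)) :=
  ((h.tendsto_pvInt hx).const_mul _).add_const _

lemma HalfHolder.tendsto_vxLoc (h : HalfHolder (oddExt ω) A B G) {x : ℝ × ℝ} (hx : 0 < x.2) :
    Tendsto (vxLoc ω x) atTop (𝓝 (1 / Real.pi * pvLimit (oddExt ω) x - ω x / 2)) :=
  ((h.tendsto_pvInt hx).const_mul _).sub_const _

lemma HalfHolder.uyInf_eq (h : HalfHolder (oddExt ω) A B G) {x : ℝ × ℝ} (hx : 0 < x.2) :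
    uyInf ω x = 1 / Real.pi * pvLimit (oddExt ω) x + ω x / 2 := by
  rw [uyInf, if_pos hx, (h.tendsto_uyLoc hx).limUnder_eq]

lemma HalfHolder.vxInf_eq (h : HalfHolder (oddExt ω) A B G) {x : ℝ × ℝ} (hx : 0 < x.2) :
    vxInf ω x = 1 / Real.pi * pvLimit (oddExt ω) x - ω x / 2 := by
  rw [vxInf, if_pos hx, (h.tendsto_vxLoc hx).limUnder_eq]

/-- Multiplied by `π`, the local terms `±ω/2` give the `±π/2` increments of the integral estimate,
with regularization radius `a - b`. -/
lemma HalfHolder.abs_sub_le_of_lt (h : HalfHolder (oddExt ω) A B G) {τ M p a b : ℝ}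
    (hAM : A ≤ M) (hBM : B ≤ τ * M) (hb : 0 < b) (hab : b < a) :
    |uyInf ω (p, a) - uyInf ω (p, b)| ≤ constU τ / Real.pi * M * √|a - b| ∧
    |vxInf ω (p, a) - vxInf ω (p, b)| ≤ constV τ / Real.pi * M * √|a - b| := by
  have ha : 0 < a := hb.trans hab
  have hd := sub_pos.2 hab
  have hY : ∀ s, ∀ t ∈ Set.Icc b a, ∀ t' ∈ Set.Icc b a,
      |oddExt ω (s, t) - oddExt ω (s, t')| ≤ B * √|t - t'| := fun s t ht t' ht' =>
    h.vert s t t' (Or.inl ⟨hb.le.trans ht.1, hb.le.trans ht'.1⟩)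
  have k := abs_integral_regInt_sub_le h.A_nonneg h.B_nonneg hAM hBM hab h.horiz hY
    (h.integrable_regInt_sub (x := (p, a)) (z := (p, b)) ha.ne' hb.ne' hd)
  rw [← h.pvLimit_sub (x := (p, a)) (z := (p, b)) ha.ne' hb.ne' hd,
    oddExt_of_nonneg (y := (p, a)) ha.le, oddExt_of_nonneg (y := (p, b)) hb.le] at k
  have hp := Real.pi_pos
  rw [h.uyInf_eq (x := (p, a)) ha, h.uyInf_eq (x := (p, b)) hb, h.vxInf_eq (x := (p, a)) ha,
    h.vxInf_eq (x := (p, b)) hb, abs_of_pos hd]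
  constructor
  · calc |1 / Real.pi * pvLimit (oddExt ω) (p, a) + ω (p, a) / 2 -
          (1 / Real.pi * pvLimit (oddExt ω) (p, b) + ω (p, b) / 2)|
        = |1 / Real.pi * (pvLimit (oddExt ω) (p, a) - pvLimit (oddExt ω) (p, b) +
            Real.pi / 2 * (ω (p, a) - ω (p, b)))| := by
          congr 1; field_simp; ring
      _ = 1 / Real.pi * |pvLimit (oddExt ω) (p, a) - pvLimit (oddExt ω) (p, b) +
            Real.pi / 2 * (ω (p, a) - ω (p, b))| := by
          rw [abs_mul, abs_of_pos (by positivity)]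
      _ ≤ 1 / Real.pi * (constU τ * M * √(a - b)) := by gcongr; exact k.1
      _ = _ := by ring
  · calc |1 / Real.pi * pvLimit (oddExt ω) (p, a) - ω (p, a) / 2 -
          (1 / Real.pi * pvLimit (oddExt ω) (p, b) - ω (p, b) / 2)|
        = |1 / Real.pi * (pvLimit (oddExt ω) (p, a) - pvLimit (oddExt ω) (p, b) -
            Real.pi / 2 * (ω (p, a) - ω (p, b)))| := by
          congr 1; field_simp; ring
      _ = 1 / Real.pi * |pvLimit (oddExt ω) (p, a) - pvLimit (oddExt ω) (p, b) -
            Real.pi / 2 * (ω (p, a) - ω (p, b))| := by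
          rw [abs_mul, abs_of_pos (by positivity)]
      _ ≤ 1 / Real.pi * (constV τ * M * √(a - b)) := by gcongr; exact k.2
      _ = _ := by ring

lemma HalfHolder.abs_sub_le_of_pos (h : HalfHolder (oddExt ω) A B G) {τ M p a b : ℝ}
    (hAM : A ≤ M) (hBM : B ≤ τ * M) (ha : 0 < a) (hb : 0 < b) :
    |uyInf ω (p, a) - uyInf ω (p, b)| ≤ constU τ / Real.pi * M * √|a - b| ∧
    |vxInf ω (p, a) - vxInf ω (p, b)| ≤ constV τ / Real.pi * M * √|a - b| := by
  rcases lt_trichotomy a b with hab | hab | hab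
  · rw [abs_sub_comm, abs_sub_comm (vxInf _ _), abs_sub_comm a]
    exact h.abs_sub_le_of_lt hAM hBM ha hab
  · subst hab; simp
  · exact h.abs_sub_le_of_lt hAM hBM hb hab

/-- The bound makes the images of right neighbourhoods of `0` Cauchy. -/
lemma exists_tendsto_zero_right {φ : ℝ → ℝ} {L : ℝ}
    (h : ∀ a b, 0 < a → 0 < b → |φ a - φ b| ≤ L * √|a - b|) :
    ∃ l, Tendsto φ (𝓝[>] 0) (𝓝 l) := by
  have hc : Cauchy (map φ (𝓝[>] 0)) := by
    rw [Metric.cauchy_iff]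
    refine ⟨inferInstance, fun ε hε => ?_⟩
    have hlim : Tendsto (fun δ : ℝ => |L| * √δ) (𝓝[>] 0) (𝓝 0) := by
      have : Continuous fun δ : ℝ => |L| * √δ := by fun_prop
      simpa using (this.tendsto 0).mono_left nhdsWithin_le_nhds
    obtain ⟨δ, hδ, hδ0⟩ := ((hlim.eventually (gt_mem_nhds hε)).and self_mem_nhdsWithin).exists
    refine ⟨φ '' Set.Ioo 0 δ, image_mem_map (Ioo_mem_nhdsGT hδ0), ?_⟩
    rintro _ ⟨a, ha, rfl⟩ _ ⟨b, hb, rfl⟩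
    rw [Real.dist_eq]
    refine lt_of_le_of_lt ((h a b ha.1 hb.1).trans ?_) hδ
    have : |a - b| ≤ δ := by
      rw [abs_le]; constructor <;> linarith [ha.1, ha.2, hb.1, hb.2]
    exact mul_le_mul (le_abs_self L) (Real.sqrt_le_sqrt this) (Real.sqrt_nonneg _) (abs_nonneg _)
  exact CompleteSpace.complete hc

lemma abs_sub_le_of_tendsto_zero_right {φ : ℝ → ℝ} {L : ℝ}
    (h : ∀ a b, 0 < a → 0 < b → |φ a - φ b| ≤ L * √|a - b|)
    (h0 : Tendsto φ (𝓝[>] 0) (𝓝 (φ 0))) {a b : ℝ} (ha : 0 ≤ a) (hb : 0 ≤ b) :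
    |φ a - φ b| ≤ L * √|a - b| := by
  have key : ∀ c, 0 < c → |φ c - φ 0| ≤ L * √|c - 0| := by
    intro c hc
    have hr : Tendsto (fun b : ℝ => L * √|c - b|) (𝓝[>] 0) (𝓝 (L * √|c - 0|)) := by
      have : Continuous fun b : ℝ => L * √|c - b| := by fun_prop
      exact (this.tendsto 0).mono_left nhdsWithin_le_nhds
    refine le_of_tendsto_of_tendsto (h0.const_sub (φ c)).abs hr ?_
    filter_upwards [self_mem_nhdsWithin] with b hb
    exact h c b hc hb
  rcases ha.eq_or_lt with rfl | ha
  · rcases hb.eq_or_lt with rfl | hb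
    · simp
    · rw [abs_sub_comm, abs_sub_comm 0]
      exact key b hb
  · rcases hb.eq_or_lt with rfl | hb
    · exact key a ha
    · exact h a b ha hb

lemma HalfHolder.tendsto_boundary (h : HalfHolder (oddExt ω) A B G) (p : ℝ) :
    Tendsto (fun t : ℝ => uyInf ω (p, t)) (𝓝[>] 0) (𝓝 (uyInf ω (p, 0))) ∧
    Tendsto (fun t : ℝ => vxInf ω (p, t)) (𝓝[>] 0) (𝓝 (vxInf ω (p, 0))) := by
  -- Existence of the boundary limits needs only some finite Hölder constant, so `τ = 1` serves.
  have hb := fun a b (ha : 0 < a) (hb : 0 < b) => h.abs_sub_le_of_pos (τ := 1) (M := max A B)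
    (p := p) (le_max_left _ _) (by rw [one_mul]; exact le_max_right _ _) ha hb
  obtain ⟨l, hl⟩ := exists_tendsto_zero_right fun a b ha hb' => (hb a b ha hb').1
  obtain ⟨m, hm⟩ := exists_tendsto_zero_right fun a b ha hb' => (hb a b ha hb').2
  have e1 : uyInf ω (p, 0) = l := by
    rw [uyInf, if_neg (lt_irrefl _)]
    refine (hl.congr' ?_).limUnder_eq
    filter_upwards [self_mem_nhdsWithin] with t ht
    exact if_pos ht
  have e2 : vxInf ω (p, 0) = m := by
    rw [vxInf, if_neg (lt_irrefl _)]
    refine (hm.congr' ?_).limUnder_eq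
    filter_upwards [self_mem_nhdsWithin] with t ht
    exact if_pos ht
  rw [e1, e2]
  exact ⟨hl, hm⟩

lemma HalfHolder.limitsExist (h : HalfHolder (oddExt ω) A B G) : LimitsExist ω := by
  refine ⟨fun x hx => ⟨fun a ε hε => h.integrableOn_ker_mul x a hε, fun a ha => ?_, ?_, ?_⟩,
    h.tendsto_boundary⟩
  · have ht := h.tendsto_truncInt hx ha le_rfl
    rwa [pvInt, ht.limUnder_eq]
  · rw [h.uyInf_eq hx]; exact h.tendsto_uyLoc hx
  · rw [h.vxInf_eq hx]; exact h.tendsto_vxLoc hx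

lemma HalfHolder.abs_sub_le_of_nonneg (h : HalfHolder (oddExt ω) A B G) {τ M p a b : ℝ}
    (hAM : A ≤ M) (hBM : B ≤ τ * M) (ha : 0 ≤ a) (hb : 0 ≤ b) :
    |uyInf ω (p, a) - uyInf ω (p, b)| ≤ constU τ / Real.pi * M * √|a - b| ∧
    |vxInf ω (p, a) - vxInf ω (p, b)| ≤ constV τ / Real.pi * M * √|a - b| :=
  ⟨abs_sub_le_of_tendsto_zero_right (φ := fun t => uyInf ω (p, t))
      (fun _ _ ha hb => (h.abs_sub_le_of_pos hAM hBM ha hb).1) (h.tendsto_boundary p).1 ha hb,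
    abs_sub_le_of_tendsto_zero_right (φ := fun t => vxInf ω (p, t))
      (fun _ _ ha hb => (h.abs_sub_le_of_pos hAM hBM ha hb).2) (h.tendsto_boundary p).2 ha hb⟩

end Velocity

end HolderVel

theorem lemma3p4 :
    ∃ C₃ C₄ : ℝ → ℝ,
      (∀ τ : ℝ, 0 < τ → 0 < C₃ τ ∧ 0 < C₄ τ) ∧
      1 / Real.pi * C₃ 0.582 ≤ 2.60 ∧
      1 / Real.pi * C₄ 0.582 ≤ 2.61 ∧
      ∀ ω : ℝ × ℝ → ℝ,
        HolderVel.semiX (1 / 2) HolderVel.halfPlane ω ≠ ∞ →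
        HolderVel.semiY (1 / 2) HolderVel.halfPlane ω ≠ ∞ →
        HolderVel.LimitsExist ω ∧
        ∀ τ : ℝ, 0 < τ → ∀ x₁ x₂ z₂ : ℝ, 0 ≤ x₂ → 0 ≤ z₂ → x₂ ≠ z₂ →
          |HolderVel.vxInf ω (x₁, x₂) - HolderVel.vxInf ω (x₁, z₂)| / |x₂ - z₂| ^ (1 / 2 : ℝ)
            ≤ C₃ τ / Real.pi *
              max (HolderVel.semiX (1 / 2) HolderVel.halfPlane ω).toReal
                (τ⁻¹ * (HolderVel.semiY (1 / 2) HolderVel.halfPlane ω).toReal) ∧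
          |HolderVel.uyInf ω (x₁, x₂) - HolderVel.uyInf ω (x₁, z₂)| / |x₂ - z₂| ^ (1 / 2 : ℝ)
            ≤ C₄ τ / Real.pi *
              max (HolderVel.semiX (1 / 2) HolderVel.halfPlane ω).toReal
                (τ⁻¹ * (HolderVel.semiY (1 / 2) HolderVel.halfPlane ω).toReal) := by
  refine ⟨HolderVel.constV, HolderVel.constU,
    fun τ hτ => ⟨HolderVel.constV_pos hτ, HolderVel.constU_pos hτ⟩,
    HolderVel.constV_le, HolderVel.constU_le, fun ω h1 h2 => ?_⟩
  have h := HolderVel.halfHolder_oddExt h1 h2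
  refine ⟨h.limitsExist, fun τ hτ x₁ x₂ z₂ hx hz hne => ?_⟩
  have hBM : (HolderVel.semiY (1 / 2) HolderVel.halfPlane ω).toReal ≤
      τ * max (HolderVel.semiX (1 / 2) HolderVel.halfPlane ω).toReal
        (τ⁻¹ * (HolderVel.semiY (1 / 2) HolderVel.halfPlane ω).toReal) := by
    rw [← inv_mul_le_iff₀ hτ]
    exact le_max_right _ _
  have hd : 0 < √|x₂ - z₂| := Real.sqrt_pos.2 (abs_pos.2 (sub_ne_zero.2 hne))
  have k := h.abs_sub_le_of_nonneg (τ := τ) (p := x₁) (le_max_left _ _) hBM hx hz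
  rw [← Real.sqrt_eq_rpow, div_le_iff₀ hd, div_le_iff₀ hd]
  exact ⟨k.2, k.1⟩
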